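/- **Setting.** Let $\mathbb S^1=\mathbb R/\mathbb Z$ with Lebesgue measure $m$. For $\lambda>1$ and $A_*\ge 0$ let $\mathcal M=\mathcal M(\lambda,A_*)$ be the set of $C^2$ maps $T:\mathbb S^1\to\mathbb S^1$ with $\inf T'\ge\lambda$ and $\|T''\|_\infty\le A_*$ (derivatives of a lift). For $T_1,T_2,\dots\in\mathcal M$ write $\mathcal T_{c,a}=T_c\circ\cdots\circ T_a$, $\mathcal T_i=\mathcal T_{i,1}$, $\mathcal T_0=\mathrm{Id}$, and let $\mathcal L_{c,a}$ be the transfer operator of $\mathcal T_{c,a}$, i.e. $\mathcal L_{c,a}\psi$ is the density with respect to $m$ of the push-forward of $\psi\,dm$ under $\mathcal T_{c,a}$. Let $\mu=\varrho\,dm$ be a probability measure with $\varrho>0$, $\log\varrho$ Lipschitz and $L_0=\operatorname{Lip}(\log\varrho)$. Let $f:\mathbb S^1\to\mathbb R^d$ be Lipschitz, $\|f\|_\infty=\max_\alpha\|f_\alpha\|_\infty$ and $\|f\|_{\mathrm{Lip}}=\|f\|_\infty+\max_\alpha\operatorname{Lip}(f_\alpha)$. Put $\bar f^i=f\circ\mathcal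 T_i-\mu(f\circ\mathcal T_i)$, $$W=W(N)=\frac1{\sqrt N}\sum_{i=0}^{N-1}\bar f^i,\qquad \Sigma_N=\frac1N\sum_{i,j=0}^{N-1}\mu(\bar f^i\otimes\bar f^j),\qquad \Phi_\Sigma(h)=\frac1{\sqrt{(2\pi)^d\det\Sigma}}\int_{\mathbb R^d}e^{-\frac12 w\cdot\Sigma^{-1}w}h(w)\,dw .$$ For $h:\mathbb R^d\to\mathbb R$ let $\|D^kh\|_\infty$ be the maximum of the sup norms of all partial derivatives of $h$ of order $k$. **Theorem 3.1 (multivariate circle theorem).** There are constants $\vartheta=\vartheta(\lambda,A_*)\in(0,1)$ with $\vartheta\ge\lambda^{-1}$, $B_0=B_0(\lambda,A_*,L_0)>0$, $C_2=C_2(\lambda,A_*,\|f\|_{\mathrm{Lip}},L_0)>0$ and $C_4=C_4(\lambda,A_*,\|f\|_{\mathrm{Lip}},L_0)>0$, depending only on the quantities in brackets, such that for all $\lambda>1$, $A_*\ge0$, every sequence $(T_i)_{i\ge1}\subset\mathcal M(\lambda,A_*)$, every $\varrho$ as above, every $d$ and every Lipschitz $f:\mathbb S^1\to\mathbb R^d$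 the following holds. 1. (Role of $B_0$.) $\|\mathcal L_{c,a}\varrho-\mathcal L_{c,b}\varrho\|_{L^1(m)}\le B_0\,\vartheta^{\,c-b+1}$ for all $1\le a\le b\le c$. 2. (Role of $C_2,C_4$.) For all $0\le i\le j\le k\le l$, all $\alpha',\beta'\in\{1,\dots,d\}$ and all $\alpha,\beta,\gamma,\delta\in\{\alpha',\beta'\}$, $$|\mu(\bar f^i_\alpha\bar f^j_\beta)|\le C_2\vartheta^{\,j-i},\qquad |\mu(\bar f^i_\alpha\bar f^j_\beta\bar f^k_\gamma\bar f^l_\delta)|\le C_4\vartheta^{\max\{j-i,\,l-k\}},$$ $$|\mu(\bar f^i_\alpha\bar f^j_\beta\bar f^k_\gamma\bar f^l_\delta)-\mu(\bar f^i_\alpha\bar f^j_\beta)\,\mu(\bar f^k_\gamma\bar f^l_\delta)|\le C_4\vartheta^{\,k-j}.$$ 3. (Central limit theorem with a rate.) Let $h:\mathbb R^d\to\mathbb R$ be three times differentiable with $\|D^kh\|_\infty<\infty$ for $k=1,2,3$, and let $N\ge 16/(1-\vartheta)^2$ be an integer such that $\Sigma_N$ is positive definite. Then $$|\mu(h(W))-\Phi_{\Sigma_N}(h)|\le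 C\,N^{-\frac12}\log N,$$ where $$C=\frac{30d^3\max\{C_2,\sqrt{C_4}\}\left(\|f\|_\infty\|D^3h\|_\infty+\|D^2h\|_\infty\right)}{(1-\vartheta)^2}+2d^2\|D^2h\|_\infty\frac{\|f\|_{\mathrm{Lip}}^2}{\vartheta^{-\frac12}-\vartheta^{\frac12}}+4dB_0\|f\|_{\mathrm{Lip}}\|Dh\|_\infty+\frac{2d\|Dh\|_\infty\|f\|_{\mathrm{Lip}}}{\vartheta^{\frac12}} .$$ -/

import Mathlib

open MeasureTheory
open scoped Matrix

noncomputable section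

namespace CircleCLT

/-- The class of `C²` circle maps with `T' ≥ lam` and `|T''| ≤ A`. The circle is `ℝ / ℤ`, and the
derivatives of a circle map are those of a lift `F : ℝ → ℝ` (lifts differ by integers only). -/
def IsExpanding (lam A : ℝ) (T : UnitAddCircle → UnitAddCircle) : Prop :=
  ∃ F : ℝ → ℝ, ContDiff ℝ 2 F ∧ (∀ x : ℝ, T (x : UnitAddCircle) = (F x : UnitAddCircle)) ∧
    (∀ x, lam ≤ deriv F x) ∧ (∀ x, |deriv (deriv F) x| ≤ A)

/-- The composition `T_{a+n-1} ∘ ⋯ ∘ T_{a+1} ∘ T_a` of `n` consecutive maps, starting with `T_a`. -/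
def seqComp (T : ℕ → UnitAddCircle → UnitAddCircle) (a : ℕ) : ℕ → UnitAddCircle → UnitAddCircle
  | 0 => id
  | n + 1 => T (a + n) ∘ seqComp T a n

/-- The best Lipschitz constant of a real function on the circle (for Lipschitz functions). -/
def lipConst (g : UnitAddCircle → ℝ) : ℝ :=
  ⨆ p : UnitAddCircle × UnitAddCircle, |g p.1 - g p.2| / dist p.1 p.2

/-- Positive probability densities (with respect to Lebesgue measure) with Lipschitz logarithm. -/
def IsLogLipDensity (ϱ : UnitAddCircle → ℝ) : Prop :=
  (∀ x, 0 < ϱ x) ∧ (∃ K, LipschitzWith K (fun x => Real.log (ϱ x))) ∧ ∫ x, ϱ x = 1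

/-- The measure with density `ϱ` with respect to Lebesgue measure. -/
def densityMeasure (ϱ : UnitAddCircle → ℝ) : Measure UnitAddCircle :=
  volume.withDensity (fun x => ENNReal.ofReal (ϱ x))

/-- The transfer operator of `S` applied to the density `ϱ`: the Lebesgue density of the
push-forward under `S` of the measure with density `ϱ`. -/
def transfer (S : UnitAddCircle → UnitAddCircle) (ϱ : UnitAddCircle → ℝ) : UnitAddCircle → ℝ :=
  fun x => (((densityMeasure ϱ).map S).rnDeriv volume x).toReal

section

variable {d : ℕ}

/-- `‖f‖_∞`, the maximum over the coordinates of the sup norms. -/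
def supNorm (f : UnitAddCircle → Fin d → ℝ) : ℝ :=
  ⨆ p : Fin d × UnitAddCircle, |f p.2 p.1|

/-- `‖f‖_Lip = ‖f‖_∞ + Lip(f)`, where `Lip(f)` is the maximum of the Lipschitz constants of the
coordinates. -/
def lipNorm (f : UnitAddCircle → Fin d → ℝ) : ℝ :=
  supNorm f + ⨆ α : Fin d, lipConst (fun x => f x α)

/-- `f̄^i = f ∘ 𝒯_i - μ(f ∘ 𝒯_i)`, where `𝒯_i = T_i ∘ ⋯ ∘ T_1`. -/
def fbar (μ : Measure UnitAddCircle) (T : ℕ → UnitAddCircle → UnitAddCircle)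
    (f : UnitAddCircle → Fin d → ℝ) (i : ℕ) (x : UnitAddCircle) : Fin d → ℝ :=
  fun α => f (seqComp T 1 i x) α - ∫ y, f (seqComp T 1 i y) α ∂μ

/-- `W = N^{-1/2} ∑_{i<N} f̄^i`. -/
def W (μ : Measure UnitAddCircle) (T : ℕ → UnitAddCircle → UnitAddCircle)
    (f : UnitAddCircle → Fin d → ℝ) (N : ℕ) (x : UnitAddCircle) : Fin d → ℝ :=
  (1 / Real.sqrt N) • ∑ i ∈ Finset.range N, fbar μ T f i x

/-- The covariance matrix of `W`. -/
def covMatrix (μ : Measure UnitAddCircle) (T : ℕ → UnitAddCircle → UnitAddCircle)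
    (f : UnitAddCircle → Fin d → ℝ) (N : ℕ) : Matrix (Fin d) (Fin d) ℝ :=
  Matrix.of fun α β => (1 / (N : ℝ)) * ∑ i ∈ Finset.range N, ∑ j ∈ Finset.range N,
    ∫ x, fbar μ T f i x α * fbar μ T f j x β ∂μ

/-- `Φ_Σ(h)`, the expectation of `h` under the centred normal distribution with positive definite
covariance matrix `S`. -/
def gaussExp (S : Matrix (Fin d) (Fin d) ℝ) (h : (Fin d → ℝ) → ℝ) : ℝ :=
  (1 / Real.sqrt ((2 * Real.pi) ^ d * S.det)) *
    ∫ w : Fin d → ℝ, Real.exp (-(1 / 2) * (w ⬝ᵥ (S⁻¹ *ᵥ w))) * h w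

/-- `h` is three times (Fréchet) differentiable. -/
def ThreeTimesDifferentiable (h : (Fin d → ℝ) → ℝ) : Prop :=
  ∀ k < 3, Differentiable ℝ (iteratedFDeriv ℝ k h)

/-- The absolute value of the partial derivative `∂_{α 0} ⋯ ∂_{α (k-1)} h` at `w`,
for the pair `p = (w, α)`. -/
def absPartial (k : ℕ) (h : (Fin d → ℝ) → ℝ) (p : (Fin d → ℝ) × (Fin k → Fin d)) : ℝ :=
  |iteratedFDeriv ℝ k h p.1 (fun i => Pi.single (p.2 i) 1)|

/-- `‖D^k h‖_∞ < ∞`. -/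
def DerivBounded (k : ℕ) (h : (Fin d → ℝ) → ℝ) : Prop :=
  BddAbove (Set.range (absPartial k h))

/-- `‖D^k h‖_∞`, the maximum of the sup norms of the partial derivatives of order `k`. -/
def derivNorm (k : ℕ) (h : (Fin d → ℝ) → ℝ) : ℝ :=
  ⨆ p, absPartial k h p

/-- The decay of pair and quadruple correlations of the `f̄^i` at rate `θ^n`,
with constants `c₂`, `c₄`. -/
def CorrelationDecay (μ : Measure UnitAddCircle) (T : ℕ → UnitAddCircle → UnitAddCircle)
    (f : UnitAddCircle → Fin d → ℝ) (θ c₂ c₄ : ℝ) : Prop :=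
  ∀ α' β' : Fin d, ∀ α ∈ ({α', β'} : Set (Fin d)), ∀ β ∈ ({α', β'} : Set (Fin d)),
    ∀ γ ∈ ({α', β'} : Set (Fin d)), ∀ δ ∈ ({α', β'} : Set (Fin d)),
    ∀ i j k l : ℕ, i ≤ j → j ≤ k → k ≤ l →
      |∫ x, fbar μ T f i x α * fbar μ T f j x β ∂μ| ≤ c₂ * θ ^ (j - i) ∧
      |∫ x, fbar μ T f i x α * fbar μ T f j x β * fbar μ T f k x γ * fbar μ T f l x δ ∂μ|
        ≤ c₄ * θ ^ max (j - i) (l - k) ∧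
      |(∫ x, fbar μ T f i x α * fbar μ T f j x β * fbar μ T f k x γ * fbar μ T f l x δ ∂μ)
          - (∫ x, fbar μ T f i x α * fbar μ T f j x β ∂μ)
            * ∫ x, fbar μ T f k x γ * fbar μ T f l x δ ∂μ|
        ≤ c₄ * θ ^ (k - j)

/-- The constant in the error bound, as a function of `ϑ`, `C₂`, `C₄`, `B₀`, of `f` and of `h`. -/
def cltConst (θ c₂ c₄ b₀ : ℝ) (f : UnitAddCircle → Fin d → ℝ) (h : (Fin d → ℝ) → ℝ) : ℝ :=
  30 * (d : ℝ) ^ 3 * max c₂ (Real.sqrt c₄) *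
      (supNorm f * derivNorm 3 h + derivNorm 2 h) / (1 - θ) ^ 2
    + 2 * (d : ℝ) ^ 2 * derivNorm 2 h *
      (lipNorm f ^ 2 / (θ ^ (-(1 / 2) : ℝ) - θ ^ ((1 / 2) : ℝ)))
    + 4 * (d : ℝ) * b₀ * lipNorm f * derivNorm 1 h
    + 2 * (d : ℝ) * derivNorm 1 h * lipNorm f / θ ^ ((1 / 2) : ℝ)

end

/-- Loss of memory in `L¹` at rate `θ^n` with constant `b₀`: the transfer operators of
`T_c ∘ ⋯ ∘ T_a` and `T_c ∘ ⋯ ∘ T_b` are applied to `ϱ`. -/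
def MemoryLoss (T : ℕ → UnitAddCircle → UnitAddCircle) (ϱ : UnitAddCircle → ℝ) (θ b₀ : ℝ) : Prop :=
  ∀ a b c : ℕ, 1 ≤ a → a ≤ b → b ≤ c →
    ∫ x, |transfer (seqComp T a (c + 1 - a)) ϱ x - transfer (seqComp T b (c + 1 - b)) ϱ x|
      ≤ b₀ * θ ^ (c + 1 - b)

end CircleCLT

end

/-! The proof has a dynamical half, decay of correlations, and a probabilistic half, normal
approximation by approximate integration by parts.

Dynamics. A transfer operator sums over inverse branches, which contract by `lam⁻¹` and whose
weights have log-Lipschitz distortion `A / lam`. It therefore improves a log-Lipschitz constant `K`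
to `(K + A / lam) / lam`. At `K = regConst lam A` there is slack: a constant mass `splitMass lam A`
can be removed from a density before the operator is applied, and the image of the rest still has
constant `K` (`IsPeriodicDensity.split`). The removed mass is the same for any two densities and
cancels in their difference, so their images approach each other exponentially in the sup norm
(`IsPeriodicDensity.contraction`). This gives `memoryLoss`. It also gives decorrelation: if `Ψ`
varies slowly in terms of the position at time `m`, then `m` operators turn `Ψ ρ` into a Lipschitz
function, and the next `n` operators contract its centred part. As the estimate is uniform in the
point, it covers observables `Φ x (𝒯_{m + n} x)` that are not products (`decorrelation`).

Probability. A centred normal vector `Z` with covariance `S` satisfies `E Z_α u(Z) = ∑_β S_αβ E ∂_β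
u(Z)`. `abs_stein_discrepancy_le` shows that `W` satisfies this up to order `N^{-1/2} log N`. For
each `n` the sum `W` is split into a far past `P`, a far future `Q` and a window `Y` of about `K ~
log N` indices around `n`. The term `f̄^n` is almost independent of `P + Q`, so only the linear term
of `u(W)` in `Y` matters, with a remainder quadratic in `Y`. A second decorrelation, with the
doubled window, separates `f̄^n Y_β` from `∂_β u(W)`, and the means of `f̄^n Y_β` add up to the
covariance matrix except for a geometric tail. The remainders are controlled by `E |Y|² = O(K / N)`,
a consequence of summable pair correlations; sup norms would cost another logarithm.

Finally `Z`, taken independent of `W`, is rotated into `W` along `sin t W + cos t Z`. In the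
derivative of the expectation of `h` the two integration by parts formulas cancel up to the
discrepancy (`abs_integral_sub_gaussExp_le`), so no Stein equation has to be solved. -/

noncomputable section

namespace CircleCLT

/-! ### Lifts of expanding circle maps -/

section

open Function

/-- `F` is the lift of an expanding circle map of degree `k`, with `F' ≥ lam` and `|F''| ≤ A`. -/
structure IsLift (lam A : ℝ) (k : ℕ) (F : ℝ → ℝ) : Prop where
  contDiff : ContDiff ℝ 2 F
  shift : ∀ x, F (x + 1) = F x + k
  le_deriv : ∀ x, lam ≤ deriv F x
  abs_deriv_deriv_le : ∀ x, |deriv (deriv F) x| ≤ A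

namespace IsLift

variable {lam A : ℝ} {k : ℕ} {F : ℝ → ℝ}

lemma differentiable (h : IsLift lam A k F) : Differentiable ℝ F :=
  h.contDiff.differentiable (by norm_num)

lemma continuous (h : IsLift lam A k F) : Continuous F := h.contDiff.continuous

lemma continuous_deriv (h : IsLift lam A k F) : Continuous (deriv F) :=
  h.contDiff.continuous_deriv (by norm_num)

lemma differentiable_deriv (h : IsLift lam A k F) : Differentiable ℝ (deriv F) := by
  have : ContDiff ℝ 1 (deriv F) := by
    have h2 : ContDiff ℝ (1 + 1) F := by simpa [one_add_one_eq_two] using h.contDiff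
    exact (contDiff_succ_iff_deriv.1 h2).2.2
  exact this.differentiable (by norm_num)

lemma deriv_pos (hl : 1 < lam) (h : IsLift lam A k F) (x : ℝ) : 0 < deriv F x :=
  lt_of_lt_of_le (by linarith) (h.le_deriv x)

lemma shift_nat (h : IsLift lam A k F) (j : ℕ) (x : ℝ) : F (x + j) = F x + k * j := by
  induction j with
  | zero => simp
  | succ j ih =>
    have := h.shift (x + j)
    push_cast
    rw [← add_assoc, this, ih]; ring

lemma expand_of_le (h : IsLift lam A k F) {x y : ℝ} (hxy : x ≤ y) :
    lam * (y - x) ≤ F y - F x :=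
  mul_sub_le_image_sub_of_le_deriv h.differentiable h.le_deriv hxy

lemma expand (h : IsLift lam A k F) (x y : ℝ) : lam * |x - y| ≤ |F x - F y| := by
  rcases le_total x y with hxy | hxy
  · have := h.expand_of_le hxy
    rw [abs_sub_comm x y, abs_sub_comm (F x), abs_of_nonneg (sub_nonneg.2 hxy)]
    exact this.trans (le_abs_self _)
  · have := h.expand_of_le hxy
    rw [abs_of_nonneg (sub_nonneg.2 hxy)]
    exact this.trans (le_abs_self _)

lemma injective (hl : 1 < lam) (h : IsLift lam A k F) : Injective F := by
  intro x y hxy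
  have := h.expand x y
  rw [hxy, sub_self, abs_zero] at this
  have h0 : |x - y| ≤ 0 := by nlinarith [abs_nonneg (x - y)]
  linarith [abs_nonpos_iff.1 h0]

lemma surjective (hl : 1 < lam) (h : IsLift lam A k F) : Surjective F := by
  apply h.continuous.surjective
  · apply Filter.tendsto_atTop_mono' _ (f₁ := fun x => lam * x + F 0)
    · filter_upwards [Filter.eventually_ge_atTop 0] with x hx
      linarith [h.expand_of_le hx]
    · exact Filter.tendsto_atTop_add_const_right _ _
        (Filter.tendsto_id.const_mul_atTop (by linarith))
  · refine Filter.tendsto_atBot_mono' (f₁ := fun x => lam * x + F 0) _ ?_ ?_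
    · filter_upwards [Filter.eventually_le_atBot 0] with x hx
      linarith [h.expand_of_le hx]
    · exact Filter.tendsto_atBot_add_const_right _ _
        (Filter.tendsto_id.const_mul_atBot (by linarith))

lemma apply_inv (hl : 1 < lam) (h : IsLift lam A k F) (y : ℝ) : F (invFun F y) = y :=
  rightInverse_invFun (h.surjective hl) y

lemma inv_apply (hl : 1 < lam) (h : IsLift lam A k F) (x : ℝ) : invFun F (F x) = x :=
  leftInverse_invFun (h.injective hl) x

lemma inv_contract (hl : 1 < lam) (h : IsLift lam A k F) (x y : ℝ) :
    |invFun F x - invFun F y| ≤ |x - y| / lam := by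
  have := h.expand (invFun F x) (invFun F y)
  rw [h.apply_inv hl, h.apply_inv hl] at this
  rw [le_div_iff₀ (by linarith)]
  linarith

lemma continuous_inv (hl : 1 < lam) (h : IsLift lam A k F) : Continuous (invFun F) := by
  have : LipschitzWith 1 (invFun F) := by
    apply LipschitzWith.of_dist_le_mul
    intro x y
    rw [Real.dist_eq, Real.dist_eq, NNReal.coe_one, one_mul]
    exact (h.inv_contract hl x y).trans (div_le_self (abs_nonneg _) hl.le)
  exact this.continuous

lemma inv_shift (hl : 1 < lam) (h : IsLift lam A k F) (y : ℝ) :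
    invFun F (y + k) = invFun F y + 1 := by
  apply h.injective hl
  rw [h.apply_inv hl, h.shift, h.apply_inv hl]

/-- The logarithmic derivative `F'' / F'` is at most `A / lam` in absolute value. The multiplicative
form follows from the Lipschitz bound on `F'` and `1 + t ≤ e^t`. -/
lemma deriv_distortion (hl : 1 < lam) (h : IsLift lam A k F) (x y : ℝ) :
    deriv F y ≤ Real.exp (A / lam * |x - y|) * deriv F x := by
  have h1 : |deriv F y - deriv F x| ≤ A * |y - x| := by
    have := Convex.norm_image_sub_le_of_norm_deriv_le (s := Set.univ) (f := deriv F) (C := A)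
      (fun z _ => h.differentiable_deriv z) (fun z _ => h.abs_deriv_deriv_le z) convex_univ
      (Set.mem_univ x) (Set.mem_univ y)
    simpa using this
  have hA : 0 ≤ A := (abs_nonneg _).trans (h.abs_deriv_deriv_le 0)
  have h2 := (le_abs_self _).trans h1
  have h3 := Real.add_one_le_exp (A / lam * |x - y|)
  have h4 := h.le_deriv x
  rw [abs_sub_comm y x] at h2
  have h5 : A * |x - y| ≤ (A / lam * |x - y|) * deriv F x := by
    have : A * |x - y| = (A / lam * |x - y|) * lam := by field_simp
    rw [this]
    exact mul_le_mul_of_nonneg_left h4 (by positivity)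
  have h6 := mul_le_mul_of_nonneg_right h3 (h.deriv_pos hl x).le
  nlinarith

end IsLift

/-! ### Transfer operators of lifts -/

/-- The transfer operator of the lift `F` of degree `k`, acting on `1`-periodic functions. -/
def transferLift (F : ℝ → ℝ) (k : ℕ) (ψ : ℝ → ℝ) (x : ℝ) : ℝ :=
  ∑ j ∈ Finset.range k, ψ (invFun F (x + j)) / deriv F (invFun F (x + j))

/-- `log ψ` has the modulus of continuity `K |x - y| + c |E x - E y|`. -/
def LogModulus (K c : ℝ) (E : ℝ → ℝ) (ψ : ℝ → ℝ) : Prop :=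
  ∀ x y, ψ x ≤ Real.exp (K * |x - y| + c * |E x - E y|) * ψ y

/-- `log ψ` is Lipschitz with constant `K`. -/
def LogLip (K : ℝ) (ψ : ℝ → ℝ) : Prop :=
  ∀ x y, ψ x ≤ Real.exp (K * |x - y|) * ψ y

section transferLift

variable {lam A : ℝ} {k : ℕ} {F : ℝ → ℝ}

/-- The parameter `y` is carried along because decorrelation evaluates the image of `fun z => H z y`
at the point `y` itself. -/
lemma transferLift_continuous (hl : 1 < lam) (h : IsLift lam A k F) {H : ℝ → ℝ → ℝ}
    (hH : Continuous (uncurry H)) :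
    Continuous (uncurry fun x y => transferLift F k (fun z => H z y) x) := by
  unfold transferLift
  apply continuous_finsetSum
  intro j _
  have hi := h.continuous_inv hl
  have hd := h.continuous_deriv
  refine Continuous.div ?_ (by fun_prop) (fun p => (h.deriv_pos hl _).ne')
  exact hH.comp (f := fun p : ℝ × ℝ => (invFun F (p.1 + j), p.2)) (by fun_prop)

lemma transferLift_continuous' (hl : 1 < lam) (h : IsLift lam A k F) {ψ : ℝ → ℝ}
    (hψ : Continuous ψ) : Continuous (transferLift F k ψ) := by
  have := transferLift_continuous hl h (H := fun x _ => ψ x) (by fun_prop)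
  exact this.comp (f := fun x : ℝ => (x, (0 : ℝ))) (by fun_prop)

/-- Moving `x` by one period turns branch `j` into branch `j + 1`, and branch `k` is branch `0`
moved by one period. -/
lemma transferLift_periodic (hl : 1 < lam) (h : IsLift lam A k F) {ψ : ℝ → ℝ}
    (hψ : Periodic ψ 1) : Periodic (transferLift F k ψ) 1 := by
  intro x
  unfold transferLift
  set g : ℕ → ℝ := fun j => ψ (invFun F (x + j)) / deriv F (invFun F (x + j)) with hg
  have hd : Periodic (deriv F) 1 := by
    intro y
    have : (fun z => F (z + 1)) = fun z => F z + k := funext h.shift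
    rw [← deriv_comp_add_const, this, deriv_add_const]
  have h1 : ∀ j : ℕ, ψ (invFun F (x + 1 + j)) / deriv F (invFun F (x + 1 + j)) = g (j + 1) := by
    intro j
    simp only [hg]
    push_cast
    rw [show x + 1 + (j : ℝ) = x + (j + 1) by ring]
  rw [Finset.sum_congr rfl (fun j _ => h1 j)]
  have h2 : g k = g 0 := by
    simp only [hg]
    rw [h.inv_shift hl, hψ, hd]
    simp
  have h3 := Finset.sum_range_succ g k
  rw [Finset.sum_range_succ' g k, h2] at h3
  linarith

/-- The substitution `u = F x` maps the unit interval to one of length `k`, whose unit pieces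
correspond to the inverse branches. The dependence of `H` on both the point and its image is what
admits observables that are not products. -/
lemma integral_transferLift (hl : 1 < lam) (h : IsLift lam A k F) {H : ℝ → ℝ → ℝ}
    (hH : Continuous (uncurry H)) (h1 : ∀ y, Periodic (fun x => H x y) 1)
    (h2 : ∀ x, Periodic (H x) 1) :
    ∫ x in (0 : ℝ)..1, H x (F x) = ∫ y in (0 : ℝ)..1, transferLift F k (fun x => H x y) y := by
  set g : ℝ → ℝ := fun u => H (invFun F u) u / deriv F (invFun F u) with hg
  have hi := h.continuous_inv hl
  have hd := h.continuous_deriv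
  have hgc : Continuous g := by
    refine Continuous.div ?_ (by fun_prop) (fun p => (h.deriv_pos hl _).ne')
    exact hH.comp (f := fun u : ℝ => (invFun F u, u)) (by fun_prop)
  have hdp : Periodic (deriv F) 1 := by
    intro y
    have : (fun z => F (z + 1)) = fun z => F z + k := funext h.shift
    rw [← deriv_comp_add_const, this, deriv_add_const]
  have hgp : Periodic g k := by
    intro u
    simp only [hg]
    rw [h.inv_shift hl, hdp, show H (invFun F u + 1) (u + k) = H (invFun F u) (u + k) from
      h1 (u + k) (invFun F u)]
    congr 1
    have := (h2 (invFun F u)).nat_mul k u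
    simpa using this
  have e1 : ∫ x in (0 : ℝ)..1, H x (F x) = ∫ u in (F 0)..(F 1), g u := by
    rw [← intervalIntegral.integral_comp_mul_deriv (f := F) (f' := deriv F)
      (fun x _ => (h.differentiable x).hasDerivAt) hd.continuousOn hgc]
    refine intervalIntegral.integral_congr (fun x _ => ?_)
    simp only [hg, comp, h.inv_apply hl]
    rw [div_mul_cancel₀ _ (h.deriv_pos hl x).ne']
  have e2 : F 1 = F 0 + k := by simpa using h.shift 0
  have e3 : ∫ u in (F 0)..(F 0 + k), g u = ∫ u in (0 : ℝ)..(0 + k), g u :=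
    hgp.intervalIntegral_add_eq _ _
  rw [e1, e2, e3, zero_add]
  have e4 := intervalIntegral.sum_integral_adjacent_intervals (f := g) (μ := volume)
    (a := fun j : ℕ => (j : ℝ)) (n := k) (fun j _ => hgc.intervalIntegrable _ _)
  simp only [Nat.cast_zero] at e4
  rw [← e4]
  unfold transferLift
  rw [intervalIntegral.integral_finsetSum]
  · refine Finset.sum_congr rfl (fun j _ => ?_)
    have : ∫ x in (0 : ℝ)..1, g (x + j) = ∫ x in (0 + j : ℝ)..(1 + j), g x :=
      intervalIntegral.integral_comp_add_right _ _
    rw [Nat.cast_succ, add_comm (j : ℝ) 1]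
    rw [zero_add] at this
    rw [← this]
    refine intervalIntegral.integral_congr (fun x _ => ?_)
    simp only [hg]
    congr 1
    have := (h2 (invFun F (x + j))).nat_mul j x
    simpa using this
  · intro j _
    apply Continuous.intervalIntegrable
    refine Continuous.div ?_ (by fun_prop) (fun p => (h.deriv_pos hl _).ne')
    exact hH.comp (f := fun u : ℝ => (invFun F (u + j), u)) (by fun_prop)

lemma transferLift_nonneg (hl : 1 < lam) (h : IsLift lam A k F) {ψ : ℝ → ℝ}
    (hψ : ∀ x, 0 ≤ ψ x) (x : ℝ) : 0 ≤ transferLift F k ψ x :=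
  Finset.sum_nonneg fun _ _ => div_nonneg (hψ _) (h.deriv_pos hl _).le

/-- Contraction of the branches and the distortion of the weight `1 / F'` produce the new first
constant. The second is unchanged: between two preimages on the same branch, `E` differs exactly as
`E'` does between the image points. A modulus relative to a future position is thus passed on until
that time is reached. -/
lemma transferLift_logModulus (hl : 1 < lam) (h : IsLift lam A k F) {ψ : ℝ → ℝ} {K c : ℝ}
    {E E' : ℝ → ℝ} {k' : ℝ} (hK : 0 ≤ K) (hψ0 : ∀ x, 0 ≤ ψ x) (hψ : LogModulus K c E ψ)
    (hE : ∀ x, E x = E' (F x)) (hE' : ∀ (x : ℝ) (j : ℕ), E' (x + j) = E' x + k' * j) :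
    LogModulus ((K + A / lam) / lam) c E' (transferLift F k ψ) := by
  intro x y
  unfold transferLift
  rw [Finset.mul_sum]
  refine Finset.sum_le_sum (fun j _ => ?_)
  set a := invFun F (x + j)
  set b := invFun F (y + j)
  have hA : 0 ≤ A := (abs_nonneg _).trans (h.abs_deriv_deriv_le 0)
  have hab : |a - b| ≤ |x - y| / lam := by
    have := h.inv_contract hl (x + j) (y + j)
    rwa [add_sub_add_right_eq_sub] at this
  have hEab : |E a - E b| = |E' x - E' y| := by
    rw [hE, hE, h.apply_inv hl, h.apply_inv hl, hE', hE', add_sub_add_right_eq_sub]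
  have h1 := hψ a b
  rw [hEab] at h1
  have h2 := h.deriv_distortion hl a b
  have hda := h.deriv_pos hl a
  have hdb := h.deriv_pos hl b
  rw [div_le_iff₀ hda]
  have h3 : (K + A / lam) * |a - b| ≤ (K + A / lam) / lam * |x - y| := by
    have := mul_le_mul_of_nonneg_left hab (show 0 ≤ K + A / lam by positivity)
    calc _ ≤ _ := this
      _ = _ := by ring
  have h4 : Real.exp (K * |a - b| + c * |E' x - E' y|) * Real.exp (A / lam * |a - b|)
      ≤ Real.exp ((K + A / lam) / lam * |x - y| + c * |E' x - E' y|) := by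
    rw [← Real.exp_add]
    apply Real.exp_le_exp.2
    linarith
  have hb := hψ0 b
  calc ψ a ≤ Real.exp (K * |a - b| + c * |E' x - E' y|) * ψ b := h1
    _ = Real.exp (K * |a - b| + c * |E' x - E' y|) * (ψ b / deriv F b) * deriv F b := by
        field_simp
    _ ≤ Real.exp (K * |a - b| + c * |E' x - E' y|) * (ψ b / deriv F b) *
          (Real.exp (A / lam * |a - b|) * deriv F a) := by
        apply mul_le_mul_of_nonneg_left h2; positivity
    _ = (Real.exp (K * |a - b| + c * |E' x - E' y|) * Real.exp (A / lam * |a - b|)) *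
          ((ψ b / deriv F b) * deriv F a) := by ring
    _ ≤ Real.exp ((K + A / lam) / lam * |x - y| + c * |E' x - E' y|) *
          ((ψ b / deriv F b) * deriv F a) := by
        apply mul_le_mul_of_nonneg_right h4; positivity
    _ = _ := by ring

lemma logModulus_zero_iff {K : ℝ} {E ψ : ℝ → ℝ} : LogModulus K 0 E ψ ↔ LogLip K ψ := by
  simp [LogModulus, LogLip]

lemma transferLift_logLip (hl : 1 < lam) (h : IsLift lam A k F) {ψ : ℝ → ℝ} {K : ℝ}
    (hK : 0 ≤ K) (hψ0 : ∀ x, 0 ≤ ψ x) (hψ : LogLip K ψ) :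
    LogLip ((K + A / lam) / lam) (transferLift F k ψ) := by
  rw [← logModulus_zero_iff (E := fun _ => 0)] at hψ ⊢
  exact transferLift_logModulus (k' := 0) hl h hK hψ0 hψ (by simp) (by simp)

end transferLift

/-! ### Log-Lipschitz functions -/

section densities

variable {K : ℝ} {ψ : ℝ → ℝ}

/-- The value at `x` is compared with all values on the period `[x, x + 1]`, which are at distance
at most one. -/
lemma LogLip.le_exp_mul_integral (hK : 0 ≤ K) (hψ : LogLip K ψ) (h0 : ∀ x, 0 ≤ ψ x)
    (hc : Continuous ψ) (hp : Periodic ψ 1) (x : ℝ) :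
    ψ x ≤ Real.exp K * ∫ t in (0 : ℝ)..1, ψ t := by
  have e : ∫ t in (0 : ℝ)..1, ψ t = ∫ t in x..x + 1, ψ t := by
    have := hp.intervalIntegral_add_eq 0 x
    rwa [zero_add] at this
  rw [e, ← intervalIntegral.integral_const_mul]
  have : ∫ _ in x..x + 1, ψ x = ψ x := by simp
  rw [← this]
  apply intervalIntegral.integral_mono_on (by linarith)
  · simp
  · exact (hc.const_mul _ |>.intervalIntegrable _ _)
  · intro t ht
    refine (hψ x t).trans (mul_le_mul_of_nonneg_right (Real.exp_le_exp.2 ?_) (h0 t))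
    have : |x - t| ≤ 1 := by rw [abs_le]; constructor <;> linarith [ht.1, ht.2]
    nlinarith

lemma LogLip.integral_le (hK : 0 ≤ K) (hψ : LogLip K ψ) (h0 : ∀ x, 0 ≤ ψ x)
    (hc : Continuous ψ) (hp : Periodic ψ 1) (x : ℝ) :
    ∫ t in (0 : ℝ)..1, ψ t ≤ Real.exp K * ψ x := by
  have e : ∫ t in (0 : ℝ)..1, ψ t = ∫ t in x..x + 1, ψ t := by
    have := hp.intervalIntegral_add_eq 0 x
    rwa [zero_add] at this
  rw [e]
  have : ∫ _ in x..x + 1, Real.exp K * ψ x = Real.exp K * ψ x := by simp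
  rw [← this]
  apply intervalIntegral.integral_mono_on (by linarith)
  · exact (hc.intervalIntegrable _ _)
  · simp
  · intro t ht
    refine (hψ t x).trans (mul_le_mul_of_nonneg_right (Real.exp_le_exp.2 ?_) (h0 x))
    have : |t - x| ≤ 1 := by rw [abs_le]; constructor <;> linarith [ht.1, ht.2]
    nlinarith

/-- This rests on `1 - e^(-t) ≤ t`. -/
lemma LogLip.lipschitz {B : ℝ} (hK : 0 ≤ K) (hψ : LogLip K ψ) (h0 : ∀ x, 0 ≤ ψ x)
    (hB : ∀ x, ψ x ≤ B) (x y : ℝ) : |ψ x - ψ y| ≤ K * B * |x - y| := by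
  have key : ∀ x y, ψ x - ψ y ≤ K * B * |x - y| := by
    intro x y
    have h1 := hψ x y
    have h2 : Real.exp (-(K * |x - y|)) * ψ x ≤ ψ y := by
      rw [Real.exp_neg, inv_mul_le_iff₀ (Real.exp_pos _)]; exact h1
    have h3 := Real.add_one_le_exp (-(K * |x - y|))
    have h4 := mul_le_mul_of_nonneg_right h3 (h0 x)
    have h5 : K * |x - y| * ψ x ≤ K * |x - y| * B :=
      mul_le_mul_of_nonneg_left (hB x) (by positivity)
    nlinarith
  rw [abs_le]
  refine ⟨?_, key x y⟩
  have := key y x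
  rw [abs_sub_comm y x] at this
  linarith

/-- Subtracting a small constant from a log-Lipschitz function worsens the constant by a factor
`1 + δ` only. -/
lemma LogLip.sub_const {δ m ε : ℝ} (hδ : 0 < δ) (hK : 0 ≤ K) (hψ : LogLip K ψ)
    (hm : ∀ x, m ≤ ψ x) (hε0 : 0 ≤ ε) (hε : ε * (1 + δ) ≤ m * δ) :
    LogLip ((1 + δ) * K) (fun x => ψ x - ε) := by
  intro x y
  set u := K * |x - y| with hu
  have hu0 : 0 ≤ u := by positivity
  have h1 := hψ x y
  rw [show (1 + δ) * K * |x - y| = u + δ * u by rw [hu]; ring, Real.exp_add]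
  set s := Real.exp u
  set q := Real.exp (δ * u)
  have hs : 1 ≤ s := Real.one_le_exp hu0
  have hq : 1 + δ * u ≤ q := by linarith [Real.add_one_le_exp (δ * u)]
  -- The claim reduces to `ε (s q - 1) ≤ ψ y · s (q - 1)`. Since `δ (s - 1) ≤ δ s u ≤ s (q - 1)`,
  -- one has `δ (s q - 1) ≤ (1 + δ) s (q - 1)`, and `hε` is exactly the condition that compensates
  -- for the factor `(1 + δ) / δ`.
  have hsu : s - 1 ≤ s * u := by
    have h3 := Real.add_one_le_exp (-u)
    have h4 : Real.exp (-u) * s = 1 := by rw [← Real.exp_add]; simp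
    nlinarith
  have h5 : δ * (s - 1) ≤ s * (q - 1) := by nlinarith
  have hp := hm y
  have hq1 : 1 ≤ q := by nlinarith [mul_nonneg hδ.le hu0]
  have h6 : δ * (s * q - 1) ≤ (1 + δ) * (s * (q - 1)) := by nlinarith
  have h7 : 0 ≤ s * (q - 1) := by nlinarith
  have h8 : δ * (ε * (s * q - 1)) ≤ δ * (ψ y * (s * (q - 1))) := by
    calc δ * (ε * (s * q - 1)) = ε * (δ * (s * q - 1)) := by ring
      _ ≤ ε * ((1 + δ) * (s * (q - 1))) := mul_le_mul_of_nonneg_left h6 hε0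
      _ = (ε * (1 + δ)) * (s * (q - 1)) := by ring
      _ ≤ (m * δ) * (s * (q - 1)) := mul_le_mul_of_nonneg_right hε h7
      _ ≤ (ψ y * δ) * (s * (q - 1)) := by
          apply mul_le_mul_of_nonneg_right _ h7
          exact mul_le_mul_of_nonneg_right hp hδ.le
      _ = _ := by ring
  have h9 := le_of_mul_le_mul_left h8 hδ
  show ψ x - ε ≤ s * q * (ψ y - ε)
  nlinarith

lemma LogLip.mono {K' : ℝ} (hψ : LogLip K ψ) (h0 : ∀ x, 0 ≤ ψ x) (h : K ≤ K') : LogLip K' ψ := by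
  intro x y
  refine (hψ x y).trans (mul_le_mul_of_nonneg_right (Real.exp_le_exp.2 ?_) (h0 y))
  exact mul_le_mul_of_nonneg_right h (abs_nonneg _)

lemma LogModulus.mono {K' c : ℝ} {E : ℝ → ℝ} (hψ : LogModulus K c E ψ) (h0 : ∀ x, 0 ≤ ψ x)
    (h : K ≤ K') : LogModulus K' c E ψ := by
  intro x y
  refine (hψ x y).trans (mul_le_mul_of_nonneg_right (Real.exp_le_exp.2 ?_) (h0 y))
  have := mul_le_mul_of_nonneg_right h (abs_nonneg (x - y))
  linarith

lemma LogLip.mul_const {c : ℝ} (hψ : LogLip K ψ) (hc : 0 ≤ c) : LogLip K (fun x => c * ψ x) := by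
  intro x y
  have := mul_le_mul_of_nonneg_left (hψ x y) hc
  show c * ψ x ≤ _ * (c * ψ y)
  linarith

end densities

/-! ### Compositions of lifts and of transfer operators -/

/-- The lift of `seqComp`. -/
def liftComp (F : ℕ → ℝ → ℝ) (a : ℕ) : ℕ → ℝ → ℝ
  | 0 => id
  | n + 1 => F (a + n) ∘ liftComp F a n

/-- The composition of `n` consecutive transfer operators, starting with the one of `F a`. -/
def transferSeq (F : ℕ → ℝ → ℝ) (k : ℕ → ℕ) (a : ℕ) : ℕ → (ℝ → ℝ) → ℝ → ℝ
  | 0, ψ => ψ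
  | n + 1, ψ => transferLift (F (a + n)) (k (a + n)) (transferSeq F k a n ψ)

section

variable {lam A : ℝ} {F : ℕ → ℝ → ℝ} {k : ℕ → ℕ}

lemma liftComp_add (a m n : ℕ) (x : ℝ) :
    liftComp F a (m + n) x = liftComp F (a + m) n (liftComp F a m x) := by
  induction n with
  | zero => rfl
  | succ n ih =>
    show F (a + (m + n)) (liftComp F a (m + n) x) = F (a + m + n) _
    rw [ih, add_assoc]

lemma transferSeq_add (a m n : ℕ) (ψ : ℝ → ℝ) :
    transferSeq F k a (m + n) ψ = transferSeq F k (a + m) n (transferSeq F k a m ψ) := by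
  induction n with
  | zero => rfl
  | succ n ih =>
    show transferLift (F (a + (m + n))) (k (a + (m + n))) (transferSeq F k a (m + n) ψ) =
      transferLift (F (a + m + n)) (k (a + m + n)) _
    rw [ih, add_assoc]

lemma liftComp_succ' (a n : ℕ) (x : ℝ) :
    liftComp F a (n + 1) x = liftComp F (a + 1) n (F a x) := by
  rw [add_comm, liftComp_add]; rfl

lemma transferSeq_succ' (a n : ℕ) (ψ : ℝ → ℝ) :
    transferSeq F k a (n + 1) ψ = transferSeq F k (a + 1) n (transferLift (F a) (k a) ψ) := by
  rw [add_comm, transferSeq_add]; rfl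

lemma liftComp_continuous (hF : ∀ i, IsLift lam A (k i) (F i)) (a n : ℕ) :
    Continuous (liftComp F a n) := by
  induction n with
  | zero => exact continuous_id
  | succ n ih => exact (hF _).continuous.comp ih

/-- `D` is the degree of the composition. The formula is what `transferLift_logModulus` requires of
the position function `E'`. -/
lemma liftComp_shift (hF : ∀ i, IsLift lam A (k i) (F i)) (a n : ℕ) :
    ∃ D : ℕ, ∀ x, ∀ j : ℕ, liftComp F a n (x + j) = liftComp F a n x + D * j := by
  induction n with
  | zero => exact ⟨1, fun x j => by simp [liftComp]⟩
  | succ n ih =>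
    obtain ⟨D, hD⟩ := ih
    refine ⟨k (a + n) * D, fun x j => ?_⟩
    show F (a + n) (liftComp F a n (x + j)) = F (a + n) (liftComp F a n x) + _
    have := (hF (a + n)).shift_nat (D * j) (liftComp F a n x)
    push_cast at this ⊢
    rw [hD, this]; ring

lemma liftComp_expand (hl : 1 < lam) (hF : ∀ i, IsLift lam A (k i) (F i)) (a n : ℕ) (x y : ℝ) :
    lam ^ n * |x - y| ≤ |liftComp F a n x - liftComp F a n y| := by
  induction n with
  | zero => simp [liftComp]
  | succ n ih =>
    have := (hF (a + n)).expand (liftComp F a n x) (liftComp F a n y)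
    have h2 := mul_le_mul_of_nonneg_left ih (show 0 ≤ lam by linarith)
    calc lam ^ (n + 1) * |x - y| = lam * (lam ^ n * |x - y|) := by ring
      _ ≤ _ := h2.trans this

lemma transferLift_linear (F : ℝ → ℝ) (k : ℕ) (p q : ℝ) (ψ φ : ℝ → ℝ) :
    transferLift F k (fun z => p * ψ z + q * φ z) =
      fun x => p * transferLift F k ψ x + q * transferLift F k φ x := by
  funext x
  simp only [transferLift, Finset.mul_sum, ← Finset.sum_add_distrib]
  refine Finset.sum_congr rfl (fun _ _ => by ring)

lemma transferSeq_linear (a n : ℕ) (p q : ℝ) (ψ φ : ℝ → ℝ) :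
    transferSeq F k a n (fun z => p * ψ z + q * φ z) =
      fun x => p * transferSeq F k a n ψ x + q * transferSeq F k a n φ x := by
  induction n with
  | zero => rfl
  | succ n ih =>
    show transferLift _ _ (transferSeq F k a n _) = _
    rw [ih, transferLift_linear]; rfl

lemma transferSeq_continuous (hl : 1 < lam) (hF : ∀ i, IsLift lam A (k i) (F i)) (a n : ℕ)
    {H : ℝ → ℝ → ℝ} (hH : Continuous (uncurry H)) :
    Continuous (uncurry fun x y => transferSeq F k a n (fun z => H z y) x) := by
  induction n with
  | zero => exact hH
  | succ n ih => exact transferLift_continuous hl (hF (a + n)) ih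

lemma transferSeq_continuous' (hl : 1 < lam) (hF : ∀ i, IsLift lam A (k i) (F i)) (a n : ℕ)
    {ψ : ℝ → ℝ} (hψ : Continuous ψ) : Continuous (transferSeq F k a n ψ) := by
  induction n with
  | zero => exact hψ
  | succ n ih => exact transferLift_continuous' hl (hF (a + n)) ih

lemma transferSeq_periodic (hl : 1 < lam) (hF : ∀ i, IsLift lam A (k i) (F i)) (a n : ℕ)
    {ψ : ℝ → ℝ} (hψ : Periodic ψ 1) : Periodic (transferSeq F k a n ψ) 1 := by
  induction n with
  | zero => exact hψ
  | succ n ih => exact transferLift_periodic hl (hF (a + n)) ih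

lemma transferSeq_nonneg (hl : 1 < lam) (hF : ∀ i, IsLift lam A (k i) (F i)) (a n : ℕ)
    {ψ : ℝ → ℝ} (hψ : ∀ x, 0 ≤ ψ x) (x : ℝ) : 0 ≤ transferSeq F k a n ψ x := by
  induction n generalizing x with
  | zero => exact hψ x
  | succ n ih => exact transferLift_nonneg hl (hF (a + n)) ih x

lemma integral_transferSeq (hl : 1 < lam) (hF : ∀ i, IsLift lam A (k i) (F i)) (a n : ℕ)
    {H : ℝ → ℝ → ℝ} (hH : Continuous (uncurry H)) (h1 : ∀ y, Periodic (fun x => H x y) 1)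
    (h2 : ∀ x, Periodic (H x) 1) :
    ∫ x in (0 : ℝ)..1, H x (liftComp F a n x) =
      ∫ y in (0 : ℝ)..1, transferSeq F k a n (fun x => H x y) y := by
  induction n generalizing H with
  | zero => rfl
  | succ n ih =>
    have hFn := hF (a + n)
    -- The last map is absorbed into the second argument of `H`. After the first `n` operators it
    -- acts on a variable that is also the evaluation point, which is the situation of
    -- `integral_transferLift`.
    have e1 := ih (H := fun x z => H x (F (a + n) z))
      (hH.comp (f := fun p : ℝ × ℝ => (p.1, F (a + n) p.2))
        (by have := hFn.continuous; fun_prop))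
      (fun y => h1 _) (fun x z => by
        show H x (F (a + n) (z + 1)) = _
        rw [hFn.shift]
        have := (h2 x).nat_mul (k (a + n)) (F (a + n) z)
        simpa using this)
    have e2 := integral_transferLift hl hFn
      (H := fun z y => transferSeq F k a n (fun x => H x y) z)
      (transferSeq_continuous hl hF a n hH)
      (fun y => transferSeq_periodic hl hF a n (h1 y))
      (fun z y => by
        show transferSeq F k a n (fun x => H x (y + 1)) z = _
        congr 1
        funext x
        exact h2 x y)
    exact e1.trans e2

lemma integral_transferSeq_comp (hl : 1 < lam) (hF : ∀ i, IsLift lam A (k i) (F i)) (a n : ℕ)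
    {ψ v : ℝ → ℝ} (hψ : Continuous ψ) (hv : Continuous v) (hψp : Periodic ψ 1)
    (hvp : Periodic v 1) :
    ∫ x in (0 : ℝ)..1, v (liftComp F a n x) * ψ x =
      ∫ y in (0 : ℝ)..1, v y * transferSeq F k a n ψ y := by
  have := integral_transferSeq hl hF a n (H := fun x y => v y * ψ x) (by fun_prop)
    (fun y x => by simp [hψp x]) (fun x y => by simp [hvp y])
  rw [this]
  refine intervalIntegral.integral_congr (fun y _ => ?_)
  have := congrFun (transferSeq_linear (F := F) (k := k) a n (v y) 0 ψ ψ) y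
  simpa using this

lemma integral_transferSeq_self (hl : 1 < lam) (hF : ∀ i, IsLift lam A (k i) (F i)) (a n : ℕ)
    {ψ : ℝ → ℝ} (hψ : Continuous ψ) (hψp : Periodic ψ 1) :
    ∫ y in (0 : ℝ)..1, transferSeq F k a n ψ y = ∫ x in (0 : ℝ)..1, ψ x := by
  have := integral_transferSeq_comp hl hF a n (v := fun _ => 1) hψ continuous_const hψp
    (fun _ => rfl)
  simpa using this.symm

/-- When time `n` is reached, the position function has become the identity and the two constants
add up. The condition `hKA` keeps the first one from growing on the way. -/
lemma transferSeq_logLip (hl : 1 < lam) (hF : ∀ i, IsLift lam A (k i) (F i)) {K c : ℝ}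
    (hK : 0 ≤ K) (hKA : (K + A / lam) / lam ≤ K) (a n : ℕ) {ψ : ℝ → ℝ} (h0 : ∀ x, 0 ≤ ψ x)
    (hψ : LogModulus K c (liftComp F a n) ψ) : LogLip (K + c) (transferSeq F k a n ψ) := by
  induction n generalizing a ψ with
  | zero =>
    intro x y
    have := hψ x y
    rwa [show liftComp F a 0 x = x from rfl, show liftComp F a 0 y = y from rfl, ← add_mul] at this
  | succ n ih =>
    rw [transferSeq_succ']
    obtain ⟨D, hD⟩ := liftComp_shift hF (a + 1) n
    refine ih (a + 1) (transferLift_nonneg hl (hF a) h0) ?_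
    exact (transferLift_logModulus hl (hF a) hK h0 hψ (liftComp_succ' a n) hD).mono
      (transferLift_nonneg hl (hF a) h0) hKA

end

/-! ### Loss of memory and decorrelation for lifts -/

/-- A log-Lipschitz constant improved by all transfer operators. -/
def regConst (lam A : ℝ) : ℝ := 2 * A / (lam * (lam - 1)) + 1

/-- The mass that can be split off in every step. -/
def splitMass (lam A : ℝ) : ℝ :=
  Real.exp (-regConst lam A) * ((lam - 1) / 2) / (1 + (lam - 1) / 2)

/-- The rate of the loss of memory. -/
def rate (lam A : ℝ) : ℝ := max (1 - splitMass lam A) lam⁻¹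

/-- The constant in the decorrelation estimates, where `L` is a log-Lipschitz constant of the
initial density. -/
def decorConst (lam A L : ℝ) : ℝ :=
  12 * (L + regConst lam A + 1) * Real.exp (L + 2 * regConst lam A + 1)

section

variable {lam A : ℝ}

lemma one_le_regConst (hl : 1 < lam) (hA : 0 ≤ A) : 1 ≤ regConst lam A := by
  have : 0 ≤ 2 * A / (lam * (lam - 1)) :=
    div_nonneg (by linarith) (mul_nonneg (by linarith) (by linarith))
  unfold regConst; linarith

lemma div_le_regConst (hl : 1 < lam) : A / lam ≤ regConst lam A * ((lam - 1) / 2) := by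
  have h1 : 0 < lam - 1 := by linarith
  have : 2 * A / (lam * (lam - 1)) * ((lam - 1) / 2) = A / lam := by field_simp
  unfold regConst
  nlinarith

/-- This is the slack that pays for splitting off mass: the constant may first grow by the factor `1
+ (lam - 1) / 2`, and one operator restores it. -/
lemma regConst_step (hl : 1 < lam) :
    ((1 + (lam - 1) / 2) * regConst lam A + A / lam) / lam ≤ regConst lam A := by
  rw [div_le_iff₀ (by linarith)]
  have := div_le_regConst (A := A) hl
  linarith

/-- Larger constants are preserved too, so the initial density can be followed from time zero
without waiting for it to become regular. -/
lemma add_regConst_step (hl : 1 < lam) (hA : 0 ≤ A) {L : ℝ} (hL : 0 ≤ L) :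
    (L + regConst lam A + A / lam) / lam ≤ L + regConst lam A := by
  rw [div_le_iff₀ (by linarith)]
  have := div_le_regConst (A := A) hl
  have h1 := one_le_regConst hl hA
  nlinarith

lemma splitMass_pos (hl : 1 < lam) : 0 < splitMass lam A := by
  unfold splitMass
  have : 0 < (lam - 1) / 2 := by linarith
  positivity

lemma splitMass_lt_one (hl : 1 < lam) (hA : 0 ≤ A) : splitMass lam A < 1 := by
  unfold splitMass
  have h0 : 0 < (lam - 1) / 2 := by linarith
  rw [div_lt_one (by linarith)]
  have h1 : Real.exp (-regConst lam A) ≤ 1 := by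
    rw [Real.exp_le_one_iff]; linarith [one_le_regConst hl hA]
  nlinarith

lemma rate_pos (hl : 1 < lam) : 0 < rate lam A :=
  lt_of_lt_of_le (inv_pos.2 (by linarith)) (le_max_right _ _)

lemma rate_lt_one (hl : 1 < lam) : rate lam A < 1 :=
  max_lt (by linarith [splitMass_pos (A := A) hl]) (inv_lt_one_of_one_lt₀ hl)

lemma inv_le_rate : lam⁻¹ ≤ rate lam A := le_max_right _ _

lemma decorConst_pos (hl : 1 < lam) (hA : 0 ≤ A) {L : ℝ} (hL : 0 ≤ L) : 0 < decorConst lam A L := by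
  have := one_le_regConst hl hA
  unfold decorConst
  positivity

variable {F : ℕ → ℝ → ℝ} {k : ℕ → ℕ}

/-- Continuous `1`-periodic probability densities with log-Lipschitz constant `K`. -/
structure IsPeriodicDensity (K : ℝ) (ψ : ℝ → ℝ) : Prop where
  continuous : Continuous ψ
  periodic : Periodic ψ 1
  nonneg : ∀ x, 0 ≤ ψ x
  logLip : LogLip K ψ
  integral_eq : ∫ x in (0 : ℝ)..1, ψ x = 1

/-- A density with log-Lipschitz constant `K` is at least `e^(-K)`. By `LogLip.sub_const`, removing
the constant `splitMass` worsens `K` only by the factor that `regConst_step` can repair. -/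
lemma IsPeriodicDensity.split (hl : 1 < lam) (hA : 0 ≤ A) {F : ℝ → ℝ} {k : ℕ}
    (hF : IsLift lam A k F) {ψ : ℝ → ℝ} (h : IsPeriodicDensity (regConst lam A) ψ) :
    ∃ χ, IsPeriodicDensity (regConst lam A) χ ∧ transferLift F k ψ = fun x =>
      (1 - splitMass lam A) * χ x + splitMass lam A * transferLift F k (fun _ => 1) x := by
  set ε := splitMass lam A with hε
  have hε0 := splitMass_pos (A := A) hl
  have hε1 := splitMass_lt_one hl hA
  have hK := one_le_regConst hl hA
  have hne : 1 - ε ≠ 0 := by rw [hε]; linarith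
  have hm : ∀ x, Real.exp (-regConst lam A) ≤ ψ x := fun x => by
    have := h.logLip.integral_le (by linarith) h.nonneg h.continuous h.periodic x
    rw [h.integral_eq] at this
    rw [Real.exp_neg, inv_eq_one_div, div_le_iff₀ (Real.exp_pos _)]
    linarith
  have hδ : 0 < (lam - 1) / 2 := by linarith
  have hεδ : ε * (1 + (lam - 1) / 2) = Real.exp (-regConst lam A) * ((lam - 1) / 2) := by
    rw [hε, splitMass, div_mul_cancel₀ _ (by linarith)]
  have hεm : ∀ x, ε ≤ ψ x := fun x => by
    have h1 : ε ≤ Real.exp (-regConst lam A) := by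
      have := Real.exp_pos (-regConst lam A)
      nlinarith
    exact h1.trans (hm x)
  set ψ' : ℝ → ℝ := fun x => (1 - ε)⁻¹ * (ψ x - ε) with hψ'
  have hinv : 0 ≤ (1 - ε)⁻¹ := inv_nonneg.2 (by linarith)
  have h0' : ∀ x, 0 ≤ ψ' x := fun x => mul_nonneg hinv (by linarith [hεm x])
  have hc' : Continuous ψ' := by have := h.continuous; fun_prop
  have hp' : Periodic ψ' 1 := fun x => by simp [hψ', h.periodic x]
  have hL' : LogLip ((1 + (lam - 1) / 2) * regConst lam A) ψ' :=
    (h.logLip.sub_const hδ (by linarith) hm hε0.le hεδ.le).mul_const hinv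
  refine ⟨transferLift F k ψ', ⟨transferLift_continuous' hl hF hc', transferLift_periodic hl hF hp',
    transferLift_nonneg hl hF h0', ?_, ?_⟩, ?_⟩
  · exact (transferLift_logLip hl hF (by positivity) h0' hL').mono
      (transferLift_nonneg hl hF h0') (regConst_step hl)
  · have := integral_transferLift hl hF (H := fun x _ => ψ' x) (by fun_prop) (fun _ => hp')
      (fun _ _ => rfl)
    rw [← this]
    simp only [hψ']
    rw [intervalIntegral.integral_const_mul, intervalIntegral.integral_sub, h.integral_eq]
    · simp only [intervalIntegral.integral_const, sub_zero, one_smul]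
      exact inv_mul_cancel₀ hne
    · exact h.continuous.intervalIntegrable _ _
    · simp
  · rw [← transferLift_linear]
    congr 1
    funext x
    simp only [hψ']
    field_simp
    ring

/-- A coupling argument: the split-off parts of both densities coincide and cancel, so every step
multiplies the difference by `1 - splitMass lam A` and leaves two densities of the same class. -/
lemma IsPeriodicDensity.contraction (hl : 1 < lam) (hA : 0 ≤ A)
    (hF : ∀ i, IsLift lam A (k i) (F i)) (a n : ℕ) {ψ φ : ℝ → ℝ}
    (hψ : IsPeriodicDensity (regConst lam A) ψ) (hφ : IsPeriodicDensity (regConst lam A) φ) (x : ℝ) :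
    |transferSeq F k a n ψ x - transferSeq F k a n φ x| ≤
      Real.exp (regConst lam A) * (1 - splitMass lam A) ^ n := by
  have hK := one_le_regConst hl hA
  induction n generalizing a ψ φ with
  | zero =>
    have h1 := hψ.logLip.le_exp_mul_integral (by linarith) hψ.nonneg hψ.continuous hψ.periodic x
    have h2 := hφ.logLip.le_exp_mul_integral (by linarith) hφ.nonneg hφ.continuous hφ.periodic x
    rw [hψ.integral_eq] at h1
    rw [hφ.integral_eq] at h2
    have h3 := hψ.nonneg x
    have h4 := hφ.nonneg x
    simp only [transferSeq, pow_zero]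
    rw [abs_le]
    constructor <;> linarith
  | succ n ih =>
    obtain ⟨ψ', hψ', e1⟩ := hψ.split hl hA (hF a)
    obtain ⟨φ', hφ', e2⟩ := hφ.split hl hA (hF a)
    have hε1 := splitMass_lt_one hl hA
    rw [transferSeq_succ', transferSeq_succ', e1, e2, transferSeq_linear, transferSeq_linear]
    have := ih (a + 1) hψ' hφ'
    rw [add_sub_add_right_eq_sub, ← mul_sub, abs_mul, abs_of_pos (by linarith), pow_succ]
    calc _ ≤ (1 - splitMass lam A) *
          (Real.exp (regConst lam A) * (1 - splitMass lam A) ^ n) :=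
            mul_le_mul_of_nonneg_left this (by linarith)
      _ = _ := by ring

/-- Exponential loss of memory for Lipschitz functions with vanishing integral. -/
lemma abs_transferSeq_le (hl : 1 < lam) (hA : 0 ≤ A)
    (hF : ∀ i, IsLift lam A (k i) (F i)) (a n : ℕ) {ψ : ℝ → ℝ} {R : ℝ} (hc : Continuous ψ)
    (hp : Periodic ψ 1) (hR : ∀ x y, |ψ x - ψ y| ≤ R * |x - y|)
    (h0 : ∫ x in (0 : ℝ)..1, ψ x = 0) (x : ℝ) :
    |transferSeq F k a n ψ x| ≤ 2 * R * Real.exp (regConst lam A) * rate lam A ^ n := by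
  have hK := one_le_regConst hl hA
  have hR0 : 0 ≤ R := by
    have := (abs_nonneg _).trans (hR 1 0)
    simpa using this
  -- A mean-zero periodic function is bounded by its Lipschitz constant, because `ψ x` is the mean
  -- of `ψ x - ψ t` over a period.
  have hb : ∀ x, |ψ x| ≤ R := by
    intro x
    have e : ∫ t in x..x + 1, ψ t = 0 := by
      have := hp.intervalIntegral_add_eq 0 x
      rw [← this, zero_add, h0]
    have e2 : ψ x = ∫ t in x..x + 1, (ψ x - ψ t) := by
      rw [intervalIntegral.integral_sub (by simp) (hc.intervalIntegrable _ _), e]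
      simp
    have := intervalIntegral.norm_integral_le_of_norm_le_const (a := x) (b := x + 1)
      (f := fun t => ψ x - ψ t) (C := R) (fun t ht => by
        rw [Set.uIoc_of_le (by linarith)] at ht
        refine (hR x t).trans ?_
        have : |x - t| ≤ 1 := by rw [abs_le]; constructor <;> linarith [ht.1, ht.2]
        nlinarith)
    rw [← e2] at this
    simpa using this
  have hrate : (1 - splitMass lam A) ^ n ≤ rate lam A ^ n :=
    pow_le_pow_left₀ (by linarith [splitMass_lt_one hl hA]) (le_max_left _ _) n
  rcases hR0.eq_or_lt with rfl | hRpos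
  · have e : ψ = fun z => 0 * ψ z + 0 * ψ z := by
      funext z
      have := hb z
      simp only [abs_nonpos_iff] at this
      simp [this]
    rw [e, transferSeq_linear]
    simp
  -- `φ = 1 + ψ / (2 R)` is at least `1 / 2` and has Lipschitz constant `1 / 2`, so it is a density
  -- with log-Lipschitz constant `1 ≤ regConst lam A`. It can be compared with the constant density
  -- `1`.
  · set φ : ℝ → ℝ := fun x => (2 * R)⁻¹ * ψ x + 1 * 1 with hφ
    have hφd : IsPeriodicDensity (regConst lam A) φ := by
      have hnn : ∀ x, 1 / 2 ≤ φ x := fun x => by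
        have h2 := neg_le_of_abs_le (hb x)
        have h3 : (2 * R)⁻¹ * -R = -(1 / 2) := by field_simp
        have h4 := mul_le_mul_of_nonneg_left h2 (show 0 ≤ (2 * R)⁻¹ by positivity)
        simp only [hφ]
        linarith
      refine ⟨by fun_prop, fun x => by simp [hφ, hp x], fun x => by linarith [hnn x], ?_, ?_⟩
      · have : LogLip 1 φ := by
          intro x y
          have h1 : φ x - φ y ≤ 1 / 2 * |x - y| := by
            have h2 := (le_abs_self _).trans (hR x y)
            have h3 := mul_le_mul_of_nonneg_left h2 (show 0 ≤ (2 * R)⁻¹ by positivity)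
            have h4 : (2 * R)⁻¹ * (R * |x - y|) = 1 / 2 * |x - y| := by field_simp
            simp only [hφ]
            linarith
          have h2 := Real.add_one_le_exp (1 * |x - y|)
          have h3 := hnn y
          have h4 := abs_nonneg (x - y)
          have h5 := mul_le_mul_of_nonneg_right h2 (show 0 ≤ φ y by linarith)
          nlinarith
        exact this.mono (fun x => by linarith [hnn x]) hK
      · simp only [hφ]
        rw [intervalIntegral.integral_add ((hc.const_mul _).intervalIntegrable _ _) (by simp),
          intervalIntegral.integral_const_mul, h0]
        simp
    have hone : IsPeriodicDensity (regConst lam A) (fun _ => (1 : ℝ)) :=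
      ⟨continuous_const, fun _ => rfl, fun _ => zero_le_one, fun x y => by
        rw [mul_one]; exact Real.one_le_exp (by positivity), by simp⟩
    have h1 := hφd.contraction hl hA hF a n hone x
    simp only [hφ] at h1
    rw [transferSeq_linear a n _ _ ψ (fun _ => 1)] at h1
    beta_reduce at h1
    rw [one_mul, add_sub_cancel_right, abs_mul, abs_of_pos (by positivity),
      inv_mul_le_iff₀ (by positivity)] at h1
    calc _ ≤ _ := h1
      _ ≤ 2 * R * (Real.exp (regConst lam A) * rate lam A ^ n) := by gcongr
      _ = _ := by ring

/-- Exponential decay for the transfer operators applied to `(Ψ - ∫ Ψ ρ) ρ`, where `Ψ` varies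
slowly in terms of the images under `liftComp F a m`. -/
lemma abs_transferSeq_centered_le (hl : 1 < lam) (hA : 0 ≤ A)
    (hF : ∀ i, IsLift lam A (k i) (F i)) (a m n : ℕ) {L M R : ℝ} (hL : 0 ≤ L) {ρ Ψ : ℝ → ℝ}
    (hρ : IsPeriodicDensity L ρ) (hc : Continuous Ψ) (hp : Periodic Ψ 1) (hM : ∀ x, |Ψ x| ≤ M)
    (hR0 : 0 ≤ R) (hR : ∀ x y, |Ψ x - Ψ y| ≤ R * |liftComp F a m x - liftComp F a m y|) (x : ℝ) :
    |transferSeq F k a (m + n) (fun z => (Ψ z - ∫ t in (0 : ℝ)..1, Ψ t * ρ t) * ρ z) x| ≤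
      decorConst lam A L * (M + R) * rate lam A ^ n := by
  have hK := one_le_regConst hl hA
  set K := L + regConst lam A with hKdef
  have hK0 : 0 ≤ K := by linarith
  have hstep : (K + A / lam) / lam ≤ K := add_regConst_step hl hA hL
  have hM0 : 0 ≤ M := (abs_nonneg _).trans (hM 0)
  -- The shift makes `Ψ + S ≥ R`. A variation of `Ψ` by `R e` then changes `Ψ + S` by a factor of at
  -- most `1 + e ≤ exp e`, so `log (Ψ + S)` has coefficient `1` relative to the position at time
  -- `m`.
  set S := 2 * (M + R) with hS
  set I := ∫ t in (0 : ℝ)..1, (Ψ t + S) * ρ t with hI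
  have hρc := hρ.continuous
  have hρLM : LogModulus K 0 (liftComp F a m) ρ :=
    logModulus_zero_iff.2 (hρ.logLip.mono hρ.nonneg (by linarith))
  set ψ₁ := transferSeq F k a m (fun z => (Ψ z + S) * ρ z) with hψ₁
  set ψ₂ := transferSeq F k a m ρ with hψ₂
  have hpos : ∀ z, R ≤ Ψ z + S := fun z => by
    have := neg_le_of_abs_le (hM z)
    rw [hS]; linarith
  have h10 : ∀ z, 0 ≤ (Ψ z + S) * ρ z := fun z =>
    mul_nonneg (hR0.trans (hpos z)) (hρ.nonneg z)
  have h1c : Continuous fun z => (Ψ z + S) * ρ z := by fun_prop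
  have h1p : Periodic (fun z => (Ψ z + S) * ρ z) 1 := fun z => by simp [hp z, hρ.periodic z]
  have h1L : LogLip (K + 1) ψ₁ := by
    refine transferSeq_logLip hl hF hK0 hstep a m h10 ?_
    intro x y
    have h1 := hρLM x y
    rw [zero_mul, add_zero] at h1
    set e := |liftComp F a m x - liftComp F a m y|
    have he : 0 ≤ e := abs_nonneg _
    have h2 : Ψ x + S ≤ Real.exp (1 * e) * (Ψ y + S) := by
      have h3 := (le_abs_self _).trans (hR x y)
      have h4 := Real.add_one_le_exp (1 * e)
      have h5 := hpos y
      have h6 := mul_le_mul_of_nonneg_right h4 (hR0.trans h5)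
      have h7 := mul_le_mul_of_nonneg_right h5 he
      nlinarith
    rw [Real.exp_add]
    calc (Ψ x + S) * ρ x ≤ (Real.exp (1 * e) * (Ψ y + S)) * (Real.exp (K * |x - y|) * ρ y) :=
          mul_le_mul h2 h1 (hρ.nonneg x) (mul_nonneg (Real.exp_pos _).le (hR0.trans (hpos y)))
      _ = _ := by ring
  have h2L : LogLip K ψ₂ := by
    have := transferSeq_logLip hl hF hK0 hstep a m hρ.nonneg hρLM
    rwa [add_zero] at this
  have h1nn : ∀ z, 0 ≤ ψ₁ z := transferSeq_nonneg hl hF a m h10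
  have h2nn : ∀ z, 0 ≤ ψ₂ z := transferSeq_nonneg hl hF a m hρ.nonneg
  have h1cc : Continuous ψ₁ := transferSeq_continuous' hl hF a m h1c
  have h2cc : Continuous ψ₂ := transferSeq_continuous' hl hF a m hρc
  have h1pp : Periodic ψ₁ 1 := transferSeq_periodic hl hF a m h1p
  have h2pp : Periodic ψ₂ 1 := transferSeq_periodic hl hF a m hρ.periodic
  have h1I : ∫ t in (0 : ℝ)..1, ψ₁ t = I := integral_transferSeq_self hl hF a m h1c h1p
  have h2I : ∫ t in (0 : ℝ)..1, ψ₂ t = 1 :=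
    (integral_transferSeq_self hl hF a m hρc hρ.periodic).trans hρ.integral_eq
  have hI0 : 0 ≤ I := intervalIntegral.integral_nonneg zero_le_one (fun t _ => h10 t)
  have hIle : I ≤ 3 * (M + R) := by
    have : I ≤ ∫ t in (0 : ℝ)..1, (3 * (M + R)) * ρ t := by
      apply intervalIntegral.integral_mono_on zero_le_one (h1c.intervalIntegrable _ _)
        ((hρc.const_mul _).intervalIntegrable _ _)
      intro t _
      apply mul_le_mul_of_nonneg_right _ (hρ.nonneg t)
      have := (le_abs_self _).trans (hM t)
      rw [hS]; linarith
    rwa [intervalIntegral.integral_const_mul, hρ.integral_eq, mul_one] at this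
  have h1B : ∀ z, ψ₁ z ≤ Real.exp (K + 1) * I := fun z => by
    have := h1L.le_exp_mul_integral (by linarith) h1nn h1cc h1pp z
    rwa [h1I] at this
  have h2B : ∀ z, ψ₂ z ≤ Real.exp (K + 1) := fun z => by
    have := h2L.le_exp_mul_integral (by linarith) h2nn h2cc h2pp z
    rw [h2I, mul_one] at this
    exact this.trans (Real.exp_le_exp.2 (by linarith))
  have h1lip := h1L.lipschitz (by linarith) h1nn h1B
  have h2lip := h2L.lipschitz (by linarith) h2nn h2B
  set E := Real.exp (K + 1)
  have hE : 0 < E := Real.exp_pos _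
  have hmean : ∫ t in (0 : ℝ)..1, Ψ t * ρ t = I - S := by
    rw [hI]
    have : ∀ t, (Ψ t + S) * ρ t = Ψ t * ρ t + S * ρ t := fun t => by ring
    simp_rw [this]
    rw [intervalIntegral.integral_add ((by fun_prop : Continuous fun t => Ψ t * ρ t).intervalIntegrable
      _ _) ((hρc.const_mul _).intervalIntegrable _ _), intervalIntegral.integral_const_mul,
      hρ.integral_eq]
    ring
  have hsplit : (fun z => (Ψ z - ∫ t in (0 : ℝ)..1, Ψ t * ρ t) * ρ z) =
      fun z => 1 * ((Ψ z + S) * ρ z) + (-I) * ρ z := by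
    funext z
    rw [hmean]; ring
  rw [transferSeq_add, hsplit, transferSeq_linear]
  -- After `m` steps `ψ₁ - I ψ₂` is Lipschitz with mean zero, and the remaining `n` steps contract
  -- it. Both parts contribute `I ≤ 3 (M + R)`, whence the `6`; the factor `2` of
  -- `abs_transferSeq_le` makes it the `12` in `decorConst`.
  have key := abs_transferSeq_le hl hA hF (a + m) n (ψ := fun z => 1 * ψ₁ z + (-I) * ψ₂ z)
    (R := 6 * (M + R) * (K + 1) * E) (by fun_prop) (fun z => by simp [h1pp z, h2pp z])
    (fun x y => by
      have e : 1 * ψ₁ x + -I * ψ₂ x - (1 * ψ₁ y + -I * ψ₂ y) =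
        (ψ₁ x - ψ₁ y) - I * (ψ₂ x - ψ₂ y) := by ring
      rw [e]
      refine (abs_sub _ _).trans ?_
      rw [abs_mul, abs_of_nonneg hI0]
      have h1 := h1lip x y
      have h2 := mul_le_mul_of_nonneg_left (h2lip x y) hI0
      have hd := abs_nonneg (x - y)
      have h3 : (K + 1) * (E * I) * |x - y| ≤ (K + 1) * (E * (3 * (M + R))) * |x - y| := by
        gcongr
      have h4 : I * (K * E * |x - y|) ≤ (3 * (M + R)) * ((K + 1) * E * |x - y|) := by
        gcongr; linarith
      linarith)
    (by
      rw [intervalIntegral.integral_add ((h1cc.const_mul _).intervalIntegrable _ _)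
        ((h2cc.const_mul _).intervalIntegrable _ _), intervalIntegral.integral_const_mul,
        intervalIntegral.integral_const_mul, h1I, h2I]
      ring) x
  refine key.trans (le_of_eq ?_)
  have : Real.exp (L + 2 * regConst lam A + 1) = E * Real.exp (regConst lam A) := by
    rw [← Real.exp_add]; congr 1; rw [hKdef]; ring
  rw [decorConst, this, ← hKdef]
  ring

/-- Decorrelation of `Φ x (liftComp F a (m + n) x)`: the two arguments of `Φ` become independent
at an exponential rate. -/
lemma decorrelation_lift (hl : 1 < lam) (hA : 0 ≤ A)
    (hF : ∀ i, IsLift lam A (k i) (F i)) (a m n : ℕ) {L M R : ℝ} (hL : 0 ≤ L) {ρ : ℝ → ℝ}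
    (hρ : IsPeriodicDensity L ρ) {Φ : ℝ → ℝ → ℝ} (hc : Continuous (uncurry Φ))
    (h1 : ∀ y, Periodic (fun x => Φ x y) 1) (h2 : ∀ x, Periodic (Φ x) 1)
    (hM : ∀ x y, |Φ x y| ≤ M) (hR0 : 0 ≤ R)
    (hR : ∀ y x x', |Φ x y - Φ x' y| ≤ R * |liftComp F a m x - liftComp F a m x'|) :
    |(∫ x in (0 : ℝ)..1, Φ x (liftComp F a (m + n) x) * ρ x) -
      ∫ x' in (0 : ℝ)..1, (∫ x in (0 : ℝ)..1, Φ x (liftComp F a (m + n) x') * ρ x) * ρ x'| ≤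
      decorConst lam A L * (M + R) * rate lam A ^ n := by
  have hρc := hρ.continuous
  set e : ℝ → ℝ := fun y => ∫ x in (0 : ℝ)..1, Φ x y * ρ x with he
  have hec : Continuous e := by
    apply intervalIntegral.continuous_parametric_intervalIntegral_of_continuous'
    have : Continuous fun p : ℝ × ℝ => Φ p.2 p.1 * ρ p.2 :=
      (hc.comp (f := fun p : ℝ × ℝ => (p.2, p.1)) (by fun_prop)).mul (by fun_prop)
    exact this
  have hep : Periodic e 1 := fun y => by
    simp only [he]
    congr 1
    funext x
    rw [h2 x y]
  have hEc := liftComp_continuous hF a (m + n)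
  have hc1 : Continuous fun x => Φ x (liftComp F a (m + n) x) * ρ x :=
    (hc.comp (f := fun x : ℝ => (x, liftComp F a (m + n) x)) (by fun_prop)).mul hρc
  have hc2 : Continuous fun x => e (liftComp F a (m + n) x) * ρ x := by fun_prop
  -- `Φ` is centred in its first argument for each `y`. The change of variables evaluates the image
  -- of this centred function at the same `y`, so a bound uniform in the point is needed rather than
  -- one in `L¹`.
  have e1 := integral_transferSeq hl hF a (m + n) (H := fun x y => (Φ x y - e y) * ρ x)
    (by
      have : Continuous fun p : ℝ × ℝ => (Φ p.1 p.2 - e p.2) * ρ p.1 :=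
        (Continuous.sub hc (by fun_prop)).mul (by fun_prop)
      exact this)
    (fun y x => by
      have := h1 y x
      simp only at this
      simp only [this, hρ.periodic x]) (fun x y => by simp only [h2 x y, hep y])
  rw [← intervalIntegral.integral_sub (hc1.intervalIntegrable _ _) (hc2.intervalIntegrable _ _)]
  have e2 : (fun x => Φ x (liftComp F a (m + n) x) * ρ x - e (liftComp F a (m + n) x) * ρ x) =
      fun x => (Φ x (liftComp F a (m + n) x) - e (liftComp F a (m + n) x)) * ρ x := by
    funext x; ring
  rw [e2, e1]
  have := intervalIntegral.norm_integral_le_of_norm_le_const (a := (0 : ℝ)) (b := 1)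
    (f := fun y => transferSeq F k a (m + n) (fun x => (Φ x y - e y) * ρ x) y)
    (C := decorConst lam A L * (M + R) * rate lam A ^ n)
    (fun y _ => abs_transferSeq_centered_le hl hA hF a m n hL hρ
      (hc.comp (f := fun x : ℝ => (x, y)) (by fun_prop)) (h1 y) (fun x => hM x y) hR0 (hR y) y)
  simpa using this

end

/-! ### From the line to the circle -/

lemma integral_circle_eq (g : UnitAddCircle → ℝ) :
    ∫ x, g x = ∫ x in (0 : ℝ)..1, g x := by
  have := UnitAddCircle.intervalIntegral_preimage 0 g
  rw [zero_add] at this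
  exact this.symm

lemma dist_coe_le (s t : ℝ) : dist (s : UnitAddCircle) t ≤ |s - t| := by
  rw [dist_eq_norm, ← AddCircle.coe_sub]
  exact QuotientAddGroup.norm_mk_le_norm

lemma periodic_coe (g : UnitAddCircle → ℝ) : Periodic (fun x : ℝ => g x) 1 := fun x => by
  simp only [AddCircle.coe_add_period]

lemma continuous_coe_circle : Continuous fun x : ℝ => (x : UnitAddCircle) :=
  continuous_quotient_mk'

lemma continuous_of_continuous_coe {X : Type*} [TopologicalSpace X] {g : UnitAddCircle → X}
    (h : Continuous fun x : ℝ => g x) : Continuous g :=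
  isQuotientMap_quotient_mk'.continuous_iff.2 h

/-- Boundedness must be known before `lipConst` can be used as an upper bound, since an unbounded
real supremum has the default value `0`. -/
lemma bddAbove_lipConst {g : UnitAddCircle → ℝ} {K : NNReal} (hg : LipschitzWith K g) :
    BddAbove (Set.range fun p : UnitAddCircle × UnitAddCircle =>
      |g p.1 - g p.2| / dist p.1 p.2) := by
  refine ⟨K, ?_⟩
  rintro _ ⟨p, rfl⟩
  have := hg.dist_le_mul p.1 p.2
  rw [Real.dist_eq] at this
  exact div_le_of_le_mul₀ dist_nonneg K.2 this

lemma lipConst_nonneg (g : UnitAddCircle → ℝ) : 0 ≤ lipConst g :=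
  Real.iSup_nonneg fun _ => by positivity

lemma abs_sub_le_lipConst {g : UnitAddCircle → ℝ} {K : NNReal} (hg : LipschitzWith K g)
    (x y : UnitAddCircle) : |g x - g y| ≤ lipConst g * dist x y := by
  rcases eq_or_ne x y with rfl | hxy
  · simp
  · rw [← div_le_iff₀ (dist_pos.2 hxy)]
    exact le_ciSup (bddAbove_lipConst hg) (x, y)

/-- Lifts `F i` of the maps `T i`, `i ≥ 1`. -/
structure IsLiftedSystem (lam A : ℝ) (T : ℕ → UnitAddCircle → UnitAddCircle) (F : ℕ → ℝ → ℝ)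
    (k : ℕ → ℕ) : Prop where
  one_lt : 1 < lam
  nonneg : 0 ≤ A
  isLift : ∀ i, IsLift lam A (k i) (F i)
  coe : ∀ i, 1 ≤ i → ∀ x : ℝ, T i x = (F i x : UnitAddCircle)

/-- The increment `F (x + 1) - F x` is a continuous integer-valued function, hence constant.
Expansion makes it nonnegative, so it is a degree in `ℕ`. -/
lemma IsExpanding.exists_isLift {lam A : ℝ} (hl : 1 < lam) {T : UnitAddCircle → UnitAddCircle}
    (h : IsExpanding lam A T) :
    ∃ F k, IsLift lam A k F ∧ ∀ x : ℝ, T x = (F x : UnitAddCircle) := by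
  obtain ⟨F, hF, hT, hd, hdd⟩ := h
  have h1 : ∀ x, ∃ n : ℤ, (n : ℝ) = F (x + 1) - F x := by
    intro x
    have e : ((F (x + 1) - F x : ℝ) : UnitAddCircle) = 0 := by
      rw [AddCircle.coe_sub, ← hT, ← hT, AddCircle.coe_add_period, sub_self]
    obtain ⟨n, hn⟩ := (AddCircle.coe_eq_zero_iff 1).1 e
    exact ⟨n, by simpa using hn⟩
  choose n hn using h1
  have hnc : Continuous n := by
    rw [Int.isClosedEmbedding_coe_real.isEmbedding.isInducing.continuous_iff]
    have : ((fun m : ℤ => (m : ℝ)) ∘ n) = fun x => F (x + 1) - F x := funext hn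
    rw [this]
    have := hF.continuous
    fun_prop
  have hconst : ∀ x, n x = n 0 := fun x => PreconnectedSpace.constant inferInstance hnc
  have hpos : 0 ≤ n 0 := by
    have h2 : lam * (0 + 1 - 0) ≤ F (0 + 1) - F 0 :=
      mul_sub_le_image_sub_of_le_deriv (hF.differentiable (by norm_num)) hd (by norm_num)
    rw [← hn 0] at h2
    have : (0 : ℝ) ≤ n 0 := by linarith
    exact_mod_cast this
  refine ⟨F, (n 0).toNat, ⟨hF, fun x => ?_, hd, hdd⟩, hT⟩
  have h3 : (((n 0).toNat : ℤ) : ℝ) = n 0 := by rw [Int.toNat_of_nonneg hpos]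
  rw [Int.cast_natCast] at h3
  rw [h3, ← hconst x, hn]; ring

lemma exists_isLiftedSystem {lam A : ℝ} (hl : 1 < lam) (hA : 0 ≤ A)
    {T : ℕ → UnitAddCircle → UnitAddCircle} (hT : ∀ i, 1 ≤ i → IsExpanding lam A (T i)) :
    ∃ F k, IsLiftedSystem lam A T F k := by
  have h : ∀ i, ∃ F k, IsLift lam A k F ∧ (1 ≤ i → ∀ x : ℝ, T i x = (F x : UnitAddCircle)) := by
    intro i
    by_cases hi : 1 ≤ i
    · obtain ⟨F, k, h1, h2⟩ := (hT i hi).exists_isLift hl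
      exact ⟨F, k, h1, fun _ => h2⟩
    · obtain ⟨F, k, h1, -⟩ := (hT 1 le_rfl).exists_isLift hl
      exact ⟨F, k, h1, fun h => absurd h hi⟩
  choose F k h1 h2 using h
  exact ⟨F, k, hl, hA, h1, h2⟩

lemma IsLogLipDensity.continuous {ϱ : UnitAddCircle → ℝ} (h : IsLogLipDensity ϱ) :
    Continuous ϱ := by
  obtain ⟨h0, ⟨K, hK⟩, -⟩ := h
  have : ϱ = fun x => Real.exp (Real.log (ϱ x)) := funext fun x => (Real.exp_log (h0 x)).symm
  rw [this]
  exact Real.continuous_exp.comp hK.continuous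

lemma IsLogLipDensity.isPeriodicDensity {ϱ : UnitAddCircle → ℝ} (h : IsLogLipDensity ϱ) :
    IsPeriodicDensity (lipConst fun x => Real.log (ϱ x)) (fun x : ℝ => ϱ x) := by
  have hc := h.continuous
  obtain ⟨h0, ⟨K, hK⟩, hI⟩ := h
  refine ⟨hc.comp continuous_coe_circle, periodic_coe ϱ, fun x => (h0 x).le, ?_, ?_⟩
  · intro x y
    have h1 := (le_abs_self _).trans (abs_sub_le_lipConst hK x y)
    have h2 := mul_le_mul_of_nonneg_left (dist_coe_le x y)
      (lipConst_nonneg fun x => Real.log (ϱ x))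
    calc ϱ x = Real.exp (Real.log (ϱ x)) := (Real.exp_log (h0 x)).symm
      _ ≤ Real.exp ((lipConst fun x => Real.log (ϱ x)) * |x - y| + Real.log (ϱ y)) :=
          Real.exp_le_exp.2 (by linarith)
      _ = _ := by rw [Real.exp_add, Real.exp_log (h0 y)]
  · exact (integral_circle_eq ϱ).symm.trans hI

lemma integral_densityMeasure {ϱ : UnitAddCircle → ℝ} (hc : Continuous ϱ) (h0 : ∀ x, 0 ≤ ϱ x)
    (g : UnitAddCircle → ℝ) :
    ∫ x, g x ∂densityMeasure ϱ = ∫ x in (0 : ℝ)..1, g x * ϱ x := by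
  unfold densityMeasure
  rw [integral_withDensity_eq_integral_toReal_smul (by fun_prop) (by simp), integral_circle_eq]
  refine intervalIntegral.integral_congr (fun x _ => ?_)
  simp only [smul_eq_mul, ENNReal.toReal_ofReal (h0 _)]
  ring

lemma isProbabilityMeasure_densityMeasure {ϱ : UnitAddCircle → ℝ} (h : IsLogLipDensity ϱ) :
    IsProbabilityMeasure (densityMeasure ϱ) := by
  constructor
  have hc := h.continuous
  rw [densityMeasure, withDensity_apply _ MeasurableSet.univ, Measure.restrict_univ,
    ← ofReal_integral_eq_lintegral_ofReal _ (Filter.Eventually.of_forall fun x => (h.1 x).le),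
    h.2.2, ENNReal.ofReal_one]
  exact hc.integrable_of_hasCompactSupport (HasCompactSupport.of_compactSpace _)

/-! ### Decorrelation and loss of memory on the circle -/

section

variable {lam A : ℝ} {T : ℕ → UnitAddCircle → UnitAddCircle} {F : ℕ → ℝ → ℝ} {k : ℕ → ℕ}

lemma IsLiftedSystem.seqComp_coe (h : IsLiftedSystem lam A T F k) {a : ℕ} (ha : 1 ≤ a) (n : ℕ)
    (x : ℝ) : seqComp T a n x = (liftComp F a n x : UnitAddCircle) := by
  induction n with
  | zero => rfl
  | succ n ih =>
    show T (a + n) (seqComp T a n x) = (F (a + n) (liftComp F a n x) : UnitAddCircle)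
    rw [ih, h.coe _ (by omega)]

lemma IsLiftedSystem.continuous_seqComp (h : IsLiftedSystem lam A T F k) {a : ℕ} (ha : 1 ≤ a)
    (n : ℕ) : Continuous (seqComp T a n) := by
  refine continuous_of_continuous_coe ?_
  exact (continuous_coe_circle.comp (liftComp_continuous h.isLift a n)).congr
    fun x => (h.seqComp_coe ha n x).symm

lemma seqComp_add (a m n : ℕ) (x : UnitAddCircle) :
    seqComp T a (m + n) x = seqComp T (a + m) n (seqComp T a m x) := by
  induction n with
  | zero => rfl
  | succ n ih =>
    show T (a + (m + n)) (seqComp T a (m + n) x) = T (a + m + n) _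
    rw [ih, add_assoc]

/-- `Ψ` is Lipschitz with constant `R` in terms of the lifted image at time `m`. -/
def DynLip (F : ℕ → ℝ → ℝ) (m : ℕ) (R : ℝ) (Ψ : UnitAddCircle → ℝ) : Prop :=
  ∀ s t : ℝ, |Ψ s - Ψ t| ≤ R * |liftComp F 1 m s - liftComp F 1 m t|

/-- Decorrelation of the two arguments of `Φ x (𝒯_{m + n} x)`. -/
theorem decorrelation (h : IsLiftedSystem lam A T F k) {ϱ : UnitAddCircle → ℝ} {L : ℝ}
    (hϱ : IsLogLipDensity ϱ) (hL : L = lipConst fun x => Real.log (ϱ x)) (m n : ℕ)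
    {Φ : UnitAddCircle → UnitAddCircle → ℝ} (hc : Continuous (uncurry Φ)) {M R : ℝ}
    (hM : ∀ x y, |Φ x y| ≤ M) (hR0 : 0 ≤ R) (hR : ∀ y, DynLip F m R fun x => Φ x y) :
    |(∫ x, Φ x (seqComp T 1 (m + n) x) ∂densityMeasure ϱ) -
      ∫ x', ∫ x, Φ x (seqComp T 1 (m + n) x') ∂densityMeasure ϱ ∂densityMeasure ϱ| ≤
      decorConst lam A L * (M + R) * rate lam A ^ n := by
  subst hL
  have hϱc := hϱ.continuous
  have hϱ0 : ∀ x, 0 ≤ ϱ x := fun x => (hϱ.1 x).le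
  have key := decorrelation_lift h.one_lt h.nonneg h.isLift 1 m n (lipConst_nonneg _)
    hϱ.isPeriodicDensity (Φ := fun x y => Φ x y) (M := M) (R := R)
    (hc.comp (f := fun p : ℝ × ℝ => ((p.1 : UnitAddCircle), (p.2 : UnitAddCircle)))
      ((continuous_coe_circle.comp continuous_fst).prodMk
        (continuous_coe_circle.comp continuous_snd)))
    (fun y => periodic_coe fun x => Φ x y) (fun x => periodic_coe (Φ x)) (fun x y => hM x y) hR0
    (fun y x x' => hR y x x')
  rw [integral_densityMeasure hϱc hϱ0, integral_densityMeasure hϱc hϱ0]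
  simp only [integral_densityMeasure hϱc hϱ0, h.seqComp_coe le_rfl]
  exact key

/-- The transfer operators of circle maps are given by the explicit ones of the lifts. -/
lemma transfer_ae_eq (h : IsLiftedSystem lam A T F k) {ϱ : UnitAddCircle → ℝ}
    (hϱ : IsLogLipDensity ϱ) {a : ℕ} (ha : 1 ≤ a) (n : ℕ) :
    transfer (seqComp T a n) ϱ =ᵐ[volume]
      (transferSeq_periodic h.one_lt h.isLift a n (periodic_coe ϱ)).lift := by
  set hp := transferSeq_periodic h.one_lt h.isLift a n (periodic_coe ϱ)
  set ψ : UnitAddCircle → ℝ := hp.lift with hψ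
  have hϱc := hϱ.continuous
  have hϱ0 : ∀ x, 0 ≤ ϱ x := fun x => (hϱ.1 x).le
  have hcoe : ∀ x : ℝ, ψ x = transferSeq F k a n (fun x : ℝ => ϱ x) x := fun x =>
    hp.lift_coe x
  have hψc : Continuous ψ := by
    refine continuous_of_continuous_coe ?_
    exact (transferSeq_continuous' h.one_lt h.isLift a n
      (hϱc.comp continuous_coe_circle)).congr fun x => (hcoe x).symm
  have hψ0 : ∀ x, 0 ≤ ψ x := by
    intro x
    induction x using QuotientAddGroup.induction_on with
    | H x =>
      exact (transferSeq_nonneg h.one_lt h.isLift a n (fun x : ℝ => hϱ0 x) x).trans_eq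
        (hcoe x).symm
  have hS := h.continuous_seqComp ha n
  have := isProbabilityMeasure_densityMeasure hϱ
  -- Both measures have the same integrals of bounded continuous functions, by the duality between
  -- composition and `transferSeq`. Being finite, they coincide, and `ψ` is the Radon–Nikodym
  -- density almost everywhere.
  have hmeas : (densityMeasure ϱ).map (seqComp T a n) = densityMeasure ψ := by
    have : IsFiniteMeasure (densityMeasure ψ) := by
      constructor
      rw [densityMeasure, withDensity_apply _ MeasurableSet.univ, Measure.restrict_univ]
      have hi : Integrable ψ volume :=
        hψc.integrable_of_hasCompactSupport (HasCompactSupport.of_compactSpace _)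
      rw [← ofReal_integral_eq_lintegral_ofReal hi (Filter.Eventually.of_forall hψ0)]
      exact ENNReal.ofReal_lt_top
    apply ext_of_forall_integral_eq_of_IsFiniteMeasure
    intro v
    rw [integral_map hS.aemeasurable v.continuous.aestronglyMeasurable,
      integral_densityMeasure hϱc hϱ0, integral_densityMeasure hψc hψ0]
    simp only [h.seqComp_coe ha, hcoe]
    exact integral_transferSeq_comp h.one_lt h.isLift a n (ψ := fun x : ℝ => ϱ x)
      (v := fun x : ℝ => v x) (hϱc.comp continuous_coe_circle)
      (v.continuous.comp continuous_coe_circle) (periodic_coe ϱ) (periodic_coe v)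
  have h1 := Measure.rnDeriv_withDensity (volume : Measure UnitAddCircle)
    (f := fun x => ENNReal.ofReal (ψ x)) (by fun_prop)
  filter_upwards [h1] with x hx
  rw [transfer, hmeas, densityMeasure, hx, ENNReal.toReal_ofReal (hψ0 x)]

theorem memoryLoss (h : IsLiftedSystem lam A T F k) {ϱ : UnitAddCircle → ℝ} {L : ℝ}
    (hϱ : IsLogLipDensity ϱ) (hL : L = lipConst fun x => Real.log (ϱ x)) :
    MemoryLoss T ϱ (rate lam A) (decorConst lam A L) := by
  intro a b c ha hab hbc
  have hl := h.one_lt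
  have hK := one_le_regConst hl h.nonneg
  have hper := hϱ.isPeriodicDensity
  rw [← hL] at hper
  have hL0 : 0 ≤ L := hL ▸ lipConst_nonneg _
  obtain ⟨p, rfl⟩ := Nat.exists_eq_add_of_le hab
  obtain ⟨n, hn⟩ : ∃ n, c + 1 - (a + p) = n := ⟨_, rfl⟩
  have hn' : c + 1 - a = p + n := by omega
  rw [hn, hn']
  set ϱ' : ℝ → ℝ := fun x => ϱ x with hϱ'
  have e1 := transfer_ae_eq h hϱ ha (p + n)
  have e2 := transfer_ae_eq h hϱ (ha.trans hab) n
  have e3 : ∫ x, |transfer (seqComp T a (p + n)) ϱ x - transfer (seqComp T (a + p) n) ϱ x| =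
      ∫ x in (0 : ℝ)..1, |transferSeq F k a (p + n) ϱ' x - transferSeq F k (a + p) n ϱ' x| := by
    rw [integral_congr_ae (g := fun x =>
      |(transferSeq_periodic hl h.isLift a (p + n) (periodic_coe ϱ)).lift x -
        (transferSeq_periodic hl h.isLift (a + p) n (periodic_coe ϱ)).lift x|)]
    · rw [integral_circle_eq]; rfl
    · filter_upwards [e1, e2] with x h1 h2
      rw [h1, h2]
  rw [e3]
  set K := L + regConst lam A with hKdef
  have hK0 : 0 ≤ K := by linarith
  set ψ := transferSeq F k a p ϱ' with hψ
  have hψL : LogLip K ψ := by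
    have := transferSeq_logLip hl h.isLift hK0 (add_regConst_step hl h.nonneg hL0) a p hper.nonneg
      (logModulus_zero_iff.2 (hper.logLip.mono hper.nonneg (by linarith)))
    rwa [add_zero] at this
  have hψ0 : ∀ x, 0 ≤ ψ x := transferSeq_nonneg hl h.isLift a p hper.nonneg
  have hψc : Continuous ψ := transferSeq_continuous' hl h.isLift a p hper.continuous
  have hψp : Periodic ψ 1 := transferSeq_periodic hl h.isLift a p hper.periodic
  have hψI : ∫ x in (0 : ℝ)..1, ψ x = 1 :=
    (integral_transferSeq_self hl h.isLift a p hper.continuous hper.periodic).trans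
      hper.integral_eq
  have hϱL : LogLip K ϱ' := hper.logLip.mono hper.nonneg (by linarith)
  have b1 : ∀ x, ψ x ≤ Real.exp K := fun x => by
    have := hψL.le_exp_mul_integral hK0 hψ0 hψc hψp x
    rwa [hψI, mul_one] at this
  have b2 : ∀ x, ϱ' x ≤ Real.exp K := fun x => by
    have := hϱL.le_exp_mul_integral hK0 hper.nonneg hper.continuous hper.periodic x
    rwa [hper.integral_eq, mul_one] at this
  have l1 := hψL.lipschitz hK0 hψ0 b1
  have l2 := hϱL.lipschitz hK0 hper.nonneg b2
  have hϱc := hper.continuous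
  -- Both compositions end with the same `n` maps. The longer one starts them from `ψ` instead of
  -- `ϱ'`, so the difference is the image of the mean-zero function `ψ - ϱ'`.
  have key := abs_transferSeq_le hl h.nonneg h.isLift (a + p) n
    (ψ := fun z => 1 * ψ z + (-1) * ϱ' z) (R := 2 * (K * Real.exp K))
    (by fun_prop) (fun z => by simp [hψp z, hper.periodic z])
    (fun x y => by
      have e : 1 * ψ x + -1 * ϱ' x - (1 * ψ y + -1 * ϱ' y) =
        (ψ x - ψ y) - (ϱ' x - ϱ' y) := by ring
      rw [e]
      refine (abs_sub _ _).trans ?_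
      linarith [l1 x y, l2 x y])
    (by
      rw [intervalIntegral.integral_add ((hψc.const_mul _).intervalIntegrable _ _)
        ((hϱc.const_mul _).intervalIntegrable _ _), intervalIntegral.integral_const_mul,
        intervalIntegral.integral_const_mul, hψI, hper.integral_eq]
      ring)
  rw [transferSeq_linear] at key
  have := intervalIntegral.norm_integral_le_of_norm_le_const (a := (0 : ℝ)) (b := 1)
    (f := fun x => |transferSeq F k a (p + n) ϱ' x - transferSeq F k (a + p) n ϱ' x|)
    (C := 2 * (2 * (K * Real.exp K)) * Real.exp (regConst lam A) * rate lam A ^ n)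
    (fun x _ => by
      rw [transferSeq_add, Real.norm_eq_abs, abs_abs]
      have := key x
      simpa [sub_eq_add_neg] using this)
  simp only [sub_zero, abs_one, mul_one] at this
  refine (le_abs_self _).trans (this.trans ?_)
  apply mul_le_mul_of_nonneg_right _ (pow_nonneg (rate_pos hl).le n)
  have e4 : Real.exp K * Real.exp (regConst lam A) ≤ Real.exp (L + 2 * regConst lam A + 1) := by
    rw [← Real.exp_add]
    apply Real.exp_le_exp.2
    rw [hKdef]; linarith
  rw [decorConst, ← hKdef]
  calc 2 * (2 * (K * Real.exp K)) * Real.exp (regConst lam A)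
      = 4 * K * (Real.exp K * Real.exp (regConst lam A)) := by ring
    _ ≤ 12 * (K + 1) * Real.exp (L + 2 * regConst lam A + 1) := by
      apply mul_le_mul (by linarith) e4 (by positivity) (by linarith)

end

/-! ### Norms of observables -/

section norms

variable {d : ℕ} {f : UnitAddCircle → Fin d → ℝ}

lemma bddAbove_supNorm (hf : Continuous f) :
    BddAbove (Set.range fun p : Fin d × UnitAddCircle => |f p.2 p.1|) := by
  have h1 : ∀ α : Fin d, ∃ c, ∀ x, |f x α| ≤ c := fun α => by
    obtain ⟨c, hc⟩ := isCompact_univ.exists_bound_of_continuousOn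
      (f := fun x => f x α) (by fun_prop : Continuous fun x => f x α).continuousOn
    exact ⟨c, fun x => hc x trivial⟩
  choose c hc using h1
  refine ⟨∑ α, |c α|, ?_⟩
  rintro _ ⟨⟨α, x⟩, rfl⟩
  exact (hc α x).trans ((le_abs_self _).trans
    (Finset.single_le_sum (f := fun α => |c α|) (fun _ _ => abs_nonneg _) (Finset.mem_univ α)))

lemma abs_apply_le_supNorm (hf : Continuous f) (x : UnitAddCircle) (α : Fin d) :
    |f x α| ≤ supNorm f :=
  le_ciSup (bddAbove_supNorm hf) (α, x)

lemma supNorm_nonneg (f : UnitAddCircle → Fin d → ℝ) : 0 ≤ supNorm f :=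
  Real.iSup_nonneg fun _ => abs_nonneg _

lemma supNorm_le_lipNorm (f : UnitAddCircle → Fin d → ℝ) : supNorm f ≤ lipNorm f :=
  le_add_of_nonneg_right (Real.iSup_nonneg fun _ => lipConst_nonneg _)

lemma lipNorm_nonneg (f : UnitAddCircle → Fin d → ℝ) : 0 ≤ lipNorm f :=
  (supNorm_nonneg f).trans (supNorm_le_lipNorm f)

lemma abs_sub_le_lipNorm {K : NNReal} (hf : LipschitzWith K f) (x y : UnitAddCircle) (α : Fin d) :
    |f x α - f y α| ≤ lipNorm f * dist x y := by
  have hα : LipschitzWith K fun x => f x α := by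
    apply LipschitzWith.of_dist_le_mul
    intro x y
    exact (dist_le_pi_dist (f x) (f y) α).trans (hf.dist_le_mul x y)
  refine (abs_sub_le_lipConst hα x y).trans (mul_le_mul_of_nonneg_right ?_ dist_nonneg)
  have h1 : lipConst (fun x => f x α) ≤ ⨆ α : Fin d, lipConst (fun x => f x α) :=
    le_ciSup (f := fun α => lipConst (fun x => f x α)) (Set.finite_range _).bddAbove α
  have := supNorm_nonneg f
  unfold lipNorm
  linarith

end norms

/-! ### Observables of the past and of the future -/

section calculus

variable {lam A : ℝ} {T : ℕ → UnitAddCircle → UnitAddCircle} {F : ℕ → ℝ → ℝ} {k : ℕ → ℕ}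

lemma DynLip.mono {m : ℕ} {R R' : ℝ} {Ψ : UnitAddCircle → ℝ} (h : DynLip F m R Ψ) (hR : R ≤ R') :
    DynLip F m R' Ψ := fun s t =>
  (h s t).trans (mul_le_mul_of_nonneg_right hR (abs_nonneg _))

lemma DynLip.const (m : ℕ) (c : ℝ) : DynLip F m 0 fun _ => c := fun s t => by simp

lemma DynLip.sub_const {m : ℕ} {R : ℝ} {Ψ : UnitAddCircle → ℝ} (h : DynLip F m R Ψ) (c : ℝ) :
    DynLip F m R fun x => Ψ x - c := fun s t => by
  rw [sub_sub_sub_cancel_right]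
  exact h s t

lemma DynLip.const_mul {m : ℕ} {R : ℝ} {Ψ : UnitAddCircle → ℝ} (h : DynLip F m R Ψ) {c : ℝ}
    (hc : 0 ≤ c) : DynLip F m (c * R) fun x => c * Ψ x := fun s t => by
  rw [← mul_sub, abs_mul, abs_of_nonneg hc, mul_assoc]
  exact mul_le_mul_of_nonneg_left (h s t) hc

lemma DynLip.sum {ι : Type*} {m : ℕ} (I : Finset ι) {R : ι → ℝ} {Ψ : ι → UnitAddCircle → ℝ}
    (h : ∀ i ∈ I, DynLip F m (R i) (Ψ i)) :
    DynLip F m (∑ i ∈ I, R i) fun x => ∑ i ∈ I, Ψ i x := fun s t => by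
  rw [← Finset.sum_sub_distrib, Finset.sum_mul]
  exact (Finset.abs_sum_le_sum_abs _ _).trans (Finset.sum_le_sum fun i hi => h i hi s t)

lemma DynLip.mul {m : ℕ} {R R' M M' : ℝ} {Ψ Ψ' : UnitAddCircle → ℝ} (h : DynLip F m R Ψ)
    (h' : DynLip F m R' Ψ') (hM : ∀ x, |Ψ x| ≤ M) (hM' : ∀ x, |Ψ' x| ≤ M') :
    DynLip F m (R * M' + M * R') fun x => Ψ x * Ψ' x := fun s t => by
  have e : Ψ s * Ψ' s - Ψ t * Ψ' t = (Ψ s - Ψ t) * Ψ' s + Ψ t * (Ψ' s - Ψ' t) := by ring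
  rw [e]
  refine (abs_add_le _ _).trans ?_
  rw [abs_mul, abs_mul]
  have h1 := mul_le_mul (h s t) (hM' s) (abs_nonneg _) ((abs_nonneg _).trans (h s t))
  have h2 := mul_le_mul (hM t) (h' s t) (abs_nonneg _) ((abs_nonneg _).trans (hM t))
  linarith

/-- Expansion makes distances at time `i` smaller than those at time `m` by the factor `(lam⁻¹) ^ (m
- i)`. The bound `lam⁻¹ ≤ rate lam A` enters here. -/
lemma DynLip.later (hs : IsLiftedSystem lam A T F k) {i m : ℕ} (him : i ≤ m) {R : ℝ} (hR : 0 ≤ R)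
    {Ψ : UnitAddCircle → ℝ} (h : DynLip F i R Ψ) :
    DynLip F m (R * rate lam A ^ (m - i)) Ψ := fun s t => by
  obtain ⟨n, rfl⟩ := Nat.exists_eq_add_of_le him
  rw [Nat.add_sub_cancel_left]
  have h0 : 0 < lam := by linarith [hs.one_lt]
  have h1 := liftComp_expand hs.one_lt hs.isLift (1 + i) n (liftComp F 1 i s) (liftComp F 1 i t)
  rw [← liftComp_add, ← liftComp_add] at h1
  have h2 : (lam⁻¹) ^ n ≤ rate lam A ^ n :=
    pow_le_pow_left₀ (by positivity) inv_le_rate n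
  have h3 : |liftComp F 1 i s - liftComp F 1 i t| ≤
      (lam⁻¹) ^ n * |liftComp F 1 (i + n) s - liftComp F 1 (i + n) t| := by
    rw [inv_pow, inv_mul_eq_div, le_div_iff₀ (by positivity)]
    linarith
  have h4 := h3.trans (mul_le_mul_of_nonneg_right h2 (abs_nonneg _))
  rw [mul_assoc]
  exact (h s t).trans (mul_le_mul_of_nonneg_left h4 hR)

lemma DynLip.later' (hs : IsLiftedSystem lam A T F k) {i m : ℕ} (him : i ≤ m) {R : ℝ} (hR : 0 ≤ R)
    {Ψ : UnitAddCircle → ℝ} (h : DynLip F i R Ψ) : DynLip F m R Ψ :=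
  (h.later hs him hR).mono (mul_le_of_le_one_right hR
    (pow_le_one₀ (rate_pos hs.one_lt).le (rate_lt_one hs.one_lt).le))

/-- `Z x` is a continuous function of the state at time `p`. -/
def IsFuture {E : Type*} [TopologicalSpace E] (T : ℕ → UnitAddCircle → UnitAddCircle) (p : ℕ)
    (Z : UnitAddCircle → E) : Prop :=
  ∃ z : UnitAddCircle → E, Continuous z ∧ ∀ x, Z x = z (seqComp T 1 p x)

lemma IsFuture.continuous (hs : IsLiftedSystem lam A T F k) {E : Type*} [TopologicalSpace E]
    {p : ℕ} {Z : UnitAddCircle → E} (h : IsFuture T p Z) : Continuous Z := by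
  obtain ⟨z, hz, hZ⟩ := h
  rw [funext hZ]
  exact hz.comp (hs.continuous_seqComp le_rfl p)

lemma IsFuture.mono (hs : IsLiftedSystem lam A T F k) {E : Type*} [TopologicalSpace E]
    {p q : ℕ} (hpq : p ≤ q) {Z : UnitAddCircle → E} (h : IsFuture T q Z) : IsFuture T p Z := by
  obtain ⟨z, hz, hZ⟩ := h
  obtain ⟨n, rfl⟩ := Nat.exists_eq_add_of_le hpq
  refine ⟨z ∘ seqComp T (1 + p) n, hz.comp (hs.continuous_seqComp (by omega) n), fun x => ?_⟩
  rw [hZ, seqComp_add]; rfl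

lemma IsFuture.comp {E E' : Type*} [TopologicalSpace E] [TopologicalSpace E'] {p : ℕ}
    {Z : UnitAddCircle → E} (h : IsFuture T p Z) {u : E → E'} (hu : Continuous u) :
    IsFuture T p fun x => u (Z x) := by
  obtain ⟨z, hz, hZ⟩ := h
  exact ⟨fun y => u (z y), hu.comp hz, fun x => by simp only [hZ]⟩

lemma IsFuture.mul {p : ℕ} {Z Z' : UnitAddCircle → ℝ} (h : IsFuture T p Z) (h' : IsFuture T p Z') :
    IsFuture T p fun x => Z x * Z' x := by
  obtain ⟨z, hz, hZ⟩ := h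
  obtain ⟨z', hz', hZ'⟩ := h'
  exact ⟨fun y => z y * z' y, hz.mul hz', fun x => by simp only [hZ, hZ']⟩

lemma IsFuture.sum {E ι : Type*} [TopologicalSpace E] [AddCommMonoid E] [ContinuousAdd E] {p : ℕ}
    (I : Finset ι) {Z : ι → UnitAddCircle → E} (h : ∀ i ∈ I, IsFuture T p (Z i)) :
    IsFuture T p fun x => ∑ i ∈ I, Z i x := by
  classical
  induction I using Finset.induction_on with
  | empty => exact ⟨fun _ => 0, continuous_const, fun x => by simp⟩
  | insert i I hi ih =>
    obtain ⟨z, hz, hZ⟩ := ih fun j hj => h j (Finset.mem_insert_of_mem hj)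
    obtain ⟨z', hz', hZ'⟩ := h i (Finset.mem_insert_self i I)
    exact ⟨fun y => z' y + z y, hz'.add hz, fun x => by
      have h1 := hZ x
      beta_reduce at h1 ⊢
      rw [Finset.sum_insert hi, hZ', h1]⟩

/-- Surjectivity transfers a sup bound on an `IsFuture` observable to the function of the later
state that represents it. -/
lemma IsLiftedSystem.surjective_seqComp (hs : IsLiftedSystem lam A T F k) (p : ℕ) :
    Surjective (seqComp T 1 p) := by
  have h1 : Surjective (liftComp F 1 p) := by
    induction p with
    | zero => exact surjective_id
    | succ n ih => exact ((hs.isLift _).surjective hs.one_lt).comp ih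
  intro y
  induction y using QuotientAddGroup.induction_on with
  | H y =>
    obtain ⟨x, rfl⟩ := h1 y
    exact ⟨x, hs.seqComp_coe le_rfl p x⟩

variable {ϱ : UnitAddCircle → ℝ} {L : ℝ}

lemma integrable_densityMeasure (hϱ : IsLogLipDensity ϱ) {g : UnitAddCircle → ℝ}
    (hg : Continuous g) : Integrable g (densityMeasure ϱ) := by
  have := isProbabilityMeasure_densityMeasure hϱ
  exact hg.integrable_of_hasCompactSupport (HasCompactSupport.of_compactSpace _)

lemma abs_integral_le_of_abs_le (hϱ : IsLogLipDensity ϱ) {g : UnitAddCircle → ℝ} {c : ℝ}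
    (hg : ∀ x, |g x| ≤ c) : |∫ x, g x ∂densityMeasure ϱ| ≤ c := by
  have := isProbabilityMeasure_densityMeasure hϱ
  have h : ∀ᵐ x ∂densityMeasure ϱ, ‖g x‖ ≤ c := Filter.Eventually.of_forall hg
  have := norm_integral_le_of_norm_le_const h
  simpa using this

/-- Decorrelation of a product of a function that is regular at time `m` and a function of the
state at time `m + n`. -/
theorem decorrelation_mul (hs : IsLiftedSystem lam A T F k) (hϱ : IsLogLipDensity ϱ)
    (hL : L = lipConst fun x => Real.log (ϱ x)) {m n p : ℕ} (hp : m + n = p)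
    {Ψ Z : UnitAddCircle → ℝ} (hΨc : Continuous Ψ) {M R M' : ℝ} (hM : ∀ x, |Ψ x| ≤ M) (hR0 : 0 ≤ R)
    (hR : DynLip F m R Ψ) (hZ : IsFuture T p Z) (hM' : ∀ x, |Z x| ≤ M') :
    |(∫ x, Ψ x * Z x ∂densityMeasure ϱ) -
      (∫ x, Ψ x ∂densityMeasure ϱ) * ∫ x, Z x ∂densityMeasure ϱ| ≤
      decorConst lam A L * ((M + R) * M') * rate lam A ^ n := by
  subst hp
  obtain ⟨z, hz, hZ⟩ := hZ
  have hzM : ∀ y, |z y| ≤ M' := fun y => by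
    obtain ⟨x, rfl⟩ := hs.surjective_seqComp (m + n) y
    rw [← hZ]; exact hM' x
  have hM'0 : 0 ≤ M' := (abs_nonneg _).trans (hM' 0)
  have hM0 : 0 ≤ M := (abs_nonneg _).trans (hM 0)
  have key := decorrelation hs hϱ hL m n (Φ := fun x y => Ψ x * z y) (M := M * M') (R := R * M')
    (by fun_prop) (fun x y => by
      rw [abs_mul]; exact mul_le_mul (hM x) (hzM y) (abs_nonneg _) hM0) (by positivity)
    (fun y s t => by
      rw [← sub_mul, abs_mul]
      have := mul_le_mul (hR s t) (hzM y) (abs_nonneg _) ((abs_nonneg _).trans (hR s t))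
      linarith)
  simp only [← hZ, integral_mul_const, integral_const_mul] at key
  rw [add_mul]
  exact key

/-- Decorrelation of a centred observable of the times between `p` and `q` from its past `P` and
its future `Q`, both at distance `K`. -/
theorem abs_integral_mul_comp_le (hs : IsLiftedSystem lam A T F k) (hϱ : IsLogLipDensity ϱ)
    (hL : L = lipConst fun x => Real.log (ϱ x)) {d p q K : ℕ} (hpq : p ≤ q)
    {Z : UnitAddCircle → ℝ} {MZ RZ RP U₀ U₁ : ℝ} (hMZ : ∀ x, |Z x| ≤ MZ) (hRZ0 : 0 ≤ RZ)
    (hRZ : DynLip F q RZ Z) (hZ : IsFuture T p Z) (hZ0 : ∫ x, Z x ∂densityMeasure ϱ = 0)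
    {P Q : UnitAddCircle → Fin d → ℝ} (hPc : Continuous P) (hRP0 : 0 ≤ RP)
    (hP : (∀ x, P x = 0) ∨ ∃ m, m + K = p ∧ ∀ γ, DynLip F m RP fun x => P x γ)
    (hQ : IsFuture T (q + K) Q) {u : (Fin d → ℝ) → ℝ} (huc : Continuous u) (hu0 : ∀ w, |u w| ≤ U₀)
    (hU₁ : 0 ≤ U₁) (hu1 : ∀ w w', |u w - u w'| ≤ U₁ * ∑ γ, |w γ - w' γ|) :
    |∫ x, Z x * u (P x + Q x) ∂densityMeasure ϱ| ≤
      2 * decorConst lam A L * (MZ * U₀ + RZ * U₀ + MZ * U₁ * (d * RP)) * rate lam A ^ K := by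
  have hμ := isProbabilityMeasure_densityMeasure hϱ
  have hMZ0 : 0 ≤ MZ := (abs_nonneg _).trans (hMZ 0)
  have hU00 : 0 ≤ U₀ := (abs_nonneg _).trans (hu0 0)
  have hC : 0 ≤ decorConst lam A L :=
    (decorConst_pos hs.one_lt hs.nonneg (hL ▸ lipConst_nonneg _)).le
  have hθ : 0 ≤ rate lam A ^ K := pow_nonneg (rate_pos hs.one_lt).le K
  have hZc := hZ.continuous hs
  obtain ⟨φ, hφ, hQφ⟩ := hQ
  have hcomp : ∀ m, (∀ γ, DynLip F m RP fun x => P x γ) → ∀ y, DynLip F m (U₁ * (d * RP))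
      fun x => u (P x + y) := by
    intro m hm y s t
    refine (hu1 _ _).trans ?_
    rw [mul_assoc]
    apply mul_le_mul_of_nonneg_left _ hU₁
    calc ∑ γ, |(P s + y) γ - (P t + y) γ|
        ≤ ∑ _γ : Fin d, RP * |liftComp F 1 m s - liftComp F 1 m t| := by
          apply Finset.sum_le_sum
          intro γ _
          simp only [Pi.add_apply, add_sub_add_right_eq_sub]
          exact hm γ s t
      _ = _ := by simp; ring
  have hPq : ∀ γ, DynLip F q RP fun x => P x γ := by
    rcases hP with hP | ⟨m, hm, hP⟩
    · intro γ
      simp only [hP]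
      exact (DynLip.const q _).mono hRP0
    · exact fun γ => (hP γ).later' hs (by omega) hRP0
  -- First the future is made independent: `Z x * u (P x + φ y)` is regular at time `q` in `x`, and
  -- `y` stands for the state at time `q + K`.
  have step1 := decorrelation hs hϱ hL q K (Φ := fun x y => Z x * u (P x + φ y)) (M := MZ * U₀)
    (R := RZ * U₀ + MZ * (U₁ * (d * RP))) (by fun_prop)
    (fun x y => by
      rw [abs_mul]; exact mul_le_mul (hMZ x) (hu0 _) (abs_nonneg _) hMZ0) (by positivity)
    (fun y => hRZ.mul (hcomp q hPq (φ y)) hMZ (fun x => hu0 _))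
  -- With the future frozen, the past is separated from `Z`, whose mean is zero. The vanishing past
  -- is a separate case because for `p < K` there is no time `m` with `m + K = p`.
  have step2 : ∀ y, |∫ x, Z x * u (P x + y) ∂densityMeasure ϱ| ≤
      decorConst lam A L * (MZ * U₀ + MZ * U₁ * (d * RP)) * rate lam A ^ K := by
    intro y
    rcases hP with hP | ⟨m, hm, hP⟩
    · simp only [hP, zero_add, integral_mul_const, hZ0, zero_mul, abs_zero]
      positivity
    · have := decorrelation_mul hs hϱ hL hm (Ψ := fun x => u (P x + y)) (by fun_prop)
        (fun x => hu0 _) (by positivity) (hcomp m hP y) hZ hMZ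
      rw [hZ0, mul_zero, sub_zero] at this
      simp_rw [mul_comm (Z _)]
      refine this.trans (le_of_eq (by ring))
  have step3 := abs_integral_le_of_abs_le hϱ (fun x' => step2 (φ (seqComp T 1 (q + K) x')))
  simp only [hQφ]
  set a := ∫ x, Z x * u (P x + φ (seqComp T 1 (q + K) x)) ∂densityMeasure ϱ
  set b := ∫ x', ∫ x, Z x * u (P x + φ (seqComp T 1 (q + K) x')) ∂densityMeasure ϱ ∂densityMeasure ϱ
  have e1 : |a| ≤ |a - b| + |b| := by
    have := abs_add_le (a - b) b
    rwa [sub_add_cancel] at this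
  have h5 : 0 ≤ decorConst lam A L * (RZ * U₀) * rate lam A ^ K := by positivity
  linarith

end calculus

/-! ### Correlations of the centred observables -/

section fbar

variable {lam A : ℝ} {T : ℕ → UnitAddCircle → UnitAddCircle} {F : ℕ → ℝ → ℝ} {k : ℕ → ℕ}
  {ϱ : UnitAddCircle → ℝ} {L : ℝ} {d : ℕ} {f : UnitAddCircle → Fin d → ℝ} {κ : NNReal}

lemma isFuture_fbar_self (hf : Continuous f) (i : ℕ) :
    IsFuture T i (fbar (densityMeasure ϱ) T f i) :=
  ⟨fun y α => f y α - ∫ y, f (seqComp T 1 i y) α ∂densityMeasure ϱ, by fun_prop, fun _ => rfl⟩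

lemma isFuture_fbar (hs : IsLiftedSystem lam A T F k) (hf : Continuous f) {p i : ℕ} (hpi : p ≤ i) :
    IsFuture T p (fbar (densityMeasure ϱ) T f i) :=
  (isFuture_fbar_self hf i).mono hs hpi

lemma isFuture_fbar_apply (hs : IsLiftedSystem lam A T F k) (hf : Continuous f) {p i : ℕ}
    (hpi : p ≤ i) (α : Fin d) : IsFuture T p fun x => fbar (densityMeasure ϱ) T f i x α :=
  (isFuture_fbar hs hf hpi).comp (continuous_apply α)

lemma continuous_fbar (hs : IsLiftedSystem lam A T F k) (hf : Continuous f) (i : ℕ) :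
    Continuous (fbar (densityMeasure ϱ) T f i) :=
  (isFuture_fbar_self hf i).continuous hs

lemma continuous_fbar_apply (hs : IsLiftedSystem lam A T F k) (hf : Continuous f) (i : ℕ)
    (α : Fin d) : Continuous fun x => fbar (densityMeasure ϱ) T f i x α :=
  (continuous_apply α).comp (continuous_fbar hs hf i)

lemma integral_fbar (hs : IsLiftedSystem lam A T F k) (hϱ : IsLogLipDensity ϱ) (hf : Continuous f)
    (i : ℕ) (α : Fin d) : ∫ x, fbar (densityMeasure ϱ) T f i x α ∂densityMeasure ϱ = 0 := by
  have := isProbabilityMeasure_densityMeasure hϱ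
  have hc := hs.continuous_seqComp le_rfl i
  simp only [fbar]
  rw [integral_sub (integrable_densityMeasure hϱ (by fun_prop)) (integrable_const _)]
  simp

lemma abs_fbar_le (hϱ : IsLogLipDensity ϱ) (hf : Continuous f) (i : ℕ) (α : Fin d)
    (x : UnitAddCircle) : |fbar (densityMeasure ϱ) T f i x α| ≤ 2 * supNorm f := by
  have h1 := abs_apply_le_supNorm hf (seqComp T 1 i x) α
  have h2 := abs_integral_le_of_abs_le hϱ fun y => abs_apply_le_supNorm hf (seqComp T 1 i y) α
  refine (abs_sub _ _).trans ?_
  linarith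

lemma dynLip_fbar_self (hs : IsLiftedSystem lam A T F k) (hf : LipschitzWith κ f) (i : ℕ)
    (α : Fin d) : DynLip F i (lipNorm f) fun x => fbar (densityMeasure ϱ) T f i x α := by
  intro s t
  simp only [fbar, sub_sub_sub_cancel_right, hs.seqComp_coe le_rfl]
  exact (abs_sub_le_lipNorm hf _ _ α).trans
    (mul_le_mul_of_nonneg_left (dist_coe_le _ _) (lipNorm_nonneg f))

lemma dynLip_fbar (hs : IsLiftedSystem lam A T F k) (hf : LipschitzWith κ f) {i m : ℕ}
    (him : i ≤ m) (α : Fin d) :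
    DynLip F m (lipNorm f) fun x => fbar (densityMeasure ϱ) T f i x α :=
  (dynLip_fbar_self hs hf i α).later' hs him (lipNorm_nonneg f)

lemma abs_integral_fbar_mul_fbar_le (hs : IsLiftedSystem lam A T F k) (hϱ : IsLogLipDensity ϱ)
    (hL : L = lipConst fun x => Real.log (ϱ x)) (hf : LipschitzWith κ f) {i j : ℕ} (hij : i ≤ j)
    (α β : Fin d) :
    |∫ x, fbar (densityMeasure ϱ) T f i x α * fbar (densityMeasure ϱ) T f j x β ∂densityMeasure ϱ| ≤
      6 * decorConst lam A L * lipNorm f ^ 2 * rate lam A ^ (j - i) := by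
  have hC := (decorConst_pos hs.one_lt hs.nonneg (hL ▸ lipConst_nonneg _)).le
  have hS := supNorm_nonneg f
  have hSM := supNorm_le_lipNorm f
  have := decorrelation_mul hs hϱ hL (Nat.add_sub_cancel' hij)
    (continuous_fbar_apply hs hf.continuous i α) (abs_fbar_le hϱ hf.continuous i α)
    (lipNorm_nonneg f) (dynLip_fbar_self hs hf i α)
    (isFuture_fbar_apply (ϱ := ϱ) hs hf.continuous le_rfl β) (abs_fbar_le hϱ hf.continuous j β)
  rw [integral_fbar hs hϱ hf.continuous, zero_mul, sub_zero] at this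
  refine this.trans (mul_le_mul_of_nonneg_right ?_ (pow_nonneg (rate_pos hs.one_lt).le _))
  rw [mul_comm 6, mul_assoc]
  apply mul_le_mul_of_nonneg_left _ hC
  nlinarith

theorem correlationDecay (hs : IsLiftedSystem lam A T F k) (hϱ : IsLogLipDensity ϱ)
    (hL : L = lipConst fun x => Real.log (ϱ x)) (hf : LipschitzWith κ f) {c₂ c₄ : ℝ}
    (hc₂ : 6 * decorConst lam A L * lipNorm f ^ 2 ≤ c₂)
    (hc₄ : 40 * decorConst lam A L * lipNorm f ^ 4 ≤ c₄) :
    CorrelationDecay (densityMeasure ϱ) T f (rate lam A) c₂ c₄ := by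
  have hC := (decorConst_pos hs.one_lt hs.nonneg (hL ▸ lipConst_nonneg _)).le
  have hfc := hf.continuous
  have hM0 := lipNorm_nonneg f
  have hθ := fun n : ℕ => pow_nonneg (rate_pos (A := A) hs.one_lt).le n
  intro α' β' α _ β _ γ _ δ _ i j l m hij hjl hlm
  set μ := densityMeasure ϱ with hμ
  set M := lipNorm f
  set C := decorConst lam A L
  have hb : ∀ i α x, |fbar μ T f i x α| ≤ 2 * M := fun i α x =>
    (abs_fbar_le hϱ hfc i α x).trans (by linarith [supNorm_le_lipNorm f])
  have hbb : ∀ i j α β x, |fbar μ T f i x α * fbar μ T f j x β| ≤ 2 * M * (2 * M) := by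
    intro i j α β x
    rw [abs_mul]
    exact mul_le_mul (hb i α x) (hb j β x) (abs_nonneg _) (by positivity)
  have hbbb : ∀ i j l α β γ x, |fbar μ T f i x α * fbar μ T f j x β * fbar μ T f l x γ| ≤
      2 * M * (2 * M) * (2 * M) := by
    intro i j l α β γ x
    rw [abs_mul]
    exact mul_le_mul (hbb i j α β x) (hb l γ x) (abs_nonneg _) (by positivity)
  have hcont : ∀ i α, Continuous fun x => fbar μ T f i x α := fun i α =>
    continuous_fbar_apply hs hfc i α
  refine ⟨?_, ?_, ?_⟩
  · exact (abs_integral_fbar_mul_fbar_le hs hϱ hL hf hij α β).trans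
      (mul_le_mul_of_nonneg_right hc₂ (hθ _))
  -- Separating the first factor gives the exponent `j - i`, separating the last one the other
  -- exponent; the mean zero of the separated factor removes the product of means. The second
  -- separation determines the constant: three factors have sup norm `8 M³` and regularity `12 M³`,
  -- and `20 M³ · 2 M = 40 M⁴`.
  · have h1 := decorrelation_mul hs hϱ hL (Nat.add_sub_cancel' hij) (hcont i α) (hb i α) hM0
      (dynLip_fbar_self hs hf i α)
      (((isFuture_fbar_apply (ϱ := ϱ) hs hfc le_rfl β).mul
        (isFuture_fbar_apply hs hfc hjl γ)).mul (isFuture_fbar_apply hs hfc (hjl.trans hlm) δ))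
      (hbbb j l m β γ δ)
    have h2 := decorrelation_mul hs hϱ hL (Nat.add_sub_cancel' hlm)
      (((hcont i α).mul (hcont j β)).mul (hcont l γ)) (hbbb i j l α β γ) (by positivity)
      (((dynLip_fbar hs hf (hij.trans hjl) α).mul (dynLip_fbar hs hf hjl β) (hb i α) (hb j β)).mul
        (dynLip_fbar_self hs hf l γ) (hbb i j α β) (hb l γ))
      (isFuture_fbar_apply (ϱ := ϱ) hs hfc le_rfl δ) (hb m δ)
    rw [integral_fbar hs hϱ hfc, zero_mul, sub_zero] at h1
    rw [integral_fbar hs hϱ hfc, mul_zero, sub_zero] at h2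
    rcases le_total (j - i) (m - l) with hle | hle
    · rw [max_eq_right hle]
      refine h2.trans (mul_le_mul_of_nonneg_right (le_trans (le_of_eq ?_) hc₄) (hθ _))
      ring
    · rw [max_eq_left hle]
      have e : ∫ x, fbar μ T f i x α * fbar μ T f j x β * fbar μ T f l x γ * fbar μ T f m x δ ∂μ =
          ∫ x, fbar μ T f i x α *
            (fbar μ T f j x β * fbar μ T f l x γ * fbar μ T f m x δ) ∂μ := by
        congr 1
        funext x
        ring
      rw [e]
      refine h1.trans (mul_le_mul_of_nonneg_right (le_trans ?_ hc₄) (hθ _))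
      have : 0 ≤ C * M ^ 4 := by positivity
      nlinarith
  · have h1 := decorrelation_mul hs hϱ hL (Nat.add_sub_cancel' hjl)
      ((hcont i α).mul (hcont j β)) (hbb i j α β) (by positivity)
      ((dynLip_fbar hs hf hij α).mul (dynLip_fbar_self hs hf j β) (hb i α) (hb j β))
      ((isFuture_fbar_apply (ϱ := ϱ) hs hfc le_rfl γ).mul (isFuture_fbar_apply hs hfc hlm δ))
      (hbb l m γ δ)
    simp only [← mul_assoc] at h1 ⊢
    refine h1.trans (mul_le_mul_of_nonneg_right (le_trans ?_ hc₄) (hθ _))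
    have : 0 ≤ C * M ^ 4 := by positivity
    nlinarith

end fbar

end

section

open ProbabilityTheory

/-! ### The multivariate normal distribution -/

section gaussian

variable {d : ℕ}

/-- The density of the standard normal distribution on `ℝ^d`. -/
def stdDensity (d : ℕ) (ξ : Fin d → ℝ) : ℝ :=
  (Real.sqrt ((2 * Real.pi) ^ d))⁻¹ * Real.exp (-(1 / 2) * (ξ ⬝ᵥ ξ))

lemma stdDensity_eq_prod (ξ : Fin d → ℝ) :
    stdDensity d ξ = ∏ i, gaussianPDFReal 0 1 (ξ i) := by
  simp only [gaussianPDFReal, NNReal.coe_one, mul_one, sub_zero, Finset.prod_mul_distrib,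
    Finset.prod_const, Finset.card_univ, Fintype.card_fin, ← Real.exp_sum]
  rw [stdDensity, dotProduct, Finset.mul_sum, inv_pow]
  congr 2
  · rw [show (2 * Real.pi) ^ d = (Real.sqrt (2 * Real.pi) ^ d) ^ 2 by
        rw [← pow_mul, mul_comm d 2, pow_mul, Real.sq_sqrt (by positivity)],
      Real.sqrt_sq (by positivity)]
  · congr 1
    funext i
    ring

lemma stdDensity_nonneg (ξ : Fin d → ℝ) : 0 ≤ stdDensity d ξ := by
  unfold stdDensity; positivity

lemma continuous_stdDensity : Continuous (stdDensity d) := by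
  unfold stdDensity dotProduct
  fun_prop

lemma integral_stdDensity : ∫ ξ, stdDensity d ξ = 1 := by
  simp only [stdDensity_eq_prod]
  rw [integral_fintype_prod_volume_eq_pow, integral_gaussianPDFReal_eq_one _ one_ne_zero, one_pow]

lemma integrable_stdDensity : Integrable (stdDensity d) := by
  have : stdDensity d = fun ξ => ∏ i, gaussianPDFReal 0 1 (ξ i) := funext stdDensity_eq_prod
  rw [this]
  exact Integrable.fintype_prod fun _ => integrable_gaussianPDFReal 0 1

lemma integrable_mul_gaussianPDFReal : Integrable fun x : ℝ => x * gaussianPDFReal 0 1 x := by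
  have := (integrable_mul_exp_neg_mul_sq (b := 1 / 2) (by norm_num)).const_mul
    (Real.sqrt (2 * Real.pi))⁻¹
  refine this.congr (Filter.Eventually.of_forall fun x => ?_)
  simp only [gaussianPDFReal, NNReal.coe_one, mul_one, sub_zero]
  rw [show -(1 / 2) * x ^ 2 = -x ^ 2 / 2 by ring]
  ring

lemma integrable_mul_stdDensity (i : Fin d) : Integrable fun ξ => ξ i * stdDensity d ξ := by
  classical
  have e : (fun ξ : Fin d → ℝ => ξ i * stdDensity d ξ) =
      fun ξ => ∏ j, (if j = i then fun x => x * gaussianPDFReal 0 1 x else gaussianPDFReal 0 1)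
        (ξ j) := by
    funext ξ
    rw [stdDensity_eq_prod, ← Finset.mul_prod_erase _ _ (Finset.mem_univ i),
      ← Finset.mul_prod_erase _ (fun j => (if j = i then fun x => x * gaussianPDFReal 0 1 x else
        gaussianPDFReal 0 1) (ξ j)) (Finset.mem_univ i)]
    rw [if_pos rfl, mul_assoc]
    congr 2
    refine Finset.prod_congr rfl fun j hj => ?_
    rw [if_neg (Finset.ne_of_mem_erase hj)]
  rw [e]
  refine Integrable.fintype_prod fun j => ?_
  split_ifs
  · exact integrable_mul_gaussianPDFReal
  · exact integrable_gaussianPDFReal 0 1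

lemma hasFDerivAt_stdDensity (ξ : Fin d → ℝ) :
    ∃ D : (Fin d → ℝ) →L[ℝ] ℝ, HasFDerivAt (stdDensity d) D ξ ∧
      ∀ i, D (Pi.single i 1) = -(ξ i * stdDensity d ξ) := by
  have h1 : ∀ i, HasFDerivAt (fun ξ : Fin d → ℝ => ξ i)
      (ContinuousLinearMap.proj (R := ℝ) (φ := fun _ : Fin d => ℝ) i) ξ := fun i =>
    (ContinuousLinearMap.proj (R := ℝ) (φ := fun _ : Fin d => ℝ) i).hasFDerivAt
  have h2 := HasFDerivAt.fun_sum fun i (_ : i ∈ Finset.univ) => (h1 i).mul (h1 i)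
  have h3 := ((h2.const_mul (-(1 / 2))).exp).const_mul (Real.sqrt ((2 * Real.pi) ^ d))⁻¹
  refine ⟨_, h3, fun i => ?_⟩
  simp only [smul_apply, sum_apply, add_apply, ContinuousLinearMap.proj_apply, smul_eq_mul, stdDensity,
    dotProduct]
  have h4 : ∑ x, (ξ x * (Pi.single i (1 : ℝ) : Fin d → ℝ) x +
      ξ x * (Pi.single i (1 : ℝ) : Fin d → ℝ) x) = 2 * ξ i := by
    simp [← two_mul, Pi.single_apply]
  simp only [h4, Pi.mul_apply]
  ring

/-- The standard normal distribution on `ℝ^d`. -/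
def stdMeasure (d : ℕ) : Measure (Fin d → ℝ) :=
  volume.withDensity fun ξ => ENNReal.ofReal (stdDensity d ξ)

lemma integral_stdMeasure (g : (Fin d → ℝ) → ℝ) :
    ∫ ξ, g ξ ∂stdMeasure d = ∫ ξ, g ξ * stdDensity d ξ := by
  have hm := (continuous_stdDensity (d := d)).measurable
  rw [stdMeasure, integral_withDensity_eq_integral_toReal_smul (by fun_prop) (by simp)]
  congr 1
  funext ξ
  rw [ENNReal.toReal_ofReal (stdDensity_nonneg ξ), smul_eq_mul, mul_comm]

lemma integrable_stdMeasure_iff (g : (Fin d → ℝ) → ℝ) :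
    Integrable g (stdMeasure d) ↔ Integrable fun ξ => g ξ * stdDensity d ξ := by
  have hm := (continuous_stdDensity (d := d)).measurable
  rw [stdMeasure, integrable_withDensity_iff (by fun_prop) (by simp)]
  simp only [ENNReal.toReal_ofReal (stdDensity_nonneg _)]

instance isProbabilityMeasure_stdMeasure : IsProbabilityMeasure (stdMeasure d) := by
  constructor
  rw [stdMeasure, withDensity_apply _ MeasurableSet.univ, Measure.restrict_univ,
    ← ofReal_integral_eq_lintegral_ofReal integrable_stdDensity
      (Filter.Eventually.of_forall stdDensity_nonneg), integral_stdDensity, ENNReal.ofReal_one]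

/-- Gaussian integration by parts for the standard normal distribution. -/
lemma integral_mul_stdMeasure {g : (Fin d → ℝ) → ℝ} (hg : Differentiable ℝ g) {c c' : ℝ}
    (hb : ∀ ξ, |g ξ| ≤ c) (i : Fin d) (hb' : ∀ ξ, |fderiv ℝ g ξ (Pi.single i 1)| ≤ c') :
    ∫ ξ, ξ i * g ξ ∂stdMeasure d = ∫ ξ, fderiv ℝ g ξ (Pi.single i 1) ∂stdMeasure d := by
  have hD : ∀ ξ, fderiv ℝ (stdDensity d) ξ (Pi.single i 1) = -(ξ i * stdDensity d ξ) := by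
    intro ξ
    obtain ⟨D, hD, h⟩ := hasFDerivAt_stdDensity ξ
    rw [hD.fderiv, h]
  have hdiff : Differentiable ℝ (stdDensity d) := fun ξ => by
    obtain ⟨D, hD, -⟩ := hasFDerivAt_stdDensity ξ
    exact hD.differentiableAt
  have key := integral_mul_fderiv_eq_neg_fderiv_mul_of_integrable (μ := (volume :
      Measure (Fin d → ℝ))) (f := g) (g := stdDensity d) (v := Pi.single i 1)
    (integrable_stdDensity.bdd_mul
      (measurable_fderiv_apply_const ℝ g _).aestronglyMeasurable
      (Filter.Eventually.of_forall hb'))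
    (by
      simp only [hD]
      exact (integrable_mul_stdDensity i).neg.bdd_mul hg.continuous.aestronglyMeasurable
        (Filter.Eventually.of_forall hb))
    (integrable_stdDensity.bdd_mul hg.continuous.aestronglyMeasurable
      (Filter.Eventually.of_forall hb))
    (fun x _ => hg x) (fun x _ => hdiff x)
  simp only [hD] at key
  rw [integral_stdMeasure, integral_stdMeasure]
  simp only [mul_neg, integral_neg, neg_inj] at key
  rw [← key]
  congr 1
  funext ξ
  ring

open scoped MatrixOrder in
-- The factor `M` realizes the normal distribution with covariance `S` as a linear image of the
-- standard one.
lemma exists_eq_mul_transpose {S : Matrix (Fin d) (Fin d) ℝ} (hS : S.PosDef) :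
    ∃ M : Matrix (Fin d) (Fin d) ℝ, M.det ≠ 0 ∧ S = M * Mᵀ := by
  obtain ⟨b, hb, e⟩ := CStarAlgebra.isStrictlyPositive_iff_eq_star_mul_self.1
    (Matrix.isStrictlyPositive_iff_posDef.2 hS)
  refine ⟨bᵀ, ?_, ?_⟩
  · rw [Matrix.det_transpose]
    exact ((Matrix.isUnit_iff_isUnit_det b).1 hb).ne_zero
  · rw [e, Matrix.transpose_transpose, Matrix.star_eq_conjTranspose,
      Matrix.conjTranspose_eq_transpose_of_trivial]

/-- Under the substitution `w = M ξ` the quadratic form becomes `ξ ⬝ᵥ ξ`, and the Jacobian `|det M|`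
cancels the square root of `det (M * Mᵀ)`. -/
lemma gaussExp_eq_integral {M : Matrix (Fin d) (Fin d) ℝ} (hM : M.det ≠ 0) {h : (Fin d → ℝ) → ℝ}
    (hc : Continuous h) : gaussExp (M * Mᵀ) h = ∫ ξ, h (M *ᵥ ξ) ∂stdMeasure d := by
  have hu : IsUnit M.det := isUnit_iff_ne_zero.2 hM
  have hut : IsUnit Mᵀ.det := by rwa [Matrix.det_transpose]
  have hvol : (volume : Measure (Fin d → ℝ)) =
      ENNReal.ofReal |M.det| • Measure.map (Matrix.toLin' M) volume := by
    rw [Real.map_matrix_volume_pi_eq_smul_volume_pi hM, smul_smul,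
      ← ENNReal.ofReal_mul (abs_nonneg _), ← abs_mul, mul_inv_cancel₀ hM]
    simp
  have hq : ∀ ξ, (M *ᵥ ξ) ⬝ᵥ ((M * Mᵀ)⁻¹ *ᵥ (M *ᵥ ξ)) = ξ ⬝ᵥ ξ := by
    intro ξ
    rw [Matrix.mul_inv_rev, Matrix.mulVec_mulVec, Matrix.mul_assoc, Matrix.nonsing_inv_mul _ hu,
      Matrix.mul_one, Matrix.dotProduct_mulVec, ← Matrix.mulVec_transpose,
      Matrix.transpose_nonsing_inv, Matrix.transpose_transpose, Matrix.mulVec_mulVec,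
      Matrix.nonsing_inv_mul _ hu, Matrix.one_mulVec]
  have hdet : Real.sqrt ((2 * Real.pi) ^ d * (M * Mᵀ).det) =
      Real.sqrt ((2 * Real.pi) ^ d) * |M.det| := by
    rw [Matrix.det_mul, Matrix.det_transpose, Real.sqrt_mul (by positivity),
      Real.sqrt_mul_self_eq_abs]
  have hcexp : Continuous fun w : Fin d → ℝ =>
      Real.exp (-(1 / 2) * (w ⬝ᵥ ((M * Mᵀ)⁻¹ *ᵥ w))) * h w := by
    simp only [dotProduct, Matrix.mulVec]
    fun_prop
  have hlin : Continuous (Matrix.toLin' M) := LinearMap.continuous_of_finiteDimensional _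
  rw [gaussExp, hdet, hvol, integral_smul_measure,
    integral_map hlin.aemeasurable hcexp.aestronglyMeasurable, integral_stdMeasure,
    ENNReal.toReal_ofReal (abs_nonneg _)]
  simp only [Matrix.toLin'_apply, hq, smul_eq_mul, stdDensity]
  rw [← mul_assoc, ← integral_const_mul]
  congr 1
  funext ξ
  have : |M.det| ≠ 0 := abs_ne_zero.2 hM
  field_simp

/-- A normal distribution with covariance matrix `S`, characterized by integration by parts. -/
theorem exists_gaussian {S : Matrix (Fin d) (Fin d) ℝ} (hS : S.PosDef) :
    ∃ γ : Measure (Fin d → ℝ), IsProbabilityMeasure γ ∧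
      (∀ h : (Fin d → ℝ) → ℝ, Continuous h → gaussExp S h = ∫ w, h w ∂γ) ∧
      (∀ α, Integrable (fun w => w α) γ) ∧
      ∀ u : (Fin d → ℝ) → ℝ, Differentiable ℝ u → ∀ c c' : ℝ, (∀ w, |u w| ≤ c) →
        (∀ w β, |fderiv ℝ u w (Pi.single β 1)| ≤ c') → ∀ α,
        ∫ w, w α * u w ∂γ = ∑ β, S α β * ∫ w, fderiv ℝ u w (Pi.single β 1) ∂γ := by
  obtain ⟨M, hM, rfl⟩ := exists_eq_mul_transpose hS
  set B : (Fin d → ℝ) →L[ℝ] (Fin d → ℝ) := LinearMap.toContinuousLinearMap (Matrix.toLin' M)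
  have hB : ∀ ξ, B ξ = M *ᵥ ξ := fun ξ => by simp [B]
  have hBm : AEMeasurable B (stdMeasure d) := B.continuous.aemeasurable
  have hcoord : ∀ i : Fin d, Integrable (fun ξ => ξ i) (stdMeasure d) := fun i =>
    (integrable_stdMeasure_iff _).2 (integrable_mul_stdDensity i)
  refine ⟨(stdMeasure d).map B, Measure.isProbabilityMeasure_map hBm, fun h hc => ?_, fun α => ?_,
    fun u hu c c' hc hc' α => ?_⟩
  · rw [gaussExp_eq_integral hM hc, integral_map hBm hc.aestronglyMeasurable]
    simp only [hB]
  · rw [integrable_map_measure (continuous_apply α).aestronglyMeasurable hBm]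
    have : ((fun w : Fin d → ℝ => w α) ∘ B) = fun ξ => ∑ i, M α i * ξ i := by
      funext ξ
      simp [hB, Matrix.mulVec, dotProduct]
    rw [this]
    exact integrable_finsetSum _ fun i _ => (hcoord i).const_mul _
  · have hfd := fun β => measurable_fderiv_apply_const ℝ u (Pi.single β (1 : ℝ))
    have hcu : Continuous fun w : Fin d → ℝ => w α * u w :=
      (continuous_apply α).mul hu.continuous
    rw [integral_map hBm hcu.aestronglyMeasurable]
    simp_rw [fun β => integral_map hBm (hfd β).aestronglyMeasurable (f := fun w =>
      fderiv ℝ u w (Pi.single β 1))]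
    have hdB : Differentiable ℝ (u ∘ B) := hu.comp B.differentiable
    have hfB : ∀ ξ i, fderiv ℝ (u ∘ B) ξ (Pi.single i 1) =
        ∑ β, M β i * fderiv ℝ u (B ξ) (Pi.single β 1) := by
      intro ξ i
      rw [fderiv_comp ξ (hu _) B.differentiableAt, B.fderiv]
      have : B (Pi.single i 1) = ∑ β, M β i • (Pi.single β 1 : Fin d → ℝ) := by
        funext β
        simp [hB, Finset.sum_apply, Pi.single_apply]
      rw [ContinuousLinearMap.comp_apply, this, map_sum]
      simp
    have hbd : ∀ ξ i, |fderiv ℝ (u ∘ B) ξ (Pi.single i 1)| ≤ ∑ β, |M β i| * c' := by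
      intro ξ i
      rw [hfB]
      refine (Finset.abs_sum_le_sum_abs _ _).trans (Finset.sum_le_sum fun β _ => ?_)
      rw [abs_mul]
      exact mul_le_mul_of_nonneg_left (hc' _ _) (abs_nonneg _)
    -- Integration by parts in each coordinate is summed with the weights `M α i`. The chain rule
    -- supplies another factor `M β i`, and `∑ i, M α i * M β i` is the covariance.
    have hibp := fun i => integral_mul_stdMeasure hdB (fun ξ => hc (B ξ)) i (fun ξ => hbd ξ i)
    have hint : ∀ β, Integrable (fun ξ => fderiv ℝ u (B ξ) (Pi.single β 1)) (stdMeasure d) := by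
      intro β
      have hmeas : Measurable fun ξ => fderiv ℝ u (B ξ) (Pi.single β 1) :=
        (hfd β).comp B.continuous.measurable
      exact Integrable.of_bound hmeas.aestronglyMeasurable c'
        (Filter.Eventually.of_forall fun ξ => hc' _ _)
    have e1 : ∀ ξ, B ξ α * u (B ξ) = ∑ i, M α i * (ξ i * (u ∘ B) ξ) := by
      intro ξ
      simp only [hB, Matrix.mulVec, dotProduct, Finset.sum_mul, Function.comp]
      exact Finset.sum_congr rfl fun i _ => by ring
    have e2 : ∀ i, Integrable (fun ξ => M α i * (ξ i * (u ∘ B) ξ)) (stdMeasure d) := by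
      intro i
      refine Integrable.const_mul ?_ _
      simp_rw [mul_comm (_ : ℝ) ((u ∘ B) _)]
      exact (hcoord i).bdd_mul hdB.continuous.aestronglyMeasurable
        (Filter.Eventually.of_forall fun ξ => hc (B ξ))
    simp_rw [e1]
    rw [integral_finsetSum _ fun i _ => e2 i]
    simp_rw [integral_const_mul, hibp, hfB]
    have e3 : ∀ i, ∫ ξ, ∑ β, M β i * fderiv ℝ u (B ξ) (Pi.single β 1) ∂stdMeasure d =
        ∑ β, M β i * ∫ ξ, fderiv ℝ u (B ξ) (Pi.single β 1) ∂stdMeasure d := by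
      intro i
      rw [integral_finsetSum _ fun β _ => (hint β).const_mul _]
      simp_rw [integral_const_mul]
    simp_rw [e3, Finset.mul_sum]
    rw [Finset.sum_comm]
    refine Finset.sum_congr rfl fun β _ => ?_
    rw [Matrix.mul_apply, Finset.sum_mul]
    refine Finset.sum_congr rfl fun i _ => ?_
    rw [Matrix.transpose_apply]
    ring

end gaussian

end

/-! ### Geometric sums -/

section geometric

lemma sum_pow_le_of_injOn {θ : ℝ} (h0 : 0 < θ) (h1 : θ < 1) (I : Finset ℕ) (g : ℕ → ℕ) (K : ℕ)
    (hg : Set.InjOn g I) (hK : ∀ j ∈ I, K ≤ g j) : ∑ j ∈ I, θ ^ g j ≤ θ ^ K / (1 - θ) := by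
  have e : ∑ j ∈ I, θ ^ g j = θ ^ K * ∑ m ∈ I.image fun j => g j - K, θ ^ m := by
    rw [Finset.sum_image, Finset.mul_sum]
    · refine Finset.sum_congr rfl fun j hj => ?_
      rw [← pow_add, Nat.add_sub_cancel' (hK j hj)]
    · intro i hi j hj hij
      refine hg hi hj ?_
      have := hK i hi
      have := hK j hj
      simp only at hij
      omega
  rw [e, div_eq_mul_inv, ← tsum_geometric_of_lt_one h0.le h1]
  exact mul_le_mul_of_nonneg_left ((summable_geometric_of_lt_one h0.le h1).sum_le_tsum _
    fun _ _ => (pow_pos h0 _).le) (pow_pos h0 _).le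

/-- With truncated subtraction the exponent is `|i - j|`. Each side of `i` contributes one geometric
series, whence the factor `2`. -/
lemma sum_pow_dist_le {θ : ℝ} (h0 : 0 < θ) (h1 : θ < 1) (I : Finset ℕ) (i K : ℕ)
    (hK : ∀ j ∈ I, K ≤ (i - j) + (j - i)) :
    ∑ j ∈ I, θ ^ ((i - j) + (j - i)) ≤ 2 * θ ^ K / (1 - θ) := by
  rw [← Finset.sum_filter_add_sum_filter_not I fun j => j ≤ i]
  have a1 := sum_pow_le_of_injOn h0 h1 (I.filter fun j => j ≤ i) (fun j => (i - j) + (j - i)) K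
    (by
      intro a ha b hb hab
      simp only [Finset.coe_filter, Set.mem_ofPred_eq] at ha hb hab
      omega)
    (fun j hj => hK j (Finset.mem_filter.1 hj).1)
  have a2 := sum_pow_le_of_injOn h0 h1 (I.filter fun j => ¬ j ≤ i) (fun j => (i - j) + (j - i)) K
    (by
      intro a ha b hb hab
      simp only [Finset.coe_filter, Set.mem_ofPred_eq] at ha hb hab
      omega)
    (fun j hj => hK j (Finset.mem_filter.1 hj).1)
  have e : 2 * θ ^ K / (1 - θ) = θ ^ K / (1 - θ) + θ ^ K / (1 - θ) := by ring
  rw [e]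
  exact add_le_add a1 a2

end geometric

/-! ### Taylor estimates in terms of partial derivatives -/

section taylor

variable {d : ℕ}

lemma fderiv_apply_eq_sum (u : (Fin d → ℝ) → ℝ) (w y : Fin d → ℝ) :
    fderiv ℝ u w y = ∑ β, fderiv ℝ u w (Pi.single β 1) * y β := by
  have := (fderiv ℝ u w).toLinearMap.pi_apply_eq_sum_univ y
  simp only [ContinuousLinearMap.coe_coe] at this
  rw [this]
  refine Finset.sum_congr rfl fun β _ => ?_
  rw [smul_eq_mul, mul_comm]
  congr 2
  funext j
  simp [Pi.single_apply, eq_comm]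

lemma abs_sub_le_of_partial_le {u : (Fin d → ℝ) → ℝ} (hu : Differentiable ℝ u) {D : ℝ}
    (hD : ∀ w β, |fderiv ℝ u w (Pi.single β 1)| ≤ D) (w w' : Fin d → ℝ) :
    |u w - u w'| ≤ D * ∑ γ, |w γ - w' γ| := by
  have hder : ∀ t : ℝ, HasDerivAt (fun t : ℝ => u (w' + t • (w - w')))
      (fderiv ℝ u (w' + t • (w - w')) (w - w')) t := fun t => by
    have h1 : HasDerivAt (fun t : ℝ => w' + t • (w - w')) (w - w') t := by
      simpa using ((hasDerivAt_id t).smul_const (w - w')).const_add w'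
    exact (hu _).hasFDerivAt.comp_hasDerivAt t h1
  have := (convex_univ).norm_image_sub_le_of_norm_hasDerivWithin_le (C := D * ∑ γ, |w γ - w' γ|)
    (fun t _ => (hder t).hasDerivWithinAt) (fun t _ => by
      rw [fderiv_apply_eq_sum, Finset.mul_sum]
      refine (Finset.abs_sum_le_sum_abs _ _).trans (Finset.sum_le_sum fun β _ => ?_)
      rw [abs_mul]
      exact mul_le_mul_of_nonneg_right (hD _ _) (abs_nonneg _)) (Set.mem_univ 0) (Set.mem_univ 1)
  simpa using this

/-- The derivative is taken at the end point `w + y`, which will be the whole sum `W`: the linear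
terms must contain `∂_β u (W)`, as in Gaussian integration by parts. -/
lemma abs_taylor_le {u : (Fin d → ℝ) → ℝ} (hu : Differentiable ℝ u) {D : ℝ} (hD0 : 0 ≤ D)
    (hD : ∀ w w' β, |fderiv ℝ u w (Pi.single β 1) - fderiv ℝ u w' (Pi.single β 1)| ≤
      D * ∑ γ, |w γ - w' γ|) (w y : Fin d → ℝ) :
    |u (w + y) - u w - ∑ β, fderiv ℝ u (w + y) (Pi.single β 1) * y β| ≤
      D * ∑ β, ∑ γ, |y β| * |y γ| := by
  have hder : ∀ t : ℝ, HasDerivAt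
      (fun t : ℝ => u (w + t • y) - t * ∑ β, fderiv ℝ u (w + y) (Pi.single β 1) * y β)
      (∑ β, fderiv ℝ u (w + t • y) (Pi.single β 1) * y β -
        ∑ β, fderiv ℝ u (w + y) (Pi.single β 1) * y β) t := fun t => by
    have h1 : HasDerivAt (fun t : ℝ => w + t • y) y t := by
      simpa using ((hasDerivAt_id t).smul_const y).const_add w
    have h2 : HasDerivAt (fun t : ℝ => u (w + t • y)) (fderiv ℝ u (w + t • y) y) t :=
      (hu (w + t • y)).hasFDerivAt.comp_hasDerivAt t h1
    rw [fderiv_apply_eq_sum] at h2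
    have h3 := (hasDerivAt_id' t).mul_const (∑ β, fderiv ℝ u (w + y) (Pi.single β 1) * y β)
    rw [one_mul] at h3
    exact h2.sub h3
  have := (convex_Icc (0 : ℝ) 1).norm_image_sub_le_of_norm_hasDerivWithin_le
    (C := D * ∑ β, ∑ γ, |y β| * |y γ|)
    (fun t _ => (hder t).hasDerivWithinAt) (fun t ht => by
      rw [← Finset.sum_sub_distrib, Finset.mul_sum]
      refine (Finset.abs_sum_le_sum_abs _ _).trans (Finset.sum_le_sum fun β _ => ?_)
      rw [← sub_mul, abs_mul, ← Finset.mul_sum]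
      have h1 := hD (w + t • y) (w + y) β
      have h2 : ∑ γ, |(w + t • y) γ - (w + y) γ| ≤ ∑ γ, |y γ| := by
        refine Finset.sum_le_sum fun γ _ => ?_
        simp only [Pi.add_apply, Pi.smul_apply, smul_eq_mul, add_sub_add_left_eq_sub]
        rw [show t * y γ - y γ = (t - 1) * y γ by ring, abs_mul]
        have : |t - 1| ≤ 1 := by rw [abs_le]; constructor <;> linarith [ht.1, ht.2]
        exact mul_le_of_le_one_left (abs_nonneg _) this
      have h3 := mul_le_mul_of_nonneg_right (h1.trans (mul_le_mul_of_nonneg_left h2 hD0))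
        (abs_nonneg (y β))
      calc _ ≤ _ := h3
        _ = _ := by ring) (Set.left_mem_Icc.2 zero_le_one) (Set.right_mem_Icc.2 zero_le_one)
  simp only [one_smul, zero_smul, add_zero, one_mul, zero_mul, sub_zero, norm_one, mul_one,
    Real.norm_eq_abs] at this
  rwa [sub_right_comm] at this

end taylor

/-! ### Partial sums over windows of indices -/

section partialSum

variable {d : ℕ}

/-- The normalized partial sum of the `f̄^i` over `i ∈ I`. -/
def partialSum (μ : Measure UnitAddCircle) (T : ℕ → UnitAddCircle → UnitAddCircle)
    (f : UnitAddCircle → Fin d → ℝ) (s : ℝ) (I : Finset ℕ) (x : UnitAddCircle) : Fin d → ℝ :=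
  s • ∑ i ∈ I, fbar μ T f i x

lemma partialSum_apply (μ : Measure UnitAddCircle) (T : ℕ → UnitAddCircle → UnitAddCircle)
    (f : UnitAddCircle → Fin d → ℝ) (s : ℝ) (I : Finset ℕ) (x : UnitAddCircle) (α : Fin d) :
    partialSum μ T f s I x α = s * ∑ i ∈ I, fbar μ T f i x α := by
  simp [partialSum]

/-- The indices `i < N` with `|i - n| < K`. -/
def nearIdx (N n K : ℕ) : Finset ℕ := (Finset.range N).filter fun i => n < i + K ∧ i < n + K

/-- The indices `i < N` with `i ≤ n - K`. -/
def pastIdx (N n K : ℕ) : Finset ℕ := (Finset.range N).filter fun i => i + K ≤ n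

/-- The indices `i < N` with `n + K ≤ i`. -/
def futureIdx (N n K : ℕ) : Finset ℕ := (Finset.range N).filter fun i => n + K ≤ i

lemma card_nearIdx_le (N n K : ℕ) : ((nearIdx N n K).card : ℝ) ≤ 2 * K := by
  have h1 : nearIdx N n K ⊆ Finset.Ico (n + 1 - K) (n + K) := fun i hi => by
    simp only [nearIdx, Finset.mem_filter, Finset.mem_Ico] at hi ⊢
    omega
  have h2 := Finset.card_le_card h1
  rw [Nat.card_Ico] at h2
  have : (nearIdx N n K).card ≤ 2 * K := by omega
  exact_mod_cast this

lemma sum_range_eq_windows {E : Type*} [AddCommMonoid E] (N n : ℕ) {K : ℕ} (hK : 1 ≤ K)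
    (g : ℕ → E) : ∑ i ∈ Finset.range N, g i =
      ∑ i ∈ pastIdx N n K, g i + ∑ i ∈ futureIdx N n K, g i + ∑ i ∈ nearIdx N n K, g i := by
  rw [← Finset.sum_filter_add_sum_filter_not (Finset.range N) fun i => ¬ (n < i + K ∧ i < n + K)]
  congr 1
  · rw [← Finset.sum_filter_add_sum_filter_not
      ((Finset.range N).filter fun i => ¬ (n < i + K ∧ i < n + K)) fun i => i + K ≤ n]
    congr 1
    · congr 1
      ext i
      simp only [pastIdx, Finset.mem_filter]
      constructor
      · exact fun h => ⟨h.1.1, h.2⟩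
      · exact fun h => ⟨⟨h.1, by omega⟩, h.2⟩
    · congr 1
      ext i
      simp only [futureIdx, Finset.mem_filter]
      constructor
      · exact fun h => ⟨h.1.1, by omega⟩
      · exact fun h => ⟨⟨h.1, by omega⟩, by omega⟩
  · congr 1
    ext i
    simp only [nearIdx, Finset.mem_filter, not_not]

lemma partialSum_range (μ : Measure UnitAddCircle) (T : ℕ → UnitAddCircle → UnitAddCircle)
    (f : UnitAddCircle → Fin d → ℝ) (s : ℝ) (N n : ℕ) {K : ℕ} (hK : 1 ≤ K) (x : UnitAddCircle) :
    partialSum μ T f s (Finset.range N) x = partialSum μ T f s (pastIdx N n K) x +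
      partialSum μ T f s (futureIdx N n K) x + partialSum μ T f s (nearIdx N n K) x := by
  simp only [partialSum]
  rw [sum_range_eq_windows N n hK, smul_add, smul_add]

variable {lam A : ℝ} {T : ℕ → UnitAddCircle → UnitAddCircle} {F : ℕ → ℝ → ℝ} {k : ℕ → ℕ}
  {ϱ : UnitAddCircle → ℝ} {L : ℝ} {f : UnitAddCircle → Fin d → ℝ} {κ : NNReal}

lemma isFuture_partialSum (hs : IsLiftedSystem lam A T F k) (hf : Continuous f) (s : ℝ) {p : ℕ}
    {I : Finset ℕ} (hI : ∀ i ∈ I, p ≤ i) :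
    IsFuture T p (partialSum (densityMeasure ϱ) T f s I) :=
  (IsFuture.sum I fun i hi => isFuture_fbar hs hf (hI i hi)).comp
    (u := fun v => s • v) (by fun_prop)

lemma continuous_partialSum (hs : IsLiftedSystem lam A T F k) (hf : Continuous f) (s : ℝ)
    (I : Finset ℕ) : Continuous (partialSum (densityMeasure ϱ) T f s I) :=
  (isFuture_partialSum hs hf s fun _ _ => Nat.zero_le _).continuous hs

lemma continuous_partialSum_apply (hs : IsLiftedSystem lam A T F k) (hf : Continuous f) (s : ℝ)
    (I : Finset ℕ) (α : Fin d) :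
    Continuous fun x => partialSum (densityMeasure ϱ) T f s I x α :=
  (continuous_apply α).comp (continuous_partialSum hs hf s I)

lemma abs_partialSum_apply_le (hϱ : IsLogLipDensity ϱ) (hf : Continuous f) {s : ℝ} (hs0 : 0 ≤ s)
    (hs1 : s ≤ 1) (I : Finset ℕ) (x : UnitAddCircle) (α : Fin d) :
    |partialSum (densityMeasure ϱ) T f s I x α| ≤ I.card * (2 * supNorm f) := by
  rw [partialSum_apply, abs_mul, abs_of_nonneg hs0]
  refine (mul_le_of_le_one_left (abs_nonneg _) hs1).trans ?_
  refine (Finset.abs_sum_le_sum_abs _ _).trans ?_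
  refine (Finset.sum_le_sum fun i _ => abs_fbar_le hϱ hf i α x).trans (le_of_eq ?_)
  simp

/-- The bound does not depend on the number of summands, because relative to the position at time
`m` the term with index `i` is damped by `rate lam A ^ (m - i)`. -/
lemma dynLip_partialSum (hs : IsLiftedSystem lam A T F k) (hf : LipschitzWith κ f) {s : ℝ}
    (hs0 : 0 ≤ s) (hs1 : s ≤ 1) {m : ℕ} {I : Finset ℕ} (hI : ∀ i ∈ I, i ≤ m) (γ : Fin d) :
    DynLip F m (2 * lipNorm f / (1 - rate lam A))
      fun x => partialSum (densityMeasure ϱ) T f s I x γ := by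
  have hM := lipNorm_nonneg f
  have hθ0 := rate_pos (A := A) hs.one_lt
  have hθ1 := rate_lt_one (A := A) hs.one_lt
  have h1 := (DynLip.sum I fun i hi =>
    (dynLip_fbar_self (ϱ := ϱ) hs hf i γ).later hs (hI i hi) hM).const_mul hs0
  simp only [partialSum_apply]
  refine h1.mono ?_
  rw [← Finset.mul_sum]
  have h2 : ∑ i ∈ I, rate lam A ^ (m - i) ≤ 2 * rate lam A ^ 0 / (1 - rate lam A) := by
    refine le_trans (le_of_eq (Finset.sum_congr rfl fun i hi => ?_))
      (sum_pow_dist_le hθ0 hθ1 I m 0 fun _ _ => Nat.zero_le _)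
    rw [Nat.sub_eq_zero_of_le (hI i hi), add_zero]
  have h3 := mul_le_mul_of_nonneg_left h2 hM
  have h4 : 0 ≤ ∑ i ∈ I, rate lam A ^ (m - i) :=
    Finset.sum_nonneg fun _ _ => (pow_pos hθ0 _).le
  refine (mul_le_of_le_one_left (mul_nonneg hM h4) hs1).trans (h3.trans (le_of_eq ?_))
  rw [pow_zero]; ring

lemma abs_covariance_le (hs : IsLiftedSystem lam A T F k) (hϱ : IsLogLipDensity ϱ)
    (hL : L = lipConst fun x => Real.log (ϱ x)) (hf : LipschitzWith κ f) (i j : ℕ) (α β : Fin d) :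
    |∫ x, fbar (densityMeasure ϱ) T f i x α * fbar (densityMeasure ϱ) T f j x β ∂densityMeasure ϱ| ≤
      6 * decorConst lam A L * lipNorm f ^ 2 * rate lam A ^ ((i - j) + (j - i)) := by
  rcases le_total i j with h | h
  · rw [Nat.sub_eq_zero_of_le h, zero_add]
    exact abs_integral_fbar_mul_fbar_le hs hϱ hL hf h α β
  · rw [Nat.sub_eq_zero_of_le h, add_zero]
    simp_rw [mul_comm (fbar (densityMeasure ϱ) T f i _ α)]
    exact abs_integral_fbar_mul_fbar_le hs hϱ hL hf h β α

lemma integral_fbar_mul_partialSum (hs : IsLiftedSystem lam A T F k) (hϱ : IsLogLipDensity ϱ)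
    (hf : Continuous f) (s : ℝ) (I : Finset ℕ) (n : ℕ) (α β : Fin d) :
    ∫ x, fbar (densityMeasure ϱ) T f n x α * partialSum (densityMeasure ϱ) T f s I x β
        ∂densityMeasure ϱ =
      s * ∑ j ∈ I, ∫ x, fbar (densityMeasure ϱ) T f n x α * fbar (densityMeasure ϱ) T f j x β
        ∂densityMeasure ϱ := by
  have hint : ∀ j ∈ I, Integrable (fun x => fbar (densityMeasure ϱ) T f n x α *
      fbar (densityMeasure ϱ) T f j x β) (densityMeasure ϱ) := fun j _ =>
    integrable_densityMeasure hϱ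
      ((continuous_fbar_apply hs hf n α).mul (continuous_fbar_apply hs hf j β))
  rw [← integral_finsetSum _ hint, ← integral_const_mul]
  congr 1
  funext x
  rw [partialSum_apply, ← Finset.mul_sum]
  ring

/-- Summable correlations make the second moment linear in the number of indices. For `s = N^{-1/2}`
and a window of length `K` this is `O(K / N)` rather than `O(K² / N)`, and so saves a logarithm in
the final rate. -/
lemma integral_partialSum_sq_le (hs : IsLiftedSystem lam A T F k) (hϱ : IsLogLipDensity ϱ)
    (hL : L = lipConst fun x => Real.log (ϱ x)) (hf : LipschitzWith κ f) {s : ℝ} (hs0 : 0 ≤ s)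
    (I : Finset ℕ) (β : Fin d) :
    ∫ x, partialSum (densityMeasure ϱ) T f s I x β ^ 2 ∂densityMeasure ϱ ≤
      s ^ 2 * I.card * (12 * decorConst lam A L * lipNorm f ^ 2 / (1 - rate lam A)) := by
  have hC := (decorConst_pos hs.one_lt hs.nonneg (hL ▸ lipConst_nonneg _)).le
  have hfc := hf.continuous
  set μ := densityMeasure ϱ with hμ
  have e : ∫ x, partialSum μ T f s I x β ^ 2 ∂μ =
      s * ∑ i ∈ I, (s * ∑ j ∈ I, ∫ x, fbar μ T f i x β * fbar μ T f j x β ∂μ) := by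
    simp_rw [hμ, ← integral_fbar_mul_partialSum hs hϱ hfc]
    have hint : ∀ i ∈ I, Integrable (fun x => fbar (densityMeasure ϱ) T f i x β *
        partialSum (densityMeasure ϱ) T f s I x β) (densityMeasure ϱ) := fun i _ =>
      integrable_densityMeasure hϱ
        ((continuous_fbar_apply hs hfc i β).mul (continuous_partialSum_apply hs hfc s I β))
    rw [← integral_finsetSum _ hint, ← integral_const_mul]
    congr 1
    funext x
    rw [← Finset.sum_mul, ← mul_assoc, ← partialSum_apply, sq]
  have hrow : ∀ i, ∑ j ∈ I, ∫ x, fbar μ T f i x β * fbar μ T f j x β ∂μ ≤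
      12 * decorConst lam A L * lipNorm f ^ 2 / (1 - rate lam A) := by
    intro i
    have h1 := sum_pow_dist_le (rate_pos (A := A) hs.one_lt) (rate_lt_one hs.one_lt) I i 0
      fun _ _ => Nat.zero_le _
    calc _ ≤ ∑ j ∈ I, 6 * decorConst lam A L * lipNorm f ^ 2 * rate lam A ^ ((i - j) + (j - i)) :=
          Finset.sum_le_sum fun j _ => (le_abs_self _).trans
            (abs_covariance_le hs hϱ hL hf i j β β)
      _ ≤ 6 * decorConst lam A L * lipNorm f ^ 2 * (2 * rate lam A ^ 0 / (1 - rate lam A)) := by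
          rw [← Finset.mul_sum]
          exact mul_le_mul_of_nonneg_left h1 (by positivity)
      _ = _ := by rw [pow_zero]; ring
  rw [e]
  calc _ ≤ s * ∑ _i ∈ I, (s * (12 * decorConst lam A L * lipNorm f ^ 2 / (1 - rate lam A))) := by
        apply mul_le_mul_of_nonneg_left _ hs0
        exact Finset.sum_le_sum fun i _ => mul_le_mul_of_nonneg_left (hrow i) hs0
    _ = _ := by
        rw [Finset.sum_const, nsmul_eq_mul]; ring

/-- The past part of a window decomposition, in the form needed for decorrelation. -/
lemma partialSum_past (hs : IsLiftedSystem lam A T F k) (hf : LipschitzWith κ f) {s : ℝ}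
    (hs0 : 0 ≤ s) (hs1 : s ≤ 1) {p K : ℕ} {I : Finset ℕ} (hI : ∀ i ∈ I, i + K ≤ p) :
    (∀ x, partialSum (densityMeasure ϱ) T f s I x = 0) ∨ ∃ m, m + K = p ∧
      ∀ γ, DynLip F m (2 * lipNorm f / (1 - rate lam A))
        fun x => partialSum (densityMeasure ϱ) T f s I x γ := by
  rcases I.eq_empty_or_nonempty with rfl | ⟨i, hi⟩
  · left
    intro x
    simp [partialSum]
  · right
    have := hI i hi
    exact ⟨p - K, by omega, fun γ => dynLip_partialSum hs hf hs0 hs1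
      (fun j hj => by have := hI j hj; omega) γ⟩

end partialSum

/-! ### Test fields and moment inequalities -/

/-- Vector fields with bounded first derivatives, the latter being Lipschitz. -/
structure IsTestField {d : ℕ} (D₁ D₂ D₃ : ℝ) (u : Fin d → (Fin d → ℝ) → ℝ) : Prop where
  differentiable : ∀ α, Differentiable ℝ (u α)
  continuous_partial : ∀ α β, Continuous fun w => fderiv ℝ (u α) w (Pi.single β 1)
  abs_le : ∀ α w, |u α w| ≤ D₁
  abs_partial_le : ∀ α w β, |fderiv ℝ (u α) w (Pi.single β 1)| ≤ D₂
  abs_partial_sub_le : ∀ α w w' β,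
    |fderiv ℝ (u α) w (Pi.single β 1) - fderiv ℝ (u α) w' (Pi.single β 1)| ≤
      D₃ * ∑ γ, |w γ - w' γ|

section

variable {ϱ : UnitAddCircle → ℝ}

lemma integral_abs_mul_abs_le (hϱ : IsLogLipDensity ϱ) {g g' : UnitAddCircle → ℝ}
    (hg : Continuous g) (hg' : Continuous g') {v : ℝ} (h : ∫ x, g x ^ 2 ∂densityMeasure ϱ ≤ v)
    (h' : ∫ x, g' x ^ 2 ∂densityMeasure ϱ ≤ v) :
    ∫ x, |g x| * |g' x| ∂densityMeasure ϱ ≤ v := by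
  have hi : ∀ {g : UnitAddCircle → ℝ}, Continuous g → Integrable g (densityMeasure ϱ) :=
    fun hg => integrable_densityMeasure hϱ hg
  have h1 : ∫ x, |g x| * |g' x| ∂densityMeasure ϱ ≤
      ∫ x, (1 / 2 * g x ^ 2 + 1 / 2 * g' x ^ 2) ∂densityMeasure ϱ := by
    refine integral_mono (hi (by fun_prop)) (hi (by fun_prop)) fun x => ?_
    have := two_mul_le_add_sq |g x| |g' x|
    simp only [sq_abs] at this
    show |g x| * |g' x| ≤ 1 / 2 * g x ^ 2 + 1 / 2 * g' x ^ 2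
    linarith
  rw [integral_add (hi (by fun_prop)) (hi (by fun_prop)), integral_const_mul,
    integral_const_mul] at h1
  linarith

lemma sq_integral_abs_le (hϱ : IsLogLipDensity ϱ) {g : UnitAddCircle → ℝ} (hg : Continuous g) :
    (∫ x, |g x| ∂densityMeasure ϱ) ^ 2 ≤ ∫ x, g x ^ 2 ∂densityMeasure ϱ := by
  have := isProbabilityMeasure_densityMeasure hϱ
  have hi : ∀ {g : UnitAddCircle → ℝ}, Continuous g → Integrable g (densityMeasure ϱ) :=
    fun hg => integrable_densityMeasure hϱ hg
  set a := ∫ x, |g x| ∂densityMeasure ϱ with ha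
  have h1 : 0 ≤ ∫ x, (|g x| - a) ^ 2 ∂densityMeasure ϱ := integral_nonneg fun x => sq_nonneg _
  have h2 : ∀ x, (|g x| - a) ^ 2 = g x ^ 2 - 2 * a * |g x| + a ^ 2 := fun x => by
    rw [sub_sq, sq_abs]; ring
  simp_rw [h2] at h1
  rw [integral_add (hi (by fun_prop)) (integrable_const _), integral_sub (hi (by fun_prop))
    (hi (by fun_prop)), integral_const_mul, ← ha] at h1
  simp only [integral_const, probReal_univ, one_smul] at h1
  nlinarith

lemma integral_abs_mul_integral_abs_le (hϱ : IsLogLipDensity ϱ) {g g' : UnitAddCircle → ℝ}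
    (hg : Continuous g) (hg' : Continuous g') {v : ℝ} (h : ∫ x, g x ^ 2 ∂densityMeasure ϱ ≤ v)
    (h' : ∫ x, g' x ^ 2 ∂densityMeasure ϱ ≤ v) :
    (∫ x, |g x| ∂densityMeasure ϱ) * ∫ x, |g' x| ∂densityMeasure ϱ ≤ v := by
  have h1 := sq_integral_abs_le hϱ hg
  have h2 := sq_integral_abs_le hϱ hg'
  nlinarith [two_mul_le_add_sq (∫ x, |g x| ∂densityMeasure ϱ) (∫ x, |g' x| ∂densityMeasure ϱ)]

lemma abs_integral_le_integral (hϱ : IsLogLipDensity ϱ) {g g' : UnitAddCircle → ℝ}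
    (hg : Continuous g) (hg' : Continuous g') (h : ∀ x, |g x| ≤ g' x) :
    |∫ x, g x ∂densityMeasure ϱ| ≤ ∫ x, g' x ∂densityMeasure ϱ :=
  abs_integral_le_integral_abs.trans (integral_mono (integrable_densityMeasure hϱ hg.abs)
    (integrable_densityMeasure hϱ hg') h)

end

/-! ### Decoupling a single term from the rest of the sum -/

section

variable {d : ℕ} {lam A : ℝ} {T : ℕ → UnitAddCircle → UnitAddCircle} {F : ℕ → ℝ → ℝ} {k : ℕ → ℕ}
  {ϱ : UnitAddCircle → ℝ} {L : ℝ} {f : UnitAddCircle → Fin d → ℝ} {κ : NNReal}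
  {D₁ D₂ D₃ : ℝ} {u : Fin d → (Fin d → ℝ) → ℝ}

/-- Replacing `u α (W)` by its linearization at `W` in the contribution of the indices near `n`. -/
lemma abs_integral_linearization_le (hs : IsLiftedSystem lam A T F k) (hϱ : IsLogLipDensity ϱ)
    (hL : L = lipConst fun x => Real.log (ϱ x)) (hf : LipschitzWith κ f) (hD₂ : 0 ≤ D₂)
    (hD₃ : 0 ≤ D₃) (hu : IsTestField D₁ D₂ D₃ u) {s : ℝ} (hs0 : 0 ≤ s) (hs1 : s ≤ 1)
    (N n : ℕ) {K : ℕ} (hK : 1 ≤ K) (α : Fin d) {v : ℝ}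
    (hv : ∀ β, ∫ x, partialSum (densityMeasure ϱ) T f s (nearIdx N n K) x β ^ 2
      ∂densityMeasure ϱ ≤ v) :
    |(∫ x, fbar (densityMeasure ϱ) T f n x α *
        u α (partialSum (densityMeasure ϱ) T f s (Finset.range N) x) ∂densityMeasure ϱ) -
      ∑ β, ∫ x, fbar (densityMeasure ϱ) T f n x α *
        partialSum (densityMeasure ϱ) T f s (nearIdx N n K) x β *
        fderiv ℝ (u α) (partialSum (densityMeasure ϱ) T f s (Finset.range N) x) (Pi.single β 1)
          ∂densityMeasure ϱ| ≤
      2 * decorConst lam A L * (3 * lipNorm f * D₁ +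
        4 * lipNorm f ^ 2 * d * D₂ / (1 - rate lam A)) * rate lam A ^ K +
      2 * supNorm f * D₃ * d ^ 2 * v := by
  have hC := (decorConst_pos hs.one_lt hs.nonneg (hL ▸ lipConst_nonneg _)).le
  have hθ1 : 0 < 1 - rate lam A := sub_pos.2 (rate_lt_one hs.one_lt)
  have hfc := hf.continuous
  have hS := supNorm_nonneg f
  have hSM := supNorm_le_lipNorm f
  have hM := lipNorm_nonneg f
  have hD₁ : 0 ≤ D₁ := (abs_nonneg _).trans (hu.abs_le α 0)
  set μ := densityMeasure ϱ with hμ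
  set P := partialSum μ T f s (pastIdx N n K) with hP
  set Q := partialSum μ T f s (futureIdx N n K) with hQ
  set Y := partialSum μ T f s (nearIdx N n K) with hY
  set W := partialSum μ T f s (Finset.range N) with hW
  set X := fun x => fbar μ T f n x α with hX
  have hXb : ∀ x, |X x| ≤ 2 * supNorm f := abs_fbar_le hϱ hfc n α
  have hXc : Continuous X := continuous_fbar_apply hs hfc n α
  have hPc : Continuous P := continuous_partialSum hs hfc s _
  have hQc : Continuous Q := continuous_partialSum hs hfc s _
  have hYc : Continuous Y := continuous_partialSum hs hfc s _
  have hWc : Continuous W := continuous_partialSum hs hfc s _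
  have hYc' : ∀ β, Continuous fun x => Y x β := fun β => (continuous_apply β).comp hYc
  have huc := (hu.differentiable α).continuous
  have hWe : ∀ x, W x = P x + Q x + Y x := partialSum_range μ T f s N n hK
  have hu' : ∀ β, Continuous fun x => fderiv ℝ (u α) (W x) (Pi.single β 1) := fun β =>
    (hu.continuous_partial α β).comp hWc
  have h1 := abs_integral_mul_comp_le hs hϱ hL (K := K) (le_refl n) hXb hM
    (dynLip_fbar_self hs hf n α) (isFuture_fbar_apply hs hfc le_rfl α)
    (integral_fbar hs hϱ hfc n α) hPc (by positivity)
    (partialSum_past hs hf hs0 hs1 fun i hi => (Finset.mem_filter.1 hi).2)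
    (isFuture_partialSum (ϱ := ϱ) hs hfc s (I := futureIdx N n K) fun i hi => (Finset.mem_filter.1 hi).2)
    huc (hu.abs_le α) hD₂ (abs_sub_le_of_partial_le (hu.differentiable α) (hu.abs_partial_le α))
  have hint : ∀ {g : UnitAddCircle → ℝ}, Continuous g → Integrable g μ :=
    fun hg => integrable_densityMeasure hϱ hg
  -- `P + Q` keeps distance `K` from time `n`, so the first integral on the right is small by `h1`.
  -- The second contains the Taylor remainder for the increment `Y`.
  have e1 : (∫ x, X x * u α (W x) ∂μ) -
      ∑ β, ∫ x, X x * Y x β * fderiv ℝ (u α) (W x) (Pi.single β 1) ∂μ =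
      (∫ x, X x * u α (P x + Q x) ∂μ) + ∫ x, X x * (u α (W x) - u α (P x + Q x) -
        ∑ β, fderiv ℝ (u α) (W x) (Pi.single β 1) * Y x β) ∂μ := by
    have hi : ∀ β ∈ (Finset.univ : Finset (Fin d)),
        Integrable (fun x => X x * Y x β * fderiv ℝ (u α) (W x) (Pi.single β 1)) μ := fun β _ =>
      hint ((hXc.mul (hYc' β)).mul (hu' β))
    have hsum : Continuous fun x => ∑ β, X x * Y x β * fderiv ℝ (u α) (W x) (Pi.single β 1) :=
      continuous_finsetSum _ fun β _ => (hXc.mul (hYc' β)).mul (hu' β)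
    have hsum' : Continuous fun x => ∑ β, fderiv ℝ (u α) (W x) (Pi.single β 1) * Y x β :=
      continuous_finsetSum _ fun β _ => (hu' β).mul (hYc' β)
    rw [← integral_finsetSum _ hi, ← integral_sub (hint (by fun_prop)) (hint hsum),
      ← integral_add (hint (by fun_prop)) (hint (by fun_prop))]
    congr 1
    funext x
    have : ∑ β, X x * Y x β * fderiv ℝ (u α) (W x) (Pi.single β 1) =
        X x * ∑ β, fderiv ℝ (u α) (W x) (Pi.single β 1) * Y x β := by
      rw [Finset.mul_sum]
      exact Finset.sum_congr rfl fun β _ => by ring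
    rw [this]; ring
  have h2 : |∫ x, X x * (u α (W x) - u α (P x + Q x) -
      ∑ β, fderiv ℝ (u α) (W x) (Pi.single β 1) * Y x β) ∂μ| ≤
      2 * supNorm f * D₃ * d ^ 2 * v := by
    have hsum' : Continuous fun x => ∑ β, fderiv ℝ (u α) (W x) (Pi.single β 1) * Y x β :=
      continuous_finsetSum _ fun β _ => (hu' β).mul (hYc' β)
    refine (abs_integral_le_integral hϱ (g' := fun x => 2 * supNorm f *
      (D₃ * ∑ β, ∑ γ, |Y x β| * |Y x γ|)) (by fun_prop) (by fun_prop) fun x => ?_).trans ?_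
    · rw [abs_mul]
      have ht := abs_taylor_le (hu.differentiable α) hD₃ (hu.abs_partial_sub_le α) (P x + Q x) (Y x)
      rw [← hWe] at ht
      exact mul_le_mul (hXb x) ht (abs_nonneg _) (by positivity)
    · rw [integral_const_mul, integral_const_mul, integral_finsetSum _ fun β _ =>
        hint (by fun_prop)]
      have : ∀ β, ∫ x, ∑ γ, |Y x β| * |Y x γ| ∂μ ≤ d * v := by
        intro β
        rw [integral_finsetSum _ fun γ _ => hint (by fun_prop)]
        refine (Finset.sum_le_sum fun γ _ => integral_abs_mul_abs_le hϱ (hYc' β) (hYc' γ) (hv β)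
          (hv γ)).trans (le_of_eq (by simp))
      calc _ ≤ 2 * supNorm f * (D₃ * ∑ _β : Fin d, d * v) := by
            gcongr with β _
            exact this β
        _ = _ := by
            rw [Finset.sum_const, Finset.card_univ, Fintype.card_fin, nsmul_eq_mul]; ring
  rw [e1]
  refine (abs_add_le _ _).trans (add_le_add (h1.trans ?_) h2)
  have hθK : 0 ≤ rate lam A ^ K := pow_nonneg (rate_pos hs.one_lt).le K
  apply mul_le_mul_of_nonneg_right _ hθK
  apply mul_le_mul_of_nonneg_left _ (by positivity)
  have a1 : 2 * supNorm f * D₁ ≤ 2 * lipNorm f * D₁ := by gcongr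
  have a2 : 2 * supNorm f * D₂ * (d * (2 * lipNorm f / (1 - rate lam A))) ≤
      2 * lipNorm f * D₂ * (d * (2 * lipNorm f / (1 - rate lam A))) := by gcongr
  have a3 : 2 * lipNorm f * D₂ * (d * (2 * lipNorm f / (1 - rate lam A))) =
    4 * lipNorm f ^ 2 * d * D₂ / (1 - rate lam A) := by ring
  linarith

/-- Decorrelation of the second order term from the derivative of the test field. -/
lemma abs_integral_second_order_le (hs : IsLiftedSystem lam A T F k) (hϱ : IsLogLipDensity ϱ)
    (hL : L = lipConst fun x => Real.log (ϱ x)) (hf : LipschitzWith κ f) (hD₂ : 0 ≤ D₂)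
    (hD₃ : 0 ≤ D₃) (hu : IsTestField D₁ D₂ D₃ u) {s : ℝ} (hs0 : 0 ≤ s) (hs1 : s ≤ 1)
    (N n : ℕ) {K : ℕ} (hK : 1 ≤ K) (α β : Fin d) {v : ℝ}
    (hv : ∀ γ, ∫ x, partialSum (densityMeasure ϱ) T f s (nearIdx N n K) x γ ^ 2
      ∂densityMeasure ϱ ≤ v)
    (hv' : ∀ γ, ∫ x, partialSum (densityMeasure ϱ) T f s (nearIdx N n (2 * K)) x γ ^ 2
      ∂densityMeasure ϱ ≤ v) :
    |(∫ x, fbar (densityMeasure ϱ) T f n x α *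
        partialSum (densityMeasure ϱ) T f s (nearIdx N n K) x β *
        fderiv ℝ (u α) (partialSum (densityMeasure ϱ) T f s (Finset.range N) x) (Pi.single β 1)
          ∂densityMeasure ϱ) -
      (∫ x, fbar (densityMeasure ϱ) T f n x α *
        partialSum (densityMeasure ϱ) T f s (nearIdx N n K) x β ∂densityMeasure ϱ) *
      ∫ x, fderiv ℝ (u α) (partialSum (densityMeasure ϱ) T f s (Finset.range N) x) (Pi.single β 1)
          ∂densityMeasure ϱ| ≤
      2 * decorConst lam A L * (K * lipNorm f ^ 2 * (24 * D₂ + 32 * d * supNorm f * D₃) /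
        (1 - rate lam A)) * rate lam A ^ K + 4 * supNorm f * D₃ * d * v := by
  have hprob := isProbabilityMeasure_densityMeasure hϱ
  have hC := (decorConst_pos hs.one_lt hs.nonneg (hL ▸ lipConst_nonneg _)).le
  have hθ0 := rate_pos (A := A) hs.one_lt
  have hθ1 : 0 < 1 - rate lam A := sub_pos.2 (rate_lt_one hs.one_lt)
  have hfc := hf.continuous
  have hS := supNorm_nonneg f
  have hSM := supNorm_le_lipNorm f
  have hM := lipNorm_nonneg f
  set μ := densityMeasure ϱ with hμ
  -- The window is doubled because `X * Y` involves all times from `n - K` to `n + K`, from which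
  -- `P` and `Q` must still have distance `K`.
  set P := partialSum μ T f s (pastIdx N n (2 * K)) with hP
  set Q := partialSum μ T f s (futureIdx N n (2 * K)) with hQ
  set Y := partialSum μ T f s (nearIdx N n K) with hY
  set Y' := partialSum μ T f s (nearIdx N n (2 * K)) with hY'
  set W := partialSum μ T f s (Finset.range N) with hW
  set X := fun x => fbar μ T f n x α with hX
  set u' := fun w => fderiv ℝ (u α) w (Pi.single β 1) with hu'
  have hXb : ∀ x, |X x| ≤ 2 * supNorm f := abs_fbar_le hϱ hfc n α
  have hXc : Continuous X := continuous_fbar_apply hs hfc n α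
  have hPc : Continuous P := continuous_partialSum hs hfc s _
  have hQc : Continuous Q := continuous_partialSum hs hfc s _
  have hYc : Continuous Y := continuous_partialSum hs hfc s _
  have hYc' : Continuous Y' := continuous_partialSum hs hfc s _
  have hWc : Continuous W := continuous_partialSum hs hfc s _
  have hYcβ : ∀ γ, Continuous fun x => Y x γ := fun γ => (continuous_apply γ).comp hYc
  have hYcγ : ∀ γ, Continuous fun x => Y' x γ := fun γ => (continuous_apply γ).comp hYc'
  have huc : Continuous u' := hu.continuous_partial α β
  have hWe : ∀ x, W x = P x + Q x + Y' x := partialSum_range μ T f s N n (by omega)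
  have hint : ∀ {g : UnitAddCircle → ℝ}, Continuous g → Integrable g μ :=
    fun hg => integrable_densityMeasure hϱ hg
  have hYb : ∀ x, |Y x β| ≤ 4 * K * supNorm f := fun x => by
    refine (abs_partialSum_apply_le hϱ hfc hs0 hs1 _ x β).trans ?_
    have := mul_le_mul_of_nonneg_right (card_nearIdx_le N n K) (show 0 ≤ 2 * supNorm f by linarith)
    linarith
  set m := ∫ x, X x * Y x β ∂μ with hm
  set Z := fun x => X x * Y x β - m with hZ
  have hK1 : (1 : ℝ) ≤ K := by exact_mod_cast hK
  have hXYb : ∀ x, |X x * Y x β| ≤ 2 * supNorm f * (4 * K * supNorm f) := fun x => by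
    rw [abs_mul]
    exact mul_le_mul (hXb x) (hYb x) (abs_nonneg _) (by positivity)
  have hmb : |m| ≤ 2 * supNorm f * (4 * K * supNorm f) := abs_integral_le_of_abs_le hϱ hXYb
  have hZb : ∀ x, |Z x| ≤ 16 * K * supNorm f ^ 2 := fun x => by
    refine (abs_sub _ _).trans ?_
    linarith [hXYb x]
  have hZc : Continuous Z := by fun_prop
  have hnear : ∀ i ∈ nearIdx N n K, n - K ≤ i ∧ i ≤ n + K := fun i hi => by
    simp only [nearIdx, Finset.mem_filter] at hi
    omega
  have hZD : DynLip F (n + K) (8 * K * supNorm f * lipNorm f / (1 - rate lam A)) Z := by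
    refine (((dynLip_fbar (ϱ := ϱ) hs hf (Nat.le_add_right n K) α).mul (dynLip_partialSum hs hf hs0
      hs1 (fun i hi => (hnear i hi).2) β) hXb hYb).sub_const m).mono ?_
    have a1 : lipNorm f * (4 * K * supNorm f) ≤
        4 * K * supNorm f * lipNorm f / (1 - rate lam A) := by
      rw [le_div_iff₀ hθ1]
      have : 0 ≤ lipNorm f * (4 * K * supNorm f) := by positivity
      nlinarith
    have a2 : 2 * supNorm f * (2 * lipNorm f / (1 - rate lam A)) ≤
        4 * K * supNorm f * lipNorm f / (1 - rate lam A) := by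
      have e : 2 * supNorm f * (2 * lipNorm f / (1 - rate lam A)) =
        4 * 1 * supNorm f * lipNorm f / (1 - rate lam A) := by ring
      rw [e]
      gcongr
    have a3 : 8 * K * supNorm f * lipNorm f / (1 - rate lam A) =
      4 * K * supNorm f * lipNorm f / (1 - rate lam A) +
      4 * K * supNorm f * lipNorm f / (1 - rate lam A) := by ring
    linarith
  have hZF : IsFuture T (n - K) Z :=
    ((isFuture_fbar_apply hs hfc (Nat.sub_le n K) α).mul ((isFuture_partialSum hs hfc s
      fun i hi => (hnear i hi).1).comp (continuous_apply β))).comp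
      (u := fun y : ℝ => y - m) (by fun_prop)
  have hZ0 : ∫ x, Z x ∂μ = 0 := by
    simp only [hZ]
    rw [integral_sub (hint (by fun_prop)) (integrable_const _)]
    simp [hm]
  have h1 := abs_integral_mul_comp_le hs hϱ hL (K := K) (show n - K ≤ n + K by omega) hZb
    (by positivity) hZD hZF hZ0 hPc (RP := 2 * lipNorm f / (1 - rate lam A)) (by positivity)
    (partialSum_past hs hf hs0 hs1 fun i hi => by
      simp only [pastIdx, Finset.mem_filter] at hi
      omega)
    (isFuture_partialSum (ϱ := ϱ) hs hfc s (I := futureIdx N n (2 * K)) fun i hi => by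
      simp only [futureIdx, Finset.mem_filter] at hi
      omega)
    huc (fun w => hu.abs_partial_le α w β) hD₃ (fun w w' => hu.abs_partial_sub_le α w w' β)
  have e1 : (∫ x, X x * Y x β * u' (W x) ∂μ) - m * ∫ x, u' (W x) ∂μ =
      (∫ x, Z x * u' (P x + Q x) ∂μ) + ∫ x, Z x * (u' (W x) - u' (P x + Q x)) ∂μ := by
    rw [← integral_const_mul, ← integral_sub (hint (by fun_prop)) (hint (by fun_prop)),
      ← integral_add (hint (by fun_prop)) (hint (by fun_prop))]
    congr 1
    funext x
    simp only [hZ]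
    ring
  have h2 : |∫ x, Z x * (u' (W x) - u' (P x + Q x)) ∂μ| ≤ 4 * supNorm f * D₃ * d * v := by
    -- Estimating `m` by the mean of `|Y x β|`, and not by a constant, makes both parts of `Z`
    -- contribute products of two small window sums.
    have hmY : |m| ≤ 2 * supNorm f * ∫ x, |Y x β| ∂μ := by
      rw [← integral_const_mul]
      refine abs_integral_le_integral hϱ (by fun_prop) (by fun_prop) fun x => ?_
      rw [abs_mul]
      exact mul_le_mul_of_nonneg_right (hXb x) (abs_nonneg _)
    refine (abs_integral_le_integral hϱ (g' := fun x =>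
      ∑ γ, (2 * supNorm f * D₃ * (|Y x β| * |Y' x γ|) + D₃ * |m| * |Y' x γ|))
      (by fun_prop) (by fun_prop) fun x => ?_).trans ?_
    · rw [abs_mul]
      have a1 := hu.abs_partial_sub_le α (W x) (P x + Q x) β
      have a2 : ∀ γ, W x γ - (P x + Q x) γ = Y' x γ := fun γ => by rw [hWe]; simp
      simp only [a2] at a1
      have a3 : |Z x| ≤ 2 * supNorm f * |Y x β| + |m| := by
        refine (abs_sub _ _).trans ?_
        rw [abs_mul]
        have := mul_le_mul_of_nonneg_right (hXb x) (abs_nonneg (Y x β))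
        linarith
      refine (mul_le_mul a3 a1 (abs_nonneg _) (by positivity)).trans (le_of_eq ?_)
      rw [Finset.mul_sum, Finset.mul_sum]
      exact Finset.sum_congr rfl fun γ _ => by ring
    · rw [integral_finsetSum _ fun γ _ => hint (by fun_prop)]
      have : ∀ γ, ∫ x, (2 * supNorm f * D₃ * (|Y x β| * |Y' x γ|) + D₃ * |m| * |Y' x γ|) ∂μ ≤
          4 * supNorm f * D₃ * v := by
        intro γ
        rw [integral_add (hint (by fun_prop)) (hint (by fun_prop)), integral_const_mul,
          integral_const_mul]
        have a1 := integral_abs_mul_abs_le hϱ (hYcβ β) (hYcγ γ) (hv β) (hv' γ)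
        have a2 := integral_abs_mul_integral_abs_le hϱ (hYcβ β) (hYcγ γ) (hv β) (hv' γ)
        have a3 : 0 ≤ ∫ x, |Y' x γ| ∂μ := integral_nonneg fun x => abs_nonneg _
        have a4 : D₃ * |m| * ∫ x, |Y' x γ| ∂μ ≤ 2 * supNorm f * D₃ * v := by
          calc _ ≤ D₃ * (2 * supNorm f * ∫ x, |Y x β| ∂μ) * ∫ x, |Y' x γ| ∂μ := by gcongr
            _ = 2 * supNorm f * D₃ * ((∫ x, |Y x β| ∂μ) * ∫ x, |Y' x γ| ∂μ) := by ring
            _ ≤ _ := mul_le_mul_of_nonneg_left a2 (by positivity)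
        have a5 := mul_le_mul_of_nonneg_left a1 (show 0 ≤ 2 * supNorm f * D₃ by positivity)
        linarith
      refine (Finset.sum_le_sum fun γ _ => this γ).trans (le_of_eq ?_)
      rw [Finset.sum_const, Finset.card_univ, Fintype.card_fin, nsmul_eq_mul]; ring
  rw [e1]
  refine (abs_add_le _ _).trans (add_le_add (h1.trans ?_) h2)
  apply mul_le_mul_of_nonneg_right _ (pow_nonneg hθ0.le K)
  apply mul_le_mul_of_nonneg_left _ (by positivity)
  have a1 : 16 * K * supNorm f ^ 2 * D₂ ≤ 16 * K * lipNorm f ^ 2 * D₂ / (1 - rate lam A) := by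
    rw [le_div_iff₀ hθ1]
    have b1 : 16 * K * supNorm f ^ 2 * D₂ ≤ 16 * K * lipNorm f ^ 2 * D₂ := by gcongr
    have b2 : 0 ≤ 16 * K * supNorm f ^ 2 * D₂ := by positivity
    nlinarith
  have a2 : 8 * K * supNorm f * lipNorm f / (1 - rate lam A) * D₂ ≤
      8 * K * lipNorm f * lipNorm f / (1 - rate lam A) * D₂ := by gcongr
  have a3 : 16 * K * supNorm f ^ 2 * D₃ * (d * (2 * lipNorm f / (1 - rate lam A))) ≤
      16 * K * (supNorm f * lipNorm f) * D₃ * (d * (2 * lipNorm f / (1 - rate lam A))) := by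
    gcongr
    rw [sq]
    exact mul_le_mul_of_nonneg_left hSM hS
  calc _ ≤ 16 * K * lipNorm f ^ 2 * D₂ / (1 - rate lam A) +
        8 * K * lipNorm f * lipNorm f / (1 - rate lam A) * D₂ +
        16 * K * (supNorm f * lipNorm f) * D₃ * (d * (2 * lipNorm f / (1 - rate lam A))) := by
        linarith
    _ = _ := by ring

end

/-! ### Approximate Gaussian integration by parts for `W` -/

section

variable {d : ℕ} {lam A : ℝ} {T : ℕ → UnitAddCircle → UnitAddCircle} {F : ℕ → ℝ → ℝ} {k : ℕ → ℕ}
  {ϱ : UnitAddCircle → ℝ} {L : ℝ} {f : UnitAddCircle → Fin d → ℝ} {κ : NNReal}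
  {D₁ D₂ D₃ : ℝ} {u : Fin d → (Fin d → ℝ) → ℝ}

/-- What is missing from the covariance matrix are the pairs at distance at least `K`, whose sum is
a geometric tail in every row. -/
lemma abs_sum_near_covariance_sub_le (hs : IsLiftedSystem lam A T F k) (hϱ : IsLogLipDensity ϱ)
    (hL : L = lipConst fun x => Real.log (ϱ x)) (hf : LipschitzWith κ f) {N : ℕ} {s : ℝ}
    (hsN : s ^ 2 = 1 / N) (hN : 1 ≤ N) {K : ℕ} (hK : 1 ≤ K) (α β : Fin d) :
    |s * (∑ n ∈ Finset.range N, ∫ x, fbar (densityMeasure ϱ) T f n x α *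
        partialSum (densityMeasure ϱ) T f s (nearIdx N n K) x β ∂densityMeasure ϱ) -
      covMatrix (densityMeasure ϱ) T f N α β| ≤
      24 * decorConst lam A L * lipNorm f ^ 2 * rate lam A ^ K / (1 - rate lam A) := by
  have hC := (decorConst_pos hs.one_lt hs.nonneg (hL ▸ lipConst_nonneg _)).le
  have hN0 : (0 : ℝ) < N := by exact_mod_cast hN
  set μ := densityMeasure ϱ with hμ
  set c : ℕ → ℕ → ℝ := fun n j => ∫ x, fbar μ T f n x α * fbar μ T f j x β ∂μ with hc
  have htail : ∀ n (I : Finset ℕ), (∀ j ∈ I, K ≤ (n - j) + (j - n)) → |∑ j ∈ I, c n j| ≤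
      12 * decorConst lam A L * lipNorm f ^ 2 * rate lam A ^ K / (1 - rate lam A) := by
    intro n I hI
    calc |∑ j ∈ I, c n j| ≤ ∑ j ∈ I,
          6 * decorConst lam A L * lipNorm f ^ 2 * rate lam A ^ ((n - j) + (j - n)) :=
          (Finset.abs_sum_le_sum_abs _ _).trans
            (Finset.sum_le_sum fun j _ => abs_covariance_le hs hϱ hL hf n j α β)
      _ ≤ 6 * decorConst lam A L * lipNorm f ^ 2 * (2 * rate lam A ^ K / (1 - rate lam A)) := by
          rw [← Finset.mul_sum]
          exact mul_le_mul_of_nonneg_left (sum_pow_dist_le (rate_pos hs.one_lt)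
            (rate_lt_one hs.one_lt) I n K hI) (by positivity)
      _ = _ := by ring
  have e : s * (∑ n ∈ Finset.range N, ∫ x, fbar μ T f n x α *
        partialSum μ T f s (nearIdx N n K) x β ∂μ) - covMatrix μ T f N α β =
      -(1 / N * ∑ n ∈ Finset.range N,
        (∑ j ∈ pastIdx N n K, c n j + ∑ j ∈ futureIdx N n K, c n j)) := by
    have e1 : covMatrix μ T f N α β =
        1 / N * ∑ n ∈ Finset.range N, ∑ j ∈ Finset.range N, c n j := rfl
    rw [e1]
    simp_rw [hμ, integral_fbar_mul_partialSum hs hϱ hf.continuous, ← hμ]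
    rw [← Finset.mul_sum, ← mul_assoc, ← sq, hsN, ← mul_sub, ← Finset.sum_sub_distrib, ← mul_neg,
      ← Finset.sum_neg_distrib]
    congr 1
    refine Finset.sum_congr rfl fun n _ => ?_
    rw [sum_range_eq_windows N n hK (c n)]
    ring
  rw [e, abs_neg, abs_mul, abs_of_nonneg (by positivity)]
  have h1 : |∑ n ∈ Finset.range N,
      (∑ j ∈ pastIdx N n K, c n j + ∑ j ∈ futureIdx N n K, c n j)| ≤
      N * (24 * decorConst lam A L * lipNorm f ^ 2 * rate lam A ^ K / (1 - rate lam A)) := by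
    refine (Finset.abs_sum_le_sum_abs _ _).trans ?_
    calc _ ≤ ∑ _n ∈ Finset.range N,
          24 * decorConst lam A L * lipNorm f ^ 2 * rate lam A ^ K / (1 - rate lam A) := by
          refine Finset.sum_le_sum fun n _ => (abs_add_le _ _).trans ?_
          have h2 := htail n (pastIdx N n K) fun j hj => by
            simp only [pastIdx, Finset.mem_filter] at hj
            omega
          have h3 := htail n (futureIdx N n K) fun j hj => by
            simp only [futureIdx, Finset.mem_filter] at hj
            omega
          refine (add_le_add h2 h3).trans (le_of_eq (by ring))
      _ = _ := by simp
  calc _ ≤ 1 / (N : ℝ) * (N *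
        (24 * decorConst lam A L * lipNorm f ^ 2 * rate lam A ^ K / (1 - rate lam A))) :=
        mul_le_mul_of_nonneg_left h1 (by positivity)
    _ = _ := by field_simp

/-- Bound for the failure of the Gaussian integration by parts formula for `W`. -/
theorem abs_stein_discrepancy_le (hs : IsLiftedSystem lam A T F k) (hϱ : IsLogLipDensity ϱ)
    (hL : L = lipConst fun x => Real.log (ϱ x)) (hf : LipschitzWith κ f) (hD₂ : 0 ≤ D₂)
    (hD₃ : 0 ≤ D₃) (hu : IsTestField D₁ D₂ D₃ u) {N : ℕ} (hN : 1 ≤ N) {K : ℕ} (hK : 1 ≤ K)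
    (hθK : rate lam A ^ K ≤ 1 / N) :
    |(∫ x, ∑ α, W (densityMeasure ϱ) T f N x α * u α (W (densityMeasure ϱ) T f N x)
        ∂densityMeasure ϱ) -
      ∑ α, ∑ β, covMatrix (densityMeasure ϱ) T f N α β *
        ∫ x, fderiv ℝ (u α) (W (densityMeasure ϱ) T f N x) (Pi.single β 1) ∂densityMeasure ϱ| ≤
      1 / Real.sqrt N * (6 * decorConst lam A L * lipNorm f * d * D₁ +
        352 * decorConst lam A L * lipNorm f ^ 2 * K / (1 - rate lam A) * d ^ 3 *
          (supNorm f * D₃ + D₂)) := by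
  rcases Nat.eq_zero_or_pos d with rfl | hd
  · simp
  have hprob := isProbabilityMeasure_densityMeasure hϱ
  have hC := (decorConst_pos hs.one_lt hs.nonneg (hL ▸ lipConst_nonneg _)).le
  have hθ0 := rate_pos (A := A) hs.one_lt
  have hθ1 : 0 < 1 - rate lam A := sub_pos.2 (rate_lt_one hs.one_lt)
  have hfc := hf.continuous
  have hS := supNorm_nonneg f
  have hM := lipNorm_nonneg f
  have hN1 : (1 : ℝ) ≤ N := by exact_mod_cast hN
  have hK1 : (1 : ℝ) ≤ K := by exact_mod_cast hK
  have hd1 : (1 : ℝ) ≤ d := by exact_mod_cast hd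
  have hD₁ : 0 ≤ D₁ := (abs_nonneg _).trans (hu.abs_le ⟨0, hd⟩ 0)
  have hsqrt : 1 ≤ Real.sqrt N := Real.one_le_sqrt.2 hN1
  set s : ℝ := 1 / Real.sqrt N with hsdef
  have hs0 : 0 ≤ s := by positivity
  have hs1 : s ≤ 1 := by rw [hsdef, div_le_one (by linarith)]; exact hsqrt
  have hsN : s ^ 2 = 1 / N := by
    rw [hsdef, div_pow, one_pow, Real.sq_sqrt (by linarith)]
  have hs2N : s ^ 2 * N = 1 := by rw [hsN]; field_simp
  have hθs : rate lam A ^ K ≤ s := by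
    refine hθK.trans ?_
    rw [← hsN, sq]
    exact mul_le_of_le_one_left hs0 hs1
  -- A decorrelation error arises at each of the `N` times with weight `s`. The choice of `K`
  -- reduces their total to order `s`.
  have hsNθ : s * N * rate lam A ^ K ≤ s := by
    have h1 := mul_le_mul_of_nonneg_left hθK (show 0 ≤ s * N by positivity)
    have h2 : s * N * (1 / N) = s := by field_simp
    linarith
  set μ := densityMeasure ϱ with hμ
  have hWe : ∀ x, W μ T f N x = partialSum μ T f s (Finset.range N) x := fun x => rfl
  simp only [hWe]
  set V := partialSum μ T f s (Finset.range N) with hV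
  have hVc : Continuous V := continuous_partialSum hs hfc s _
  have hint : ∀ {g : UnitAddCircle → ℝ}, Continuous g → Integrable g μ :=
    fun hg => integrable_densityMeasure hϱ hg
  set e : ℕ → Fin d → ℝ := fun n α => ∫ x, fbar μ T f n x α * u α (V x) ∂μ with he
  set m : ℕ → Fin d → Fin d → ℝ := fun n α β =>
    ∫ x, fbar μ T f n x α * partialSum μ T f s (nearIdx N n K) x β ∂μ with hm
  set g : Fin d → Fin d → ℝ := fun α β => ∫ x, fderiv ℝ (u α) (V x) (Pi.single β 1) ∂μ with hg
  have huc := fun α => (hu.differentiable α).continuous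
  have e1 : ∫ x, ∑ α, V x α * u α (V x) ∂μ = ∑ α, s * ∑ n ∈ Finset.range N, e n α := by
    have hVc' : ∀ α, Continuous fun x => V x α := fun α => (continuous_apply α).comp hVc
    have huV : ∀ α, Continuous fun x => u α (V x) := fun α => (huc α).comp hVc
    have hi0 : ∀ α ∈ (Finset.univ : Finset (Fin d)),
        Integrable (fun x => V x α * u α (V x)) μ := fun α _ => hint ((hVc' α).mul (huV α))
    rw [integral_finsetSum _ hi0]
    refine Finset.sum_congr rfl fun α _ => ?_
    have hi : ∀ n ∈ Finset.range N, Integrable (fun x => fbar μ T f n x α * u α (V x)) μ :=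
      fun n _ => hint ((continuous_fbar_apply hs hfc n α).mul (huV α))
    simp only [he]
    rw [← integral_finsetSum _ hi, ← integral_const_mul]
    congr 1
    funext x
    rw [hV, partialSum_apply, ← Finset.sum_mul]
    ring
  -- A common second moment bound for the windows of parameter `K` and `2 K`, which have at most `4
  -- K` indices.
  set v : ℝ := s ^ 2 * (4 * K) * (12 * decorConst lam A L * lipNorm f ^ 2 / (1 - rate lam A))
    with hvdef
  have hvK : ∀ n K', ((nearIdx N n K').card : ℝ) ≤ 4 * K → ∀ β,
      ∫ x, partialSum μ T f s (nearIdx N n K') x β ^ 2 ∂μ ≤ v := by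
    intro n K' h β
    refine (integral_partialSum_sq_le hs hϱ hL hf hs0 _ β).trans ?_
    rw [hvdef]
    gcongr
  have hv1 : ∀ n β, ∫ x, partialSum μ T f s (nearIdx N n K) x β ^ 2 ∂μ ≤ v := fun n =>
    hvK n K ((card_nearIdx_le N n K).trans (by linarith))
  have hv2 : ∀ n β, ∫ x, partialSum μ T f s (nearIdx N n (2 * K)) x β ^ 2 ∂μ ≤ v := fun n =>
    hvK n (2 * K) ((card_nearIdx_le N n (2 * K)).trans (by push_cast; linarith))
  set θK := rate lam A ^ K with hθKdef
  set C := decorConst lam A L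
  set M := lipNorm f
  set S := supNorm f
  set r := 1 - rate lam A with hr
  set B₁ : ℝ := 2 * C * (3 * M * D₁ + 4 * M ^ 2 * d * D₂ / r) * θK + 2 * S * D₃ * d ^ 2 * v
  set B₂ : ℝ := 2 * C * (K * M ^ 2 * (24 * D₂ + 32 * d * S * D₃) / r) * θK + 4 * S * D₃ * d * v
  set B₃ : ℝ := 24 * C * M ^ 2 * θK / r
  have b12 : ∀ n α, |e n α - ∑ β, m n α β * g α β| ≤ B₁ + d * B₂ := by
    intro n α
    have h1 := abs_integral_linearization_le hs hϱ hL hf hD₂ hD₃ hu hs0 hs1 N n hK α (hv1 n)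
    have h2 := fun β => abs_integral_second_order_le hs hϱ hL hf hD₂ hD₃ hu hs0 hs1 N n hK α β
      (hv1 n) (hv2 n)
    set q : Fin d → ℝ := fun β => ∫ x, fbar μ T f n x α *
      partialSum μ T f s (nearIdx N n K) x β * fderiv ℝ (u α) (V x) (Pi.single β 1) ∂μ
    have h3 : |∑ β, q β - ∑ β, m n α β * g α β| ≤ d * B₂ := by
      rw [← Finset.sum_sub_distrib]
      refine (Finset.abs_sum_le_sum_abs _ _).trans
        ((Finset.sum_le_sum fun β _ => h2 β).trans (le_of_eq ?_))
      rw [Finset.sum_const, Finset.card_univ, Fintype.card_fin, nsmul_eq_mul]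
    exact (abs_sub_le _ (∑ β, q β) _).trans (add_le_add h1 h3)
  have b3 : ∀ α β, |s * ∑ n ∈ Finset.range N, m n α β - covMatrix μ T f N α β| ≤ B₃ := fun α β =>
    abs_sum_near_covariance_sub_le hs hϱ hL hf hsN hN hK α β
  have hgb : ∀ α β, |g α β| ≤ D₂ := fun α β =>
    abs_integral_le_of_abs_le hϱ fun x => hu.abs_partial_le α (V x) β
  have hB₃ : 0 ≤ B₃ := by positivity
  have e2 : (∑ α, s * ∑ n ∈ Finset.range N, e n α) - ∑ α, ∑ β, covMatrix μ T f N α β * g α β =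
      ∑ α, (s * ∑ n ∈ Finset.range N, (e n α - ∑ β, m n α β * g α β) +
        ∑ β, (s * ∑ n ∈ Finset.range N, m n α β - covMatrix μ T f N α β) * g α β) := by
    rw [← Finset.sum_sub_distrib]
    refine Finset.sum_congr rfl fun α _ => ?_
    have : s * ∑ n ∈ Finset.range N, ∑ β, m n α β * g α β =
        ∑ β, s * (∑ n ∈ Finset.range N, m n α β) * g α β := by
      rw [Finset.sum_comm, Finset.mul_sum]
      refine Finset.sum_congr rfl fun β _ => ?_
      rw [← Finset.sum_mul, mul_assoc]
    simp only [sub_mul, Finset.sum_sub_distrib, mul_sub]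
    rw [this]
    ring
  rw [e1, e2]
  have b4 : ∀ α, |s * ∑ n ∈ Finset.range N, (e n α - ∑ β, m n α β * g α β) +
      ∑ β, (s * ∑ n ∈ Finset.range N, m n α β - covMatrix μ T f N α β) * g α β| ≤
      s * (N * (B₁ + d * B₂)) + d * (B₃ * D₂) := by
    intro α
    refine (abs_add_le _ _).trans (add_le_add ?_ ?_)
    · rw [abs_mul, abs_of_nonneg hs0]
      apply mul_le_mul_of_nonneg_left _ hs0
      refine (Finset.abs_sum_le_sum_abs _ _).trans
        ((Finset.sum_le_sum fun n _ => b12 n α).trans (le_of_eq ?_))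
      rw [Finset.sum_const, Finset.card_range, nsmul_eq_mul]
    · refine (Finset.abs_sum_le_sum_abs _ _).trans
        ((Finset.sum_le_sum (g := fun _ => B₃ * D₂) fun β _ => ?_).trans (le_of_eq ?_))
      · rw [abs_mul]
        exact mul_le_mul (b3 α β) (hgb α β) (abs_nonneg _) hB₃
      · rw [Finset.sum_const, Finset.card_univ, Fintype.card_fin, nsmul_eq_mul]
  have b5 := (Finset.abs_sum_le_sum_abs (fun α => s * ∑ n ∈ Finset.range N,
      (e n α - ∑ β, m n α β * g α β) +
      ∑ β, (s * ∑ n ∈ Finset.range N, m n α β - covMatrix μ T f N α β) * g α β)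
      Finset.univ).trans (Finset.sum_le_sum fun α _ => b4 α)
  rw [Finset.sum_const, Finset.card_univ, Fintype.card_fin, nsmul_eq_mul] at b5
  refine b5.trans ?_
  have hsv : s * N * v = s * (48 * C * M ^ 2 * K / r) := by
    rw [hvdef]
    calc _ = (s ^ 2 * N) * (s * (48 * C * M ^ 2 * K / r)) := by ring
      _ = _ := by rw [hs2N, one_mul]
  have c1 : s * N * B₁ ≤ s * (2 * C * (3 * M * D₁ + 4 * M ^ 2 * d * D₂ / r) +
      2 * S * D₃ * d ^ 2 * (48 * C * M ^ 2 * K / r)) := by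
    have h1 := mul_le_mul_of_nonneg_left hsNθ
      (show 0 ≤ 2 * C * (3 * M * D₁ + 4 * M ^ 2 * d * D₂ / r) by positivity)
    have h2 : s * N * (2 * S * D₃ * d ^ 2 * v) = 2 * S * D₃ * d ^ 2 * (s * N * v) := by ring
    rw [hsv] at h2
    simp only [B₁]
    linarith
  have c2 : s * N * B₂ ≤ s * (2 * C * (K * M ^ 2 * (24 * D₂ + 32 * d * S * D₃) / r) +
      4 * S * D₃ * d * (48 * C * M ^ 2 * K / r)) := by
    have h1 := mul_le_mul_of_nonneg_left hsNθ
      (show 0 ≤ 2 * C * (K * M ^ 2 * (24 * D₂ + 32 * d * S * D₃) / r) by positivity)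
    have h2 : s * N * (4 * S * D₃ * d * v) = 4 * S * D₃ * d * (s * N * v) := by ring
    rw [hsv] at h2
    simp only [B₂]
    linarith
  have c3 : B₃ ≤ s * (24 * C * M ^ 2 / r) := by
    have h1 := mul_le_mul_of_nonneg_left hθs (show 0 ≤ 24 * C * M ^ 2 / r by positivity)
    calc B₃ = 24 * C * M ^ 2 / r * θK := by simp only [B₃]; ring
      _ ≤ _ := h1
      _ = _ := by ring
  set E := C * M ^ 2 / r with hE
  have hE0 : 0 ≤ E := by positivity
  have hd2 : (d : ℝ) ^ 2 ≤ d ^ 3 := pow_le_pow_right₀ hd1 (by norm_num)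
  -- The coefficient of `S * D₃` is `352 = 96 + 64 + 192`: the Taylor remainder, then the
  -- decorrelation and the window terms of the second order step. The coefficient `32 + 48 K` of
  -- `D₂` is afterwards absorbed in `352 K`.
  have key : (d : ℝ) * (s * (N * (B₁ + d * B₂)) + d * (B₃ * D₂)) ≤
      s * (6 * C * M * d * D₁ + E * (d ^ 2 * D₂ * (32 + 48 * K) + 352 * K * d ^ 3 * (S * D₃))) := by
    have h1 := mul_le_mul_of_nonneg_left c1 (show (0 : ℝ) ≤ d by positivity)
    have h2 := mul_le_mul_of_nonneg_left c2 (show (0 : ℝ) ≤ d ^ 2 by positivity)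
    have h3 := mul_le_mul_of_nonneg_right c3 (show (0 : ℝ) ≤ d ^ 2 * D₂ by positivity)
    calc _ = d * (s * N * B₁) + d ^ 2 * (s * N * B₂) + B₃ * (d ^ 2 * D₂) := by ring
      _ ≤ _ := add_le_add (add_le_add h1 h2) h3
      _ = _ := by rw [hE]; ring
  refine key.trans (mul_le_mul_of_nonneg_left ?_ hs0)
  have h1 : (d : ℝ) ^ 2 * D₂ * (32 + 48 * K) ≤ d ^ 3 * D₂ * (352 * K) := by
    apply mul_le_mul (mul_le_mul_of_nonneg_right hd2 hD₂) (by linarith) (by positivity)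
      (by positivity)
  have h2 := mul_le_mul_of_nonneg_left h1 hE0
  have h3 : 352 * C * M ^ 2 * K / r * d ^ 3 * (S * D₃ + D₂) =
      E * (d ^ 3 * D₂ * (352 * K)) + E * (352 * K * d ^ 3 * (S * D₃)) := by rw [hE]; ring
  rw [h3]
  linarith

end

/-! ### Interpolation between `W` and a normal vector -/

section smartPath

variable {d : ℕ}

lemma hasDerivAt_rotation {h : (Fin d → ℝ) → ℝ} (hh : Differentiable ℝ h) (v w : Fin d → ℝ)
    (t : ℝ) : HasDerivAt (fun t => h (Real.sin t • v + Real.cos t • w))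
      (∑ α, fderiv ℝ h (Real.sin t • v + Real.cos t • w) (Pi.single α 1) *
        (Real.cos t * v α - Real.sin t * w α)) t := by
  have hp1 : HasDerivAt (fun t => Real.sin t • v + Real.cos t • w)
      (Real.cos t • v + (-Real.sin t) • w) t :=
    ((Real.hasDerivAt_sin t).smul_const v).add ((Real.hasDerivAt_cos t).smul_const w)
  have hp2 := (hh (Real.sin t • v + Real.cos t • w)).hasFDerivAt.comp_hasDerivAt t hp1
  rw [fderiv_apply_eq_sum] at hp2
  refine hp2.congr_deriv (Finset.sum_congr rfl fun α _ => ?_)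
  simp only [Pi.add_apply, Pi.smul_apply, smul_eq_mul]
  ring

/-- Differentiation under the integral along the rotation of a bounded function into an
integrable one. -/
lemma hasDerivAt_integral_rotation {Ω : Type*} [TopologicalSpace Ω] [MeasurableSpace Ω]
    [BorelSpace Ω] {ν : Measure Ω} [IsProbabilityMeasure ν] {X Y : Ω → Fin d → ℝ}
    (hX : AEMeasurable X ν) (hY : AEMeasurable Y ν)
    (hXi : ∀ α, Integrable (fun q => X q α) ν) (hYi : ∀ α, Integrable (fun q => Y q α) ν)
    {h : (Fin d → ℝ) → ℝ} (hh : Differentiable ℝ h) {D : ℝ}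
    (hc : ∀ α, Continuous fun w => fderiv ℝ h w (Pi.single α 1))
    (hD : ∀ α w, |fderiv ℝ h w (Pi.single α 1)| ≤ D) (t : ℝ) :
    HasDerivAt (fun t => ∫ q, h (Real.sin t • X q + Real.cos t • Y q) ∂ν)
      (∫ q, ∑ α, fderiv ℝ h (Real.sin t • X q + Real.cos t • Y q) (Pi.single α 1) *
        (Real.cos t * X q α - Real.sin t * Y q α) ∂ν) t := by
  have hbint : Integrable (fun q => ∑ α, D * (|X q α| + |Y q α|)) ν :=
    integrable_finsetSum _ fun α _ => ((hXi α).abs.add (hYi α).abs).const_mul D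
  have hlip := abs_sub_le_of_partial_le hh (fun w α => hD α w)
  have hpm : ∀ t : ℝ, AEMeasurable (fun q => Real.sin t • X q + Real.cos t • Y q) ν := fun t =>
    (hX.const_smul (Real.sin t)).add (hY.const_smul (Real.cos t))
  have hsin : ∀ (t r : ℝ), |Real.sin t * r| ≤ |r| := fun t r => by
    rw [abs_mul]
    exact mul_le_of_le_one_left (abs_nonneg _) (Real.abs_sin_le_one t)
  have hcos : ∀ (t r : ℝ), |Real.cos t * r| ≤ |r| := fun t r => by
    rw [abs_mul]
    exact mul_le_of_le_one_left (abs_nonneg _) (Real.abs_cos_le_one t)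
  have hm : ∀ t : ℝ, AEStronglyMeasurable (fun q => h (Real.sin t • X q + Real.cos t • Y q)) ν :=
    fun t => (hh.continuous.measurable.comp_aemeasurable (hpm t)).aestronglyMeasurable
  -- `h` may be unbounded, but its bounded gradient gives linear growth, and first moments exist.
  have hint : Integrable (fun q => h (Real.sin t • X q + Real.cos t • Y q)) ν := by
    have hbi : Integrable (fun q => |h 0| + ∑ α, D * (|X q α| + |Y q α|)) ν :=
      (integrable_const _).add hbint
    refine hbi.mono' (hm t) (Filter.Eventually.of_forall fun q => ?_)
    have a1 := hlip (Real.sin t • X q + Real.cos t • Y q) 0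
    have a2 : |h (Real.sin t • X q + Real.cos t • Y q)| ≤
        |h 0| + |h (Real.sin t • X q + Real.cos t • Y q) - h 0| := by
      have := abs_add_le (h 0) (h (Real.sin t • X q + Real.cos t • Y q) - h 0)
      rwa [add_sub_cancel] at this
    rw [Finset.mul_sum] at a1
    rw [Real.norm_eq_abs]
    refine a2.trans (add_le_add_right (a1.trans (Finset.sum_le_sum fun α _ => ?_)) _)
    apply mul_le_mul_of_nonneg_left _ ((abs_nonneg _).trans (hD α 0))
    simp only [Pi.add_apply, Pi.smul_apply, smul_eq_mul, Pi.zero_apply, sub_zero]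
    exact (abs_add_le _ _).trans (add_le_add (hsin t _) (hcos t _))
  have hm' : AEStronglyMeasurable (fun q =>
      ∑ α, fderiv ℝ h (Real.sin t • X q + Real.cos t • Y q) (Pi.single α 1) *
        (Real.cos t * X q α - Real.sin t * Y q α)) ν := by
    refine Finset.aestronglyMeasurable_fun_sum _ fun α _ => ?_
    exact ((hc α).measurable.comp_aemeasurable (hpm t)).aestronglyMeasurable.mul
      (((hXi α).aestronglyMeasurable.const_mul _).sub ((hYi α).aestronglyMeasurable.const_mul _))
  have hb : ∀ (q : Ω) (t : ℝ),
      ‖∑ α, fderiv ℝ h (Real.sin t • X q + Real.cos t • Y q) (Pi.single α 1) *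
        (Real.cos t * X q α - Real.sin t * Y q α)‖ ≤ ∑ α, D * (|X q α| + |Y q α|) := by
    intro q t
    rw [Real.norm_eq_abs]
    refine (Finset.abs_sum_le_sum_abs _ _).trans (Finset.sum_le_sum fun α _ => ?_)
    rw [abs_mul]
    refine mul_le_mul (hD α _) ?_ (abs_nonneg _) ((abs_nonneg _).trans (hD α 0))
    exact (abs_sub _ _).trans (add_le_add (hcos t _) (hsin t _))
  exact (hasDerivAt_integral_of_dominated_loc_of_deriv_le Filter.univ_mem
    (Filter.Eventually.of_forall hm) hint hm'
    (Filter.Eventually.of_forall fun q t _ => hb q t) hbint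
    (Filter.Eventually.of_forall fun q t _ => hasDerivAt_rotation hh (X q) (Y q) t)).2

lemma fderiv_comp_smul_add {g : (Fin d → ℝ) → ℝ} (hg : Differentiable ℝ g) (a : ℝ)
    (w₀ w : Fin d → ℝ) (β : Fin d) :
    fderiv ℝ (fun w => g (a • w + w₀)) w (Pi.single β 1) =
      a * fderiv ℝ g (a • w + w₀) (Pi.single β 1) := by
  have h3 : HasFDerivAt (fun w : Fin d → ℝ => a • w + w₀)
      (a • ContinuousLinearMap.id ℝ (Fin d → ℝ)) w :=
    ((hasFDerivAt_id w).const_smul a).add_const w₀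
  have h4 := ((hg (a • w + w₀)).hasFDerivAt.comp w h3).fderiv
  have h5 : fderiv ℝ (fun w => g (a • w + w₀)) w = _ := h4
  rw [h5]
  simp

/-- Along the rotation the Gaussian variable is frozen and becomes the translation `w₀`. The class
of test fields, with its constants, must be stable under this. -/
lemma IsTestField.comp_smul_add {D₁ D₂ D₃ : ℝ} {u : Fin d → (Fin d → ℝ) → ℝ} (hD₃ : 0 ≤ D₃)
    (hu : IsTestField D₁ D₂ D₃ u) {a : ℝ} (ha : |a| ≤ 1) (w₀ : Fin d → ℝ) :
    IsTestField D₁ D₂ D₃ fun α w => u α (a • w + w₀) := by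
  have hfd := fun α => fderiv_comp_smul_add (hu.differentiable α) a w₀
  refine ⟨fun α => (hu.differentiable α).comp (by fun_prop), fun α β => ?_,
    fun α w => hu.abs_le α _, fun α w β => ?_, fun α w w' β => ?_⟩
  · simp only [hfd]
    exact continuous_const.mul ((hu.continuous_partial α β).comp (by fun_prop))
  · rw [hfd, abs_mul]
    exact (mul_le_of_le_one_left (abs_nonneg _) ha).trans (hu.abs_partial_le α _ β)
  · rw [hfd, hfd, ← mul_sub, abs_mul]
    refine (mul_le_of_le_one_left (abs_nonneg _) ha).trans
      ((hu.abs_partial_sub_le α _ _ β).trans (mul_le_mul_of_nonneg_left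
        (Finset.sum_le_sum fun γ _ => ?_) hD₃))
    simp only [Pi.add_apply, Pi.smul_apply, smul_eq_mul, add_sub_add_right_eq_sub]
    rw [← mul_sub, abs_mul]
    exact mul_le_of_le_one_left (abs_nonneg _) ha

set_option maxHeartbeats 1000000 in
/-- Interpolation between the law of `V` and the normal distribution: an approximate Gaussian
integration by parts formula for `V` implies a normal approximation. -/
theorem abs_integral_sub_gaussExp_le {μ : Measure UnitAddCircle} [IsProbabilityMeasure μ]
    {V : UnitAddCircle → Fin d → ℝ} (hV : Continuous V) {S : Matrix (Fin d) (Fin d) ℝ}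
    (hS : S.PosDef) {h : (Fin d → ℝ) → ℝ} (hh : Differentiable ℝ h) {D₁ D₂ D₃ ε : ℝ}
    (hD₃ : 0 ≤ D₃) (hu : IsTestField D₁ D₂ D₃ fun α w => fderiv ℝ h w (Pi.single α 1))
    (hε : ∀ u : Fin d → (Fin d → ℝ) → ℝ, IsTestField D₁ D₂ D₃ u →
      |(∫ x, ∑ α, V x α * u α (V x) ∂μ) -
        ∑ α, ∑ β, S α β * ∫ x, fderiv ℝ (u α) (V x) (Pi.single β 1) ∂μ| ≤ ε) :
    |(∫ x, h (V x) ∂μ) - gaussExp S h| ≤ 2 * ε := by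
  obtain ⟨γ, hγ, hγE, hγi, hibp⟩ := exists_gaussian hS
  rw [hγE h hh.continuous]
  set h₁ : Fin d → (Fin d → ℝ) → ℝ := fun α w => fderiv ℝ h w (Pi.single α 1) with hh₁
  set h₂ : Fin d → Fin d → (Fin d → ℝ) → ℝ := fun α β w => fderiv ℝ (h₁ α) w (Pi.single β 1)
    with hh₂
  have hε0 : 0 ≤ ε := (abs_nonneg _).trans (hε _ hu)
  have h1c : ∀ α, Continuous (h₁ α) := fun α => (hu.differentiable α).continuous
  have h2c : ∀ α β, Continuous (h₂ α β) := fun α β => hu.continuous_partial α β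
  set ν := μ.prod γ with hν
  set p : ℝ → UnitAddCircle × (Fin d → ℝ) → Fin d → ℝ := fun t q =>
    Real.sin t • V q.1 + Real.cos t • q.2 with hp
  have hpc : ∀ t, Continuous (p t) := fun t => by fun_prop
  set φ : ℝ → ℝ := fun t => ∫ q, h (p t q) ∂ν with hφ
  set φ' : ℝ → ℝ := fun t =>
    ∫ q, ∑ α, h₁ α (p t q) * (Real.cos t * V q.1 α - Real.sin t * q.2 α) ∂ν with hφ'
  obtain ⟨b, hb⟩ := isCompact_univ.exists_bound_of_continuousOn hV.continuousOn
  have hVb : ∀ x α, |V x α| ≤ b := fun x α =>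
    (norm_le_pi_norm (V x) α).trans (hb x trivial)
  have hVi : ∀ α, Integrable (fun q : UnitAddCircle × (Fin d → ℝ) => V q.1 α) ν := fun α => by
    have : Continuous fun q : UnitAddCircle × (Fin d → ℝ) => V q.1 α := by fun_prop
    exact Integrable.of_bound this.aestronglyMeasurable b
      (Filter.Eventually.of_forall fun q => hVb q.1 α)
  have hzi : ∀ α, Integrable (fun q : UnitAddCircle × (Fin d → ℝ) => q.2 α) ν := fun α =>
    (hγi α).comp_snd μ
  have hbdd : ∀ {g : UnitAddCircle × (Fin d → ℝ) → ℝ} {c : ℝ} {G : UnitAddCircle × (Fin d → ℝ) → ℝ},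
      Integrable G ν → Continuous g → (∀ q, |g q| ≤ c) → Integrable (fun q => g q * G q) ν :=
    fun hG hg hc => hG.bdd_mul hg.aestronglyMeasurable (Filter.Eventually.of_forall hc)
  have hder : ∀ t, HasDerivAt φ (φ' t) t := fun t =>
    hasDerivAt_integral_rotation (hV.comp continuous_fst).measurable.aemeasurable
      measurable_snd.aemeasurable hVi hzi hh h1c hu.abs_le t
  -- The derivative pairs the gradient of `h` with `c V - a z`. Integration by parts in `z` yields
  -- `c G`, and the approximate formula for `V` yields `a G` up to `ε`, so the main terms `c (a G)`
  -- and `a (c G)` cancel.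
  have hbound : ∀ t, |φ' t| ≤ ε := by
    intro t
    set a := Real.sin t with ha
    set c := Real.cos t with hc
    have ha1 : |a| ≤ 1 := Real.abs_sin_le_one t
    have hc1 : |c| ≤ 1 := Real.abs_cos_le_one t
    have hF1 : ∀ α, Continuous fun q => h₁ α (p t q) := fun α => (h1c α).comp (hpc t)
    have hF2 : ∀ α β, Continuous fun q => h₂ α β (p t q) := fun α β => (h2c α β).comp (hpc t)
    have iV : ∀ α, Integrable (fun q => h₁ α (p t q) * V q.1 α) ν := fun α =>
      hbdd (hVi α) (hF1 α) fun q => hu.abs_le α _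
    have iz : ∀ α, Integrable (fun q => h₁ α (p t q) * q.2 α) ν := fun α =>
      hbdd (hzi α) (hF1 α) fun q => hu.abs_le α _
    have i2 : ∀ α β, Integrable (fun q => h₂ α β (p t q)) ν := fun α β =>
      Integrable.of_bound (hF2 α β).aestronglyMeasurable D₂
        (Filter.Eventually.of_forall fun q => hu.abs_partial_le α _ β)
    set G := ∑ α, ∑ β, S α β * ∫ q, h₂ α β (p t q) ∂ν with hG
    have e1 : φ' t = c * (∫ q, ∑ α, h₁ α (p t q) * V q.1 α ∂ν) -
        a * ∑ α, ∫ q, h₁ α (p t q) * q.2 α ∂ν := by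
      rw [← integral_finsetSum _ fun α _ => iz α, ← integral_const_mul, ← integral_const_mul,
        ← integral_sub ((integrable_finsetSum _ fun α _ => iV α).const_mul _)
          ((integrable_finsetSum _ fun α _ => iz α).const_mul _)]
      simp only [hφ']
      congr 1
      funext q
      rw [Finset.mul_sum, Finset.mul_sum, ← Finset.sum_sub_distrib]
      exact Finset.sum_congr rfl fun α _ => by ring
    have e2 : ∀ α, ∫ q, h₁ α (p t q) * q.2 α ∂ν = c * ∑ β, S α β * ∫ q, h₂ α β (p t q) ∂ν := by
      intro α
      rw [hν, integral_prod _ (iz α)]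
      have hx : ∀ x, ∫ z, h₁ α (p t (x, z)) * z α ∂γ =
          ∑ β, S α β * ∫ z, c * h₂ α β (p t (x, z)) ∂γ := by
        intro x
        set w₀ := a • V x
        have hfd : ∀ z β, fderiv ℝ (fun z => h₁ α (w₀ + c • z)) z (Pi.single β 1) =
            c * h₂ α β (w₀ + c • z) := by
          intro z β
          simp only [add_comm w₀]
          exact fderiv_comp_smul_add (hu.differentiable α) c w₀ z β
        have hdiff : Differentiable ℝ fun z => h₁ α (w₀ + c • z) :=
          (hu.differentiable α).comp (by fun_prop)
        have := hibp (fun z => h₁ α (w₀ + c • z)) hdiff D₁ D₂ (fun w => hu.abs_le α _)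
          (fun w β => by
            rw [hfd, abs_mul]
            exact (mul_le_of_le_one_left (abs_nonneg _) hc1).trans (hu.abs_partial_le α _ β)) α
        simp only [hfd] at this
        rw [← this]
        congr 1
        funext z
        exact mul_comm _ _
      simp_rw [hx, integral_const_mul]
      have i3 : ∀ β ∈ (Finset.univ : Finset (Fin d)),
          Integrable (fun x => S α β * (c * ∫ z, h₂ α β (p t (x, z)) ∂γ)) μ := fun β _ =>
        ((i2 α β).integral_prod_left.const_mul c).const_mul _
      rw [integral_finsetSum _ i3, Finset.mul_sum]
      refine Finset.sum_congr rfl fun β _ => ?_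
      rw [integral_const_mul, integral_const_mul, integral_prod _ (i2 α β)]
      ring
    have e3 : ∑ α, ∫ q, h₁ α (p t q) * q.2 α ∂ν = c * G := by
      simp_rw [e2]
      rw [hG, Finset.mul_sum]
    have e4 : |(∫ q, ∑ α, h₁ α (p t q) * V q.1 α ∂ν) - a * G| ≤ ε := by
      have e5 : (∫ q, ∑ α, h₁ α (p t q) * V q.1 α ∂ν) - a * G =
          ∫ z, ((∫ x, ∑ α, V x α * h₁ α (p t (x, z)) ∂μ) -
            ∑ α, ∑ β, S α β * ∫ x, a * h₂ α β (p t (x, z)) ∂μ) ∂γ := by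
        have i4 := integrable_finsetSum Finset.univ fun α _ => iV α
        have i5 : ∀ α β, Integrable (fun z => S α β * ∫ x, a * h₂ α β (p t (x, z)) ∂μ) γ :=
          fun α β => by
            simp_rw [integral_const_mul]
            exact ((i2 α β).integral_prod_right.const_mul a).const_mul _
        have i6 : Integrable (fun z => ∫ x, ∑ α, V x α * h₁ α (p t (x, z)) ∂μ) γ := by
          have := i4.integral_prod_right
          refine this.congr (Filter.Eventually.of_forall fun z => ?_)
          simp only [mul_comm]
        rw [integral_sub i6 (integrable_finsetSum _ fun α _ =>
          integrable_finsetSum _ fun β _ => i5 α β)]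
        congr 1
        · rw [hν, integral_prod_symm _ i4]
          simp only [mul_comm]
        · rw [integral_finsetSum _ fun α _ => integrable_finsetSum _ fun β _ => i5 α β, hG,
            Finset.mul_sum]
          refine Finset.sum_congr rfl fun α _ => ?_
          rw [integral_finsetSum _ fun β _ => i5 α β, Finset.mul_sum]
          refine Finset.sum_congr rfl fun β _ => ?_
          simp_rw [integral_const_mul]
          rw [hν, integral_prod_symm _ (i2 α β)]
          ring
      rw [e5]
      have hz : ∀ z, ‖(∫ x, ∑ α, V x α * h₁ α (p t (x, z)) ∂μ) -
          ∑ α, ∑ β, S α β * ∫ x, a * h₂ α β (p t (x, z)) ∂μ‖ ≤ ε := by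
        intro z
        set w₀ := c • z
        have hfd : ∀ α w β, fderiv ℝ (fun w => h₁ α (a • w + w₀)) w (Pi.single β 1) =
            a * h₂ α β (a • w + w₀) := fun α =>
          fderiv_comp_smul_add (hu.differentiable α) a w₀
        have htest := hu.comp_smul_add hD₃ ha1 w₀
        have := hε _ htest
        simp only [hfd] at this
        exact this
      have := norm_integral_le_of_norm_le_const (μ := γ) (Filter.Eventually.of_forall hz)
      simpa using this
    rw [e1, e3, show c * (∫ q, ∑ α, h₁ α (p t q) * V q.1 α ∂ν) - a * (c * G) =
      c * ((∫ q, ∑ α, h₁ α (p t q) * V q.1 α ∂ν) - a * G) by ring, abs_mul]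
    exact (mul_le_of_le_one_left (abs_nonneg _) hc1).trans e4
  have hmv := convex_univ.norm_image_sub_le_of_norm_hasDerivWithin_le (f := φ) (f' := φ') (C := ε)
    (fun t _ => (hder t).hasDerivWithinAt) (fun t _ => hbound t) (Set.mem_univ 0)
    (Set.mem_univ (Real.pi / 2))
  have e1 : φ (Real.pi / 2) = ∫ x, h (V x) ∂μ := by
    simp only [hφ, hp, Real.sin_pi_div_two, Real.cos_pi_div_two, one_smul, zero_smul, add_zero]
    rw [hν, integral_fun_fst (fun x => h (V x))]
    simp
  have e0 : φ 0 = ∫ w, h w ∂γ := by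
    simp only [hφ, hp, Real.sin_zero, Real.cos_zero, one_smul, zero_smul, zero_add]
    rw [hν, integral_fun_snd (fun z => h z)]
    simp
  rw [e1, e0, sub_zero, Real.norm_eq_abs, Real.norm_eq_abs,
    abs_of_pos (a := Real.pi / 2) (by positivity)] at hmv
  refine hmv.trans ?_
  -- The path has length `π / 2 < 2`.
  have := Real.pi_lt_four
  nlinarith

end smartPath

/-! ### Partial derivatives of the test function -/

section regularity

variable {d : ℕ} {h : (Fin d → ℝ) → ℝ}

lemma derivNorm_nonneg (k : ℕ) (h : (Fin d → ℝ) → ℝ) : 0 ≤ derivNorm k h :=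
  Real.iSup_nonneg fun _ => abs_nonneg _

lemma DerivBounded.abs_iteratedFDeriv_le {k : ℕ} (hb : DerivBounded k h) (w : Fin d → ℝ)
    (α : Fin k → Fin d) :
    |iteratedFDeriv ℝ k h w (fun i => Pi.single (α i) 1)| ≤ derivNorm k h :=
  le_ciSup hb (w, α)

lemma fderiv_iteratedFDeriv_apply {n : ℕ} (hd : Differentiable ℝ (iteratedFDeriv ℝ n h))
    (w : Fin d → ℝ) (α : Fin n → Fin d) (β : Fin d) :
    fderiv ℝ (fun w => iteratedFDeriv ℝ n h w fun i => Pi.single (α i) 1) w (Pi.single β 1) =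
      iteratedFDeriv ℝ (n + 1) h w fun i => Pi.single ((Fin.cons β α : Fin (n + 1) → Fin d) i) 1 := by
  have h1 := (((ContinuousMultilinearMap.apply ℝ (fun _ : Fin n => Fin d → ℝ) ℝ
    (fun i => Pi.single (α i) (1 : ℝ))).hasFDerivAt).comp w (hd w).hasFDerivAt).fderiv
  have h2 : fderiv ℝ (fun w => iteratedFDeriv ℝ n h w fun i => Pi.single (α i) 1) w = _ := h1
  rw [h2, iteratedFDeriv_succ_apply_left]
  simp only [Fin.cons_zero]
  rfl

lemma differentiable_iteratedFDeriv_apply {n : ℕ}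
    (hd : Differentiable ℝ (iteratedFDeriv ℝ n h)) (α : Fin n → Fin d) :
    Differentiable ℝ fun w => iteratedFDeriv ℝ n h w fun i => Pi.single (α i) 1 :=
  (ContinuousMultilinearMap.apply ℝ (fun _ : Fin n => Fin d → ℝ) ℝ
    (fun i => Pi.single (α i) (1 : ℝ))).differentiable.comp hd

lemma ThreeTimesDifferentiable.differentiable (hh : ThreeTimesDifferentiable h) :
    Differentiable ℝ h := by
  have := differentiable_iteratedFDeriv_apply (hh 0 (by norm_num)) Fin.elim0
  simpa only [iteratedFDeriv_zero_apply] using this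

/-- The gradient of a test function is a test field. -/
lemma ThreeTimesDifferentiable.isTestField (hh : ThreeTimesDifferentiable h)
    (hb₁ : DerivBounded 1 h) (hb₂ : DerivBounded 2 h) (hb₃ : DerivBounded 3 h) :
    IsTestField (derivNorm 1 h) (derivNorm 2 h) (derivNorm 3 h)
      fun α w => fderiv ℝ h w (Pi.single α 1) := by
  have e1 : ∀ α : Fin d, (fun w => fderiv ℝ h w (Pi.single α 1)) =
      fun w => iteratedFDeriv ℝ 1 h w
        fun i => Pi.single ((Fin.cons α Fin.elim0 : Fin 1 → Fin d) i) 1 := by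
    intro α
    funext w
    rw [← fderiv_iteratedFDeriv_apply (hh 0 (by norm_num))]
    simp only [iteratedFDeriv_zero_apply]
  have e2 : ∀ α β : Fin d, (fun w => fderiv ℝ (fun w => fderiv ℝ h w (Pi.single α 1)) w
      (Pi.single β 1)) = fun w => iteratedFDeriv ℝ 2 h w
        fun i => Pi.single ((Fin.cons β (Fin.cons α Fin.elim0) : Fin 2 → Fin d) i) 1 := by
    intro α β
    funext w
    rw [e1, fderiv_iteratedFDeriv_apply (hh 1 (by norm_num))]
  have hd2 := fun α β : Fin d => differentiable_iteratedFDeriv_apply (hh 2 (by norm_num))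
    (Fin.cons β (Fin.cons α Fin.elim0))
  refine ⟨fun α => ?_, fun α β => ?_, fun α w => ?_, fun α w β => ?_, fun α w w' β => ?_⟩
  · rw [e1]
    exact differentiable_iteratedFDeriv_apply (hh 1 (by norm_num)) _
  · rw [e2]
    exact (hd2 α β).continuous
  · rw [congrFun (e1 α) w]
    exact hb₁.abs_iteratedFDeriv_le w _
  · rw [congrFun (e2 α β) w]
    exact hb₂.abs_iteratedFDeriv_le w _
  -- Third derivatives need not be continuous: the mean value inequality on segments uses only their
  -- existence and bound.
  · rw [congrFun (e2 α β) w, congrFun (e2 α β) w']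
    refine abs_sub_le_of_partial_le (hd2 α β) (fun w γ => ?_) w w'
    rw [fderiv_iteratedFDeriv_apply (hh 2 (by norm_num))]
    exact hb₃.abs_iteratedFDeriv_le w _

end regularity

/-! ### Constants -/

section constants

variable {lam A : ℝ}

/-- A bound for the ratio of the window length and `log N`. -/
def windowConst (lam A : ℝ) : ℝ :=
  1 / (-Real.log (rate lam A)) + 1

/-- The constant in the decay of pair correlations. -/
def pairConst (lam A M L : ℝ) : ℝ :=
  24 * windowConst lam A * decorConst lam A L * M ^ 2 + 1

/-- The constant in the decay of quadruple correlations. -/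
def quadConst (lam A M L : ℝ) : ℝ :=
  40 * decorConst lam A L * M ^ 4 + 1

lemma neg_log_rate_pos (hl : 1 < lam) : 0 < -Real.log (rate lam A) :=
  neg_pos.2 (Real.log_neg (rate_pos hl) (rate_lt_one hl))

lemma one_le_windowConst (hl : 1 < lam) : 1 ≤ windowConst lam A :=
  le_add_of_nonneg_left (one_div_pos.2 (neg_log_rate_pos hl)).le

/-- `K` is `log N / (-log rate)` rounded up. The rounding is paid for by `1 ≤ log N` and the summand
`1` in `windowConst`. -/
lemma exists_window_length (hl : 1 < lam) {N : ℕ} (hN : 1 ≤ Real.log N) :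
    ∃ K : ℕ, 1 ≤ K ∧ rate lam A ^ K ≤ 1 / N ∧ (K : ℝ) ≤ windowConst lam A * Real.log N := by
  have hr := neg_log_rate_pos (A := A) hl
  have hN0 : (0 : ℝ) < N := by
    rcases Nat.eq_zero_or_pos N with rfl | h
    · norm_num at hN
    · exact_mod_cast h
  have hq : 0 < Real.log N / -Real.log (rate lam A) := div_pos (by linarith) hr
  refine ⟨⌈Real.log N / -Real.log (rate lam A)⌉₊, Nat.one_le_iff_ne_zero.2
    (Nat.ceil_pos.2 hq).ne', ?_, ?_⟩
  · have h1 := Nat.le_ceil (Real.log N / -Real.log (rate lam A))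
    rw [div_le_iff₀ hr] at h1
    rw [← Real.log_le_log_iff (pow_pos (rate_pos hl) _) (by positivity), Real.log_pow, one_div,
      Real.log_inv]
    linarith
  · have h1 := (Nat.ceil_lt_add_one hq.le).le
    refine h1.trans ?_
    rw [windowConst, add_mul, one_mul, div_eq_mul_one_div, mul_comm]
    linarith

lemma one_le_log_of_sixteen_le {N : ℕ} (hN : (16 : ℝ) ≤ N) : 1 ≤ Real.log N := by
  rw [Real.le_log_iff_exp_le (by linarith)]
  have := Real.exp_one_lt_d9
  linarith

/-- Here `C` stands for `decorConst` and `κ` for `windowConst`. Since `2 · 352 ≤ 30 · 24`, the first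
term of `cltConst` absorbs the part with `K`; since `12 = 4 · 3`, the `B₀` term absorbs the part
with `derivNorm 1 h`. This is the origin of the `24` in `pairConst` and of the choice `3 * C`. The
two other terms are nonnegative. -/
lemma error_le_cltConst {d : ℕ} (f : UnitAddCircle → Fin d → ℝ) (h : (Fin d → ℝ) → ℝ)
    {θ κ C ℓ c₄ K : ℝ} (hθ0 : 0 < θ) (hθ1 : θ < 1) (hC : 0 ≤ C) (hκ : 0 ≤ κ) (hℓ : 1 ≤ ℓ)
    (hK : K ≤ κ * ℓ) :
    2 * (6 * C * lipNorm f * d * derivNorm 1 h + 352 * C * lipNorm f ^ 2 * K / (1 - θ) * d ^ 3 *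
      (supNorm f * derivNorm 3 h + derivNorm 2 h)) ≤
    cltConst θ (24 * κ * C * lipNorm f ^ 2 + 1) c₄ (3 * C) f h * ℓ := by
  have h1 := derivNorm_nonneg 1 h
  have h2 := derivNorm_nonneg 2 h
  have h3 := derivNorm_nonneg 3 h
  have hM := lipNorm_nonneg f
  have hS := supNorm_nonneg f
  have hr : 0 < 1 - θ := sub_pos.2 hθ1
  set M := lipNorm f
  set Q := supNorm f * derivNorm 3 h + derivNorm 2 h with hQ
  have hQ0 : 0 ≤ Q := by positivity
  have a1 : 0 ≤ 2 * (d : ℝ) ^ 2 * derivNorm 2 h *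
      (M ^ 2 / (θ ^ (-(1 / 2) : ℝ) - θ ^ ((1 / 2) : ℝ))) := by
    have := Real.rpow_le_rpow_of_exponent_ge hθ0 hθ1.le (show (-(1 / 2) : ℝ) ≤ 1 / 2 by norm_num)
    have := sub_nonneg.2 this
    positivity
  have a2 : 0 ≤ 2 * (d : ℝ) * derivNorm 1 h * M / θ ^ ((1 / 2) : ℝ) := by positivity
  have a3 : 704 * C * M ^ 2 * κ / (1 - θ) * d ^ 3 * Q ≤
      30 * (d : ℝ) ^ 3 * max (24 * κ * C * M ^ 2 + 1) (Real.sqrt c₄) * Q / (1 - θ) ^ 2 := by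
    have b1 : 24 * κ * C * M ^ 2 ≤ max (24 * κ * C * M ^ 2 + 1) (Real.sqrt c₄) :=
      (le_add_of_nonneg_right zero_le_one).trans (le_max_left _ _)
    have b2 : 1 / (1 - θ) ≤ 1 / (1 - θ) ^ 2 := by
      apply one_div_le_one_div_of_le (by positivity)
      nlinarith
    calc 704 * C * M ^ 2 * κ / (1 - θ) * d ^ 3 * Q
        = 704 * (C * M ^ 2 * κ * d ^ 3 * Q * (1 / (1 - θ))) := by ring
      _ ≤ 720 * (C * M ^ 2 * κ * d ^ 3 * Q * (1 / (1 - θ) ^ 2)) := by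
        apply mul_le_mul (by norm_num) (mul_le_mul_of_nonneg_left b2 (by positivity))
          (by positivity) (by norm_num)
      _ = 30 * (d : ℝ) ^ 3 * Q * (1 / (1 - θ) ^ 2) * (24 * κ * C * M ^ 2) := by ring
      _ ≤ 30 * (d : ℝ) ^ 3 * Q * (1 / (1 - θ) ^ 2) *
          max (24 * κ * C * M ^ 2 + 1) (Real.sqrt c₄) :=
        mul_le_mul_of_nonneg_left b1 (by positivity)
      _ = _ := by ring
  have a4 : 704 * C * M ^ 2 * K / (1 - θ) * d ^ 3 * Q ≤
      704 * C * M ^ 2 * κ / (1 - θ) * d ^ 3 * Q * ℓ := by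
    have := mul_le_mul_of_nonneg_left hK
      (show 0 ≤ 704 * C * M ^ 2 / (1 - θ) * d ^ 3 * Q by positivity)
    calc _ = 704 * C * M ^ 2 / (1 - θ) * d ^ 3 * Q * K := by ring
      _ ≤ _ := this
      _ = _ := by ring
  have a5 : 12 * C * M * d * derivNorm 1 h ≤ 4 * d * (3 * C) * M * derivNorm 1 h * ℓ := by
    have := le_mul_of_one_le_right (show 0 ≤ 12 * C * M * d * derivNorm 1 h by positivity) hℓ
    linarith
  have a6 := mul_le_mul_of_nonneg_right a3 (zero_le_one.trans hℓ)
  have a7 := mul_nonneg a1 (zero_le_one.trans hℓ)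
  have a8 := mul_nonneg a2 (zero_le_one.trans hℓ)
  rw [cltConst, add_mul, add_mul, add_mul]
  have e : 2 * (6 * C * M * d * derivNorm 1 h + 352 * C * M ^ 2 * K / (1 - θ) * d ^ 3 * Q) =
      12 * C * M * d * derivNorm 1 h + 704 * C * M ^ 2 * K / (1 - θ) * d ^ 3 * Q := by ring
  rw [e]
  linarith

end constants

/-! ### The central limit theorem -/

section

variable {d : ℕ} {lam A : ℝ} {T : ℕ → UnitAddCircle → UnitAddCircle} {F : ℕ → ℝ → ℝ} {k : ℕ → ℕ}
  {ϱ : UnitAddCircle → ℝ} {L : ℝ} {f : UnitAddCircle → Fin d → ℝ} {κ : NNReal}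

/-- The central limit theorem with a rate of convergence. -/
theorem abs_integral_W_sub_gaussExp_le (hs : IsLiftedSystem lam A T F k) (hϱ : IsLogLipDensity ϱ)
    (hL : L = lipConst fun x => Real.log (ϱ x)) (hf : LipschitzWith κ f) {h : (Fin d → ℝ) → ℝ}
    (hh : ThreeTimesDifferentiable h) (hb₁ : DerivBounded 1 h) (hb₂ : DerivBounded 2 h)
    (hb₃ : DerivBounded 3 h) {N : ℕ} (hN : (16 : ℝ) ≤ N)
    (hS : (covMatrix (densityMeasure ϱ) T f N).PosDef) (c₄ : ℝ) :
    |(∫ x, h (W (densityMeasure ϱ) T f N x) ∂densityMeasure ϱ) -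
      gaussExp (covMatrix (densityMeasure ϱ) T f N) h| ≤
    cltConst (rate lam A) (pairConst lam A (lipNorm f) L) c₄ (3 * decorConst lam A L) f h *
      (N : ℝ) ^ (-(1 / 2) : ℝ) * Real.log N := by
  have hprob := isProbabilityMeasure_densityMeasure hϱ
  have hlog := one_le_log_of_sixteen_le hN
  have hN1 : 1 ≤ N := by
    have : (1 : ℝ) ≤ N := by linarith
    exact_mod_cast this
  obtain ⟨K, hK, hθK, hKl⟩ := exists_window_length (A := A) hs.one_lt hlog
  have hWc : Continuous (W (densityMeasure ϱ) T f N) :=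
    continuous_partialSum hs hf.continuous (1 / Real.sqrt N) (Finset.range N)
  have h1 := abs_integral_sub_gaussExp_le hWc hS hh.differentiable (derivNorm_nonneg 3 h)
    (hh.isTestField hb₁ hb₂ hb₃) fun u hu =>
    abs_stein_discrepancy_le hs hϱ hL hf (derivNorm_nonneg 2 h) (derivNorm_nonneg 3 h) hu hN1 hK hθK
  refine h1.trans ?_
  have hC := (decorConst_pos hs.one_lt hs.nonneg (hL ▸ lipConst_nonneg _)).le
  have h2 := error_le_cltConst f h (c₄ := c₄) (rate_pos (A := A) hs.one_lt)
    (rate_lt_one hs.one_lt) hC (zero_le_one.trans (one_le_windowConst (A := A) hs.one_lt)) hlog hKl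
  have e : (N : ℝ) ^ (-(1 / 2) : ℝ) = 1 / Real.sqrt N := by
    rw [Real.rpow_neg (by positivity), ← Real.sqrt_eq_rpow, one_div]
  rw [e, pairConst]
  have h3 := mul_le_mul_of_nonneg_left h2 (show 0 ≤ 1 / Real.sqrt N by positivity)
  linarith

end

end CircleCLT

end

theorem theorem3p1 :
    ∃ (ϑ : ℝ → ℝ → ℝ) (B₀ : ℝ → ℝ → ℝ → ℝ) (C₂ C₄ : ℝ → ℝ → ℝ → ℝ → ℝ),
      ∀ lam A : ℝ, 1 < lam → 0 ≤ A →
        0 < ϑ lam A ∧ ϑ lam A < 1 ∧ lam⁻¹ ≤ ϑ lam A ∧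
        (∀ L : ℝ, 0 ≤ L → 0 < B₀ lam A L) ∧
        (∀ M L : ℝ, 0 ≤ M → 0 ≤ L → 0 < C₂ lam A M L ∧ 0 < C₄ lam A M L) ∧
        ∀ (T : ℕ → UnitAddCircle → UnitAddCircle) (ϱ : UnitAddCircle → ℝ) (L₀ : ℝ),
          (∀ i, 1 ≤ i → CircleCLT.IsExpanding lam A (T i)) →
          CircleCLT.IsLogLipDensity ϱ →
          L₀ = CircleCLT.lipConst (fun x => Real.log (ϱ x)) →
          CircleCLT.MemoryLoss T ϱ (ϑ lam A) (B₀ lam A L₀) ∧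
          ∀ (d : ℕ) (f : UnitAddCircle → Fin d → ℝ), (∃ K, LipschitzWith K f) →
            CircleCLT.CorrelationDecay (CircleCLT.densityMeasure ϱ) T f (ϑ lam A)
              (C₂ lam A (CircleCLT.lipNorm f) L₀) (C₄ lam A (CircleCLT.lipNorm f) L₀) ∧
            ∀ h : (Fin d → ℝ) → ℝ,
              CircleCLT.ThreeTimesDifferentiable h →
              CircleCLT.DerivBounded 1 h → CircleCLT.DerivBounded 2 h →
              CircleCLT.DerivBounded 3 h →
              ∀ N : ℕ, 16 / (1 - ϑ lam A) ^ 2 ≤ (N : ℝ) →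
                (CircleCLT.covMatrix (CircleCLT.densityMeasure ϱ) T f N).PosDef →
                |(∫ x, h (CircleCLT.W (CircleCLT.densityMeasure ϱ) T f N x)
                      ∂(CircleCLT.densityMeasure ϱ))
                    - CircleCLT.gaussExp
                        (CircleCLT.covMatrix (CircleCLT.densityMeasure ϱ) T f N) h|
                  ≤ CircleCLT.cltConst (ϑ lam A) (C₂ lam A (CircleCLT.lipNorm f) L₀)
                      (C₄ lam A (CircleCLT.lipNorm f) L₀) (B₀ lam A L₀) f h
                    * (N : ℝ) ^ (-(1 / 2) : ℝ) * Real.log N := by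
  -- Each constant serves two estimates: `pairConst` bounds the pair correlations and contains the
  -- window length in units of `log N`, while `3 * decorConst` bounds the memory loss and the
  -- first-derivative error.
  refine ⟨CircleCLT.rate, fun lam A L => 3 * CircleCLT.decorConst lam A L, CircleCLT.pairConst,
    CircleCLT.quadConst, fun lam A hl hA => ?_⟩
  have hκ := CircleCLT.one_le_windowConst (A := A) hl
  have hθ0 := CircleCLT.rate_pos (A := A) hl
  have hθ1 := CircleCLT.rate_lt_one (A := A) hl
  refine ⟨hθ0, hθ1, CircleCLT.inv_le_rate, fun L hL => ?_, fun M L _ hL => ?_,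
    fun T ϱ L hT hϱ hL => ?_⟩
  · have := CircleCLT.decorConst_pos hl hA hL
    positivity
  · have := CircleCLT.decorConst_pos hl hA hL
    rw [CircleCLT.pairConst, CircleCLT.quadConst]
    constructor <;> positivity
  · obtain ⟨F, k, hs⟩ := CircleCLT.exists_isLiftedSystem hl hA hT
    have hC := CircleCLT.decorConst_pos hl hA (hL ▸ CircleCLT.lipConst_nonneg _)
    refine ⟨fun a b c ha hab hbc => ?_, fun d f hf => ?_⟩
    · refine (CircleCLT.memoryLoss hs hϱ hL a b c ha hab hbc).trans
        (mul_le_mul_of_nonneg_right ?_ (pow_nonneg hθ0.le _))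
      linarith
    · obtain ⟨κ, hf⟩ := hf
      refine ⟨CircleCLT.correlationDecay hs hϱ hL hf ?_ ?_, fun h hh hb₁ hb₂ hb₃ N hN hS => ?_⟩
      · have h1 := mul_le_mul_of_nonneg_left hκ
          (show 0 ≤ 24 * CircleCLT.decorConst lam A L * CircleCLT.lipNorm f ^ 2 by positivity)
        have h2 : 0 ≤ CircleCLT.decorConst lam A L * CircleCLT.lipNorm f ^ 2 := by positivity
        rw [CircleCLT.pairConst]
        linarith
      · rw [CircleCLT.quadConst]
        linarith
      · refine CircleCLT.abs_integral_W_sub_gaussExp_le hs hϱ hL hf hh hb₁ hb₂ hb₃ ?_ hS _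
        -- As `0 < 1 - ϑ < 1`, the assumption on `N` gives `16 ≤ N`, hence `1 ≤ log N`.
        refine le_trans ?_ hN
        rw [le_div_iff₀ (by have := sub_pos.2 hθ1; positivity)]
        nlinarith
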